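/- Let $d\ge 1$, $m\ge 0$, $\omega(\mathbf k)=\sqrt{|\mathbf k|^2+m^2}$ on $\mathbb R^d$, and let $\mathcal F=\bigoplus_{n\ge 0}\otimes_s^n L^2(\mathbb R^d)$ be the boson Fock space, with creation operators $(a^\dagger(f)\Psi)^{(0)}=0$, $(a^\dagger(f)\Psi)^{(n)}=\sqrt n\,S_n(f\otimes\Psi^{(n-1)})$ for $n\ge1$ (on the maximal domain; $S_n$ is the symmetrization operator), annihilation operators $a(f)=a^\dagger(f)^*$, Segal field operators $\phi_S(f)=\frac1{\sqrt2}\,\overline{a(f)+a^\dagger(f)}$, and free Hamiltonian $H_0=d\Gamma(\omega)$, that is, $(H_0\Psi)^{(n)}(\mathbf k_1,\dots,\mathbf k_n)=\sum_{j=1}^n\omega(\mathbf k_j)\Psi^{(n)}(\mathbf k_1,\dots,\mathbf k_n)$ on the maximal domain. Let $\chi_b:\mathbb R^d\to\mathbb C$ and $\chi_I:\mathbb R^d\to\mathbb R$ be measurable functions such that * (H.1) $\chi_b$, $\chi_b/\sqrt\omega$, $\chi_b/\omega\in L^2(\mathbb R^d)$; * (H.2) $\chi_I\in L^1(\mathbb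 R^d)$ and $\chi_I\ge 0$ almost everywhere. Put $\phi(\mathbf x)=\phi_S(\rho_{\mathbf x})$ with $\rho_{\mathbf x}(\mathbf k)=\frac{\chi_b(\mathbf k)}{\sqrt{\omega(\mathbf k)}}e^{-i\mathbf k\cdot\mathbf x}$, and let $H_I\Psi=\int_{\mathbb R^d}\chi_I(\mathbf x)\,\phi(\mathbf x)^4\Psi\,d\mathbf x$ (Bochner integral) on the domain of all $\Psi\in\mathcal F$ with $\int|\chi_I(\mathbf x)|\,\|\phi(\mathbf x)^4\Psi\|\,d\mathbf x<\infty$. For $\kappa>0$ let $H_\kappa=H_0+\kappa\overline{H_I}$ on $D(H_\kappa)=D(H_0)\cap D(\overline{H_I})$, where the bar denotes the closure. Put $$c_b=16\,\|\chi_I\|_{L^1}\|\chi_b\|_{L^2}^2\,\Big\|\frac{\chi_b}{\omega}\Big\|_{L^2}^2,\qquad d_b=\|\chi_I\|_{L^1}\|\chi_b\|_{L^2}^2\,\Big\|\frac{\chi_b}{\sqrt\omega}\Big\|_{L^2}^2 .$$ Then: 1. For all $\varepsilon>0$ and all $\Psi\in D(H_\kappa)$, $$(1-c_b\varepsilon\kappa)\|H_0\Psi\|^2+\|\kappa\overline{H_I}\Psi\|^2\le\|H_\kappa\Psi\|^2+\Big(4d_b+\frac{c_b}{4\varepsilon}\Big)\kappa\|\Psi\|^2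 .$$ 2. ($H$-bound) For all $\varepsilon>0$ with $c_b\varepsilon\kappa<1$ (that is, $\varepsilon<\frac1{c_b\kappa}$, which is no restriction if $c_b=0$) and all $\Psi\in D(H_\kappa)$, $$\|H_0\Psi\|^2+\|\kappa\overline{H_I}\Psi\|^2\le\lambda_{\varepsilon,\kappa}\|H_\kappa\Psi\|^2+\mu_{\varepsilon,\kappa}\|\Psi\|^2,$$ where $$\lambda_{\varepsilon,\kappa}=\frac1{1-c_b\varepsilon\kappa},\qquad \mu_{\varepsilon,\kappa}=\frac{\kappa}{1-c_b\varepsilon\kappa}\Big(4d_b+\frac{c_b}{4\varepsilon}\Big).$$ -/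

import Mathlib

open MeasureTheory
open scoped ENNReal

noncomputable section

namespace PhiFour

/-! ### Unbounded operators -/

section Operators

variable {H : Type*} [NormedAddCommGroup H] [InnerProductSpace ℂ H]

/-- The product `B A` of two (unbounded) operators on its natural domain
`{x ∈ D(A) | A x ∈ D(B)}`. -/
def opMul (B A : H →ₗ.[ℂ] H) : H →ₗ.[ℂ] H where
  domain := (B.domain.comap A.toFun).map A.domain.subtype
  toFun :=
    { toFun := fun x => B ⟨A ⟨x, by
          obtain ⟨y, _, hy⟩ := Submodule.mem_map.1 x.2
          rw [← hy]; exact y.2⟩, by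
          obtain ⟨y, hy, hyx⟩ := Submodule.mem_map.1 x.2
          have : y = ⟨x, by rw [← hyx]; exact y.2⟩ := Subtype.ext hyx
          rw [← this]; exact hy⟩
      map_add' := fun x y => by
        rw [← LinearPMap.map_add]
        congr 1
        ext1
        exact A.map_add ⟨x, _⟩ ⟨y, _⟩
      map_smul' := fun c x => by
        rw [RingHom.id_apply, ← LinearPMap.map_smul]
        congr 1
        ext1
        exact A.map_smul c ⟨x, _⟩ }

/-- The fourth power `A⁴` of an (unbounded) operator, on its natural domain. -/
def opPow4 (A : H →ₗ.[ℂ] H) : H →ₗ.[ℂ] H := opMul A (opMul A (opMul A A))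

open Classical in
/-- The vector `T x` for `x ∈ D(T)` (and `0` for `x ∉ D(T)`, a value which is never used below
with a nonzero weight). -/
def opVal (T : H →ₗ.[ℂ] H) (x : H) : H := if h : x ∈ T.domain then T ⟨x, h⟩ else 0

theorem opVal_add (T : H →ₗ.[ℂ] H) {x y : H} (hx : x ∈ T.domain) (hy : y ∈ T.domain) :
    opVal T (x + y) = opVal T x + opVal T y := by
  rw [opVal, opVal, opVal, dif_pos hx, dif_pos hy, dif_pos (T.domain.add_mem hx hy)]
  exact T.map_add ⟨x, hx⟩ ⟨y, hy⟩

theorem opVal_smul (T : H →ₗ.[ℂ] H) (c : ℂ) {x : H} (hx : x ∈ T.domain) :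
    opVal T (c • x) = c • opVal T x := by
  rw [opVal, opVal, dif_pos hx, dif_pos (T.domain.smul_mem c hx)]
  exact T.map_smul c ⟨x, hx⟩

/-- For a measure `ν`, a real weight `w` and a family of operators `T x`, the operator
`Ψ ↦ ∫ w(x) T(x) Ψ dν(x)` (Bochner integral), whose domain consists of all `Ψ` which lie in
`D(T(x))` for almost every `x` with `w(x) ≠ 0` and for which the integrand is Bochner
integrable. -/
def opIntegral {X : Type*} [MeasurableSpace X] (ν : Measure X) (w : X → ℝ)
    (T : X → (H →ₗ.[ℂ] H)) : H →ₗ.[ℂ] H where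
  domain :=
    { carrier := {Ψ | (∀ᵐ x ∂ν, w x ≠ 0 → Ψ ∈ (T x).domain) ∧
        Integrable (fun x => (w x : ℂ) • opVal (T x) Ψ) ν}
      zero_mem' := by
        refine ⟨Filter.Eventually.of_forall fun x _ => (T x).domain.zero_mem, ?_⟩
        have : (fun x => (w x : ℂ) • opVal (T x) (0 : H)) = fun _ => 0 := by
          funext x
          have h := opVal_smul (T x) 0 (T x).domain.zero_mem
          rw [zero_smul, zero_smul] at h
          rw [h, smul_zero]
        rw [this]
        exact integrable_zero _ _ _
      add_mem' := by
        rintro Ψ Φ ⟨h1, h2⟩ ⟨h3, h4⟩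
        refine ⟨?_, (h2.add h4).congr ?_⟩
        · filter_upwards [h1, h3] with x hx hy hw
          exact (T x).domain.add_mem (hx hw) (hy hw)
        · filter_upwards [h1, h3] with x hx hy
          by_cases hw : w x = 0
          · simp [hw]
          · simp only [Pi.add_apply]
            rw [opVal_add _ (hx hw) (hy hw), smul_add]
      smul_mem' := by
        rintro c Ψ ⟨h1, h2⟩
        refine ⟨?_, (h2.smul c).congr ?_⟩
        · filter_upwards [h1] with x hx hw
          exact (T x).domain.smul_mem c (hx hw)
        · filter_upwards [h1] with x hx
          by_cases hw : w x = 0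
          · simp [hw]
          · simp only [Pi.smul_apply]
            rw [opVal_smul _ c (hx hw), smul_comm] }
  toFun :=
    { toFun := fun Ψ => ∫ x, (w x : ℂ) • opVal (T x) (Ψ : H) ∂ν
      map_add' := by
        rintro ⟨Ψ, h1, h2⟩ ⟨Φ, h3, h4⟩
        rw [← integral_add h2 h4]
        refine integral_congr_ae ?_
        filter_upwards [h1, h3] with x hx hy
        by_cases hw : w x = 0
        · simp [hw]
        · simp only [Submodule.coe_add]
          rw [opVal_add _ (hx hw) (hy hw), smul_add]
      map_smul' := by
        rintro c ⟨Ψ, h1, h2⟩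
        rw [RingHom.id_apply, ← integral_smul]
        refine integral_congr_ae ?_
        filter_upwards [h1] with x hx
        by_cases hw : w x = 0
        · simp [hw]
        · simp only [Submodule.coe_smul]
          rw [opVal_smul _ c (hx hw), smul_comm] }

end Operators

/-- The direct sum `⨁ₙ Tₙ` of operators on the Hilbert space direct sum of the spaces `Gₙ`, on
its natural domain `{Ψ | Ψₙ ∈ D(Tₙ) for all n, ∑ₙ ‖Tₙ Ψₙ‖² < ∞}`. -/
def opDirectSum {G : ℕ → Type*} [∀ n, NormedAddCommGroup (G n)] [∀ n, InnerProductSpace ℂ (G n)]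
    (T : ∀ n, G n →ₗ.[ℂ] G n) : lp G 2 →ₗ.[ℂ] lp G 2 where
  domain :=
    { carrier := {Ψ | ∃ h : ∀ n, Ψ n ∈ (T n).domain, Memℓp (fun n => T n ⟨Ψ n, h n⟩) 2}
      zero_mem' := by
        refine ⟨fun n => (T n).domain.zero_mem, ?_⟩
        have : (fun n => T n ⟨(0 : lp G 2) n, (T n).domain.zero_mem⟩) = fun n => (0 : G n) := by
          funext n
          exact (T n).map_zero
        rw [this]
        exact zero_memℓp
      add_mem' := by
        rintro Ψ Φ ⟨h1, h2⟩ ⟨h3, h4⟩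
        refine ⟨fun n => (T n).domain.add_mem (h1 n) (h3 n), ?_⟩
        have := h2.add h4
        convert this using 1
        funext n
        exact (T n).map_add ⟨Ψ n, h1 n⟩ ⟨Φ n, h3 n⟩
      smul_mem' := by
        rintro c Ψ ⟨h1, h2⟩
        refine ⟨fun n => (T n).domain.smul_mem c (h1 n), ?_⟩
        have := h2.const_smul c
        convert this using 1
        funext n
        exact (T n).map_smul c ⟨Ψ n, h1 n⟩ }
  toFun :=
    { toFun := fun Ψ => ⟨fun n => T n ⟨(Ψ : lp G 2) n, Ψ.2.choose n⟩, Ψ.2.choose_spec⟩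
      map_add' := fun Ψ Φ => by
        ext1
        funext n
        exact (T n).map_add ⟨(Ψ : lp G 2) n, Ψ.2.choose n⟩ ⟨(Φ : lp G 2) n, Φ.2.choose n⟩
      map_smul' := fun c Ψ => by
        ext1
        funext n
        exact (T n).map_smul c ⟨(Ψ : lp G 2) n, Ψ.2.choose n⟩ }

/-! ### Boson Fock space over `L²(ℝᵈ)` -/

/-- Momentum (or position) space `ℝᵈ` with its Euclidean norm. -/
abbrev Rd (d : ℕ) : Type := EuclideanSpace ℝ (Fin d)

/-- `⊗ⁿ L²(ℝᵈ)`, realised as `L²((ℝᵈ)ⁿ)`; for `n = 0` the measure is a unit point mass, so the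
space is `ℂ`. -/
abbrev L2n (d n : ℕ) : Type := Lp ℂ 2 (volume : Measure (Fin n → Rd d))

theorem measurePreserving_perm (d : ℕ) {n : ℕ} (σ : Equiv.Perm (Fin n)) :
    MeasurePreserving (fun (k : Fin n → Rd d) (i : Fin n) => k (σ i)) volume volume := by
  have h := volume_measurePreserving_piCongrLeft (fun _ : Fin n => Rd d) σ.symm
  convert h using 1
  funext k i
  have := Equiv.piCongrLeft_apply_apply (fun _ : Fin n => Rd d) σ.symm k (σ i)
  rw [Equiv.symm_apply_apply] at this
  exact this.symm

/-- The unitary `(U_σ u)(k₁, …, kₙ) = u(k_σ(1), …, k_σ(n))`. -/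
def permute (d : ℕ) {n : ℕ} (σ : Equiv.Perm (Fin n)) : L2n d n →ₗᵢ[ℂ] L2n d n :=
  Lp.compMeasurePreservingₗᵢ ℂ _ (measurePreserving_perm d σ)

theorem permute_coeFn {d n : ℕ} (σ : Equiv.Perm (Fin n)) (u : L2n d n) :
    permute d σ u =ᵐ[volume] fun k => u (fun i => k (σ i)) :=
  Lp.coeFn_compMeasurePreserving u (measurePreserving_perm d σ)

theorem permute_permute {d n : ℕ} (σ τ : Equiv.Perm (Fin n)) (u : L2n d n) :
    permute d τ (permute d σ u) = permute d (τ * σ) u := by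
  refine Lp.ext ?_
  filter_upwards [permute_coeFn τ (permute d σ u), permute_coeFn (τ * σ) u,
    (measurePreserving_perm d τ).quasiMeasurePreserving.ae (permute_coeFn σ u)] with k h1 h2 h3
  rw [h1, h2, h3]
  rfl

/-- The `n`-fold symmetric tensor product `⊗ₛⁿ L²(ℝᵈ)`: permutation invariant elements of
`L²((ℝᵈ)ⁿ)`. -/
def symL2 (d n : ℕ) : Submodule ℂ (L2n d n) where
  carrier := {u | ∀ σ : Equiv.Perm (Fin n), permute d σ u = u}
  zero_mem' := fun σ => map_zero _
  add_mem' := fun hu hv σ => by rw [map_add, hu σ, hv σ]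
  smul_mem' := fun c u hu σ => by rw [map_smul, hu σ]

instance instCompleteSpaceSymL2 (d n : ℕ) : CompleteSpace (symL2 d n) := by
  have h : IsClosed (symL2 d n : Set (L2n d n)) := by
    have : (symL2 d n : Set (L2n d n)) =
        ⋂ σ : Equiv.Perm (Fin n), {u | permute d σ u = u} := by
      ext u
      simp [symL2]
    rw [this]
    exact isClosed_iInter fun σ => isClosed_eq (permute d σ).continuous continuous_id
  exact h.completeSpace_coe

/-- The symmetrization operator `Sₙ = (1/n!) ∑_σ U_σ` from `⊗ⁿ L²(ℝᵈ)` onto `⊗ₛⁿ L²(ℝᵈ)`. -/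
def symmetrize (d n : ℕ) : L2n d n →ₗ[ℂ] symL2 d n :=
  LinearMap.codRestrict (symL2 d n)
    ((n.factorial : ℂ)⁻¹ • ∑ σ : Equiv.Perm (Fin n), (permute d σ).toLinearMap) (by
      intro u τ
      rw [LinearMap.smul_apply, map_smul, LinearMap.sum_apply, map_sum]
      congr 1
      refine Fintype.sum_equiv (Equiv.mulLeft τ) _ _ fun σ => ?_
      exact permute_permute σ τ u)

/-- The boson Fock space `⨁ₙ ⊗ₛⁿ L²(ℝᵈ)` (Hilbert space direct sum). -/
abbrev Fock (d : ℕ) : Type := lp (fun n => symL2 d n) 2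

/-! ### Creation, annihilation and field operators -/

theorem memLp_tensor {d n : ℕ} (f : Lp ℂ 2 (volume : Measure (Rd d))) (u : L2n d n) :
    MemLp (fun k : Fin (n + 1) → Rd d => f (k 0) * u (fun i => k i.succ)) 2 volume := by
  have hmp := volume_preserving_piFinSuccAbove (fun _ : Fin (n + 1) => Rd d) 0
  have h : MemLp (fun z : Rd d × (Fin n → Rd d) => f z.1 * u z.2) 2
      ((volume : Measure (Rd d)).prod volume) := by
    have hf := Lp.memLp f
    have hu := Lp.memLp u
    refine (memLp_two_iff_integrable_sq_norm (hf.1.comp_fst.mul hu.1.comp_snd)).2 ?_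
    have := Integrable.mul_prod ((memLp_two_iff_integrable_sq_norm hf.1).1 hf)
      ((memLp_two_iff_integrable_sq_norm hu.1).1 hu)
    refine this.congr (Filter.Eventually.of_forall fun z => ?_)
    simp only [Pi.mul_apply, norm_mul, mul_pow]
  exact h.comp_measurePreserving hmp

/-- The linear map `u ↦ f ⊗ u` from `⊗ⁿ L²(ℝᵈ)` to `⊗ⁿ⁺¹ L²(ℝᵈ)`. -/
def tensorLeft {d : ℕ} (n : ℕ) (f : Lp ℂ 2 (volume : Measure (Rd d))) :
    L2n d n →ₗ[ℂ] L2n d (n + 1) where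
  toFun u := (memLp_tensor f u).toLp _
  map_add' u v := by
    rw [← MemLp.toLp_add]
    refine MemLp.toLp_congr _ _ ?_
    have hmp : Measure.QuasiMeasurePreserving
        (fun (k : Fin (n + 1) → Rd d) (i : Fin n) => k i.succ) volume volume :=
      (Measure.quasiMeasurePreserving_snd (μ := (volume : Measure (Rd d)))
        (ν := (volume : Measure (Fin n → Rd d)))).comp
        (volume_preserving_piFinSuccAbove
          (fun _ : Fin (n + 1) => Rd d) 0).quasiMeasurePreserving
    filter_upwards [hmp.ae (Lp.coeFn_add u v)] with k hk
    simp only [hk, Pi.add_apply, mul_add]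
  map_smul' c u := by
    rw [RingHom.id_apply, ← MemLp.toLp_const_smul]
    refine MemLp.toLp_congr _ _ ?_
    have hmp : Measure.QuasiMeasurePreserving
        (fun (k : Fin (n + 1) → Rd d) (i : Fin n) => k i.succ) volume volume :=
      (Measure.quasiMeasurePreserving_snd (μ := (volume : Measure (Rd d)))
        (ν := (volume : Measure (Fin n → Rd d)))).comp
        (volume_preserving_piFinSuccAbove
          (fun _ : Fin (n + 1) => Rd d) 0).quasiMeasurePreserving
    filter_upwards [hmp.ae (Lp.coeFn_smul c u)] with k hk
    simp only [hk, Pi.smul_apply, smul_eq_mul]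
    ring

/-- The components of `a†(f) Ψ`: `(a†(f) Ψ)⁽⁰⁾ = 0` and
`(a†(f) Ψ)⁽ⁿ⁺¹⁾ = √(n+1) Sₙ₊₁ (f ⊗ Ψ⁽ⁿ⁾)`. -/
def creationSeq {d : ℕ} (f : Lp ℂ 2 (volume : Measure (Rd d))) (Ψ : Fock d) :
    ∀ n, symL2 d n
  | 0 => 0
  | n + 1 => (Real.sqrt (n + 1) : ℂ) • symmetrize d (n + 1) (tensorLeft n f (Ψ n : L2n d n))

theorem creationSeq_add {d : ℕ} (f : Lp ℂ 2 (volume : Measure (Rd d))) (Ψ Φ : Fock d) (n : ℕ) :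
    creationSeq f (Ψ + Φ) n = creationSeq f Ψ n + creationSeq f Φ n := by
  cases n with
  | zero => simp [creationSeq]
  | succ n =>
    simp only [creationSeq]
    rw [lp.coeFn_add, Pi.add_apply, Submodule.coe_add, map_add, map_add, smul_add]

theorem creationSeq_smul {d : ℕ} (f : Lp ℂ 2 (volume : Measure (Rd d))) (c : ℂ) (Ψ : Fock d)
    (n : ℕ) : creationSeq f (c • Ψ) n = c • creationSeq f Ψ n := by
  cases n with
  | zero => simp [creationSeq]
  | succ n =>
    simp only [creationSeq]
    rw [lp.coeFn_smul, Pi.smul_apply, Submodule.coe_smul, map_smul, map_smul, smul_comm]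

/-- The creation operator `a†(f)`, on its natural (maximal) domain. -/
def creation {d : ℕ} (f : Lp ℂ 2 (volume : Measure (Rd d))) : Fock d →ₗ.[ℂ] Fock d where
  domain :=
    { carrier := {Ψ | Memℓp (creationSeq f Ψ) 2}
      zero_mem' := by
        have : creationSeq f 0 = fun n => 0 := by
          funext n
          have h := creationSeq_smul f 0 0 n
          rwa [zero_smul, zero_smul] at h
        rw [Set.mem_ofPred_eq, this]
        exact zero_memℓp
      add_mem' := by
        intro Ψ Φ h1 h2
        have : creationSeq f (Ψ + Φ) = creationSeq f Ψ + creationSeq f Φ :=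
          funext (creationSeq_add f Ψ Φ)
        rw [Set.mem_ofPred_eq, this]
        exact Memℓp.add h1 h2
      smul_mem' := by
        intro c Ψ h
        have : creationSeq f (c • Ψ) = c • creationSeq f Ψ := funext (creationSeq_smul f c Ψ)
        rw [Set.mem_ofPred_eq, this]
        exact Memℓp.const_smul h c }
  toFun :=
    { toFun := fun Ψ => ⟨creationSeq f Ψ, Ψ.2⟩
      map_add' := fun Ψ Φ => by
        ext1
        exact funext (creationSeq_add f Ψ Φ)
      map_smul' := fun c Ψ => by
        ext1
        exact funext (creationSeq_smul f c Ψ) }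

/-- The annihilation operator `a(f) = (a†(f))*`. -/
def annihilation {d : ℕ} (f : Lp ℂ 2 (volume : Measure (Rd d))) : Fock d →ₗ.[ℂ] Fock d :=
  (creation f).adjoint

/-- The Segal field operator, `1/√2` times the closure of `a(f) + a†(f)`. -/
def segalField {d : ℕ} (f : Lp ℂ 2 (volume : Measure (Rd d))) : Fock d →ₗ.[ℂ] Fock d :=
  ((Real.sqrt 2 : ℂ)⁻¹) • (annihilation f + creation f).closure

/-! ### Second quantization of a multiplication operator -/

/-- The function `(h(k₁) + ⋯ + h(kₙ)) u(k₁, …, kₙ)`. -/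
def sumMulFun {d n : ℕ} (h : Rd d → ℝ) (u : L2n d n) (k : Fin n → Rd d) : ℂ :=
  ((∑ j, h (k j) : ℝ) : ℂ) * u k

theorem sumMulFun_add {d n : ℕ} (h : Rd d → ℝ) (u v : L2n d n) :
    sumMulFun h (u + v) =ᵐ[volume] sumMulFun h u + sumMulFun h v := by
  filter_upwards [Lp.coeFn_add u v] with k hk
  rw [sumMulFun, hk, Pi.add_apply, Pi.add_apply, mul_add]
  rfl

theorem sumMulFun_smul {d n : ℕ} (h : Rd d → ℝ) (c : ℂ) (u : L2n d n) :
    sumMulFun h (c • u) =ᵐ[volume] c • sumMulFun h u := by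
  filter_upwards [Lp.coeFn_smul c u] with k hk
  rw [sumMulFun, hk, Pi.smul_apply, Pi.smul_apply, smul_eq_mul, smul_eq_mul, sumMulFun]
  ring

theorem sumMulFun_mem {d n : ℕ} (h : Rd d → ℝ) (u : symL2 d n)
    (hu : MemLp (sumMulFun h (u : L2n d n)) 2 volume) : hu.toLp _ ∈ symL2 d n := by
  intro σ
  refine Lp.ext ?_
  have h5 : permute d σ (u : L2n d n) = u := u.2 σ
  filter_upwards [permute_coeFn σ (hu.toLp _),
    (measurePreserving_perm d σ).quasiMeasurePreserving.ae (MemLp.coeFn_toLp hu),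
    MemLp.coeFn_toLp hu, permute_coeFn σ (u : L2n d n)] with k h1 h2 h3 h4
  rw [h5] at h4
  rw [h1, h2, h3, sumMulFun, sumMulFun, h4, Equiv.sum_comp σ (fun j => h (k j))]

/-- The maximal domain of multiplication by `h(k₁) + ⋯ + h(kₙ)` on `⊗ₛⁿ L²(ℝᵈ)`. -/
def sumMulDomain (d : ℕ) (h : Rd d → ℝ) (n : ℕ) : Submodule ℂ (symL2 d n) where
  carrier := {u | MemLp (sumMulFun h (u : L2n d n)) 2 volume}
  zero_mem' := by
    have h0 := sumMulFun_smul h 0 (0 : L2n d n)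
    rw [zero_smul, zero_smul] at h0
    exact (MemLp.zero (ε := ℂ)).ae_eq h0.symm
  add_mem' := fun {u v} hu hv =>
    (MemLp.add hu hv).ae_eq (sumMulFun_add h (u : L2n d n) (v : L2n d n)).symm
  smul_mem' := fun c u hu =>
    (MemLp.const_smul hu c).ae_eq (sumMulFun_smul h c (u : L2n d n)).symm

theorem memLp_of_mem_sumMulDomain {d n : ℕ} {h : Rd d → ℝ} (u : sumMulDomain d h n) :
    MemLp (sumMulFun h u.1.1) 2 volume := u.2

/-- The map underlying `sumMul` below. -/
def sumMulToFun {d n : ℕ} (h : Rd d → ℝ) (u : sumMulDomain d h n) : symL2 d n :=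
  ⟨(memLp_of_mem_sumMulDomain u).toLp _, sumMulFun_mem h u.1 (memLp_of_mem_sumMulDomain u)⟩

theorem sumMulToFun_add {d n : ℕ} (h : Rd d → ℝ) (u v : sumMulDomain d h n) :
    sumMulToFun h (u + v) = sumMulToFun h u + sumMulToFun h v := by
  refine Subtype.ext ?_
  refine Eq.trans ?_
    (MemLp.toLp_add (memLp_of_mem_sumMulDomain u) (memLp_of_mem_sumMulDomain v))
  exact MemLp.toLp_congr (memLp_of_mem_sumMulDomain (u + v)) _ (sumMulFun_add h _ _)

theorem sumMulToFun_smul {d n : ℕ} (h : Rd d → ℝ) (c : ℂ) (u : sumMulDomain d h n) :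
    sumMulToFun h (c • u) = c • sumMulToFun h u := by
  refine Subtype.ext ?_
  refine Eq.trans ?_ (MemLp.toLp_const_smul c (memLp_of_mem_sumMulDomain u))
  exact MemLp.toLp_congr (memLp_of_mem_sumMulDomain (c • u)) _ (sumMulFun_smul h c _)

/-- Multiplication by `h(k₁) + ⋯ + h(kₙ)` on `⊗ₛⁿ L²(ℝᵈ)` with its maximal domain, that is
`∑ⱼ 1 ⊗ ⋯ ⊗ h ⊗ ⋯ ⊗ 1` for the multiplication operator `h` (zero for `n = 0`). -/
def sumMul (d : ℕ) (h : Rd d → ℝ) (n : ℕ) : symL2 d n →ₗ.[ℂ] symL2 d n where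
  domain := sumMulDomain d h n
  toFun :=
    { toFun := sumMulToFun h
      map_add' := sumMulToFun_add h
      map_smul' := sumMulToFun_smul h }

/-- The second quantization `dΓ(h)` of the operator of multiplication by `h`. -/
def secondQuantization (d : ℕ) (h : Rd d → ℝ) : Fock d →ₗ.[ℂ] Fock d :=
  opDirectSum (sumMul d h)

/-! ### The `φ⁴` Hamiltonian with cutoffs -/

/-- The dispersion relation `ω(k) = √(k² + m²)`. -/
def omega (d : ℕ) (m : ℝ) (k : Rd d) : ℝ := Real.sqrt (‖k‖ ^ 2 + m ^ 2)

/-- The free Hamiltonian `H₀ = dΓ(ω)`. -/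
def freeHamiltonian (d : ℕ) (m : ℝ) : Fock d →ₗ.[ℂ] Fock d :=
  secondQuantization d (omega d m)

/-- `ρₓ(k) = χ_b(k) ω(k)^(-1/2) exp(-i k·x)`. -/
def rho {d : ℕ} (m : ℝ) (χb : Rd d → ℂ) (x : Rd d) (k : Rd d) : ℂ :=
  χb k / (Real.sqrt (omega d m k) : ℂ) * Complex.exp (-Complex.I * (inner ℝ k x : ℝ))

open Classical in
/-- The class in `L²(ℝᵈ)` of a square integrable function (and `0` for other functions). -/
def toL2 {d : ℕ} (f : Rd d → ℂ) : Lp ℂ 2 (volume : Measure (Rd d)) :=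
  if h : MemLp f 2 volume then h.toLp f else 0

/-- The field operator `φ(x) = φ_S(ρₓ)`. -/
def field {d : ℕ} (m : ℝ) (χb : Rd d → ℂ) (x : Rd d) : Fock d →ₗ.[ℂ] Fock d :=
  segalField (toL2 (rho m χb x))

/-- The interaction `H_I Ψ = ∫ χ_I(x) φ(x)⁴ Ψ dx`. -/
def interaction {d : ℕ} (m : ℝ) (χb : Rd d → ℂ) (χI : Rd d → ℝ) : Fock d →ₗ.[ℂ] Fock d :=
  opIntegral volume χI fun x => opPow4 (field m χb x)

/-- The scaled interaction `κ` times the closure of `H_I`. -/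
def scaledInteraction {d : ℕ} (m : ℝ) (χb : Rd d → ℂ) (χI : Rd d → ℝ) (κ : ℝ) :
    Fock d →ₗ.[ℂ] Fock d :=
  (κ : ℂ) • (interaction m χb χI).closure

/-- The total Hamiltonian `H_κ`, the sum of `H₀` and the scaled interaction on the intersection
of their domains. -/
def hamiltonian {d : ℕ} (m : ℝ) (χb : Rd d → ℂ) (χI : Rd d → ℝ) (κ : ℝ) :
    Fock d →ₗ.[ℂ] Fock d :=
  freeHamiltonian d m + scaledInteraction m χb χI κ

/-- The `L²` norm of `χ_b / √ω ^ l`. -/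
def cutoffNorm {d : ℕ} (m : ℝ) (χb : Rd d → ℂ) (l : ℕ) : ℝ :=
  (eLpNorm (fun k => χb k / (Real.sqrt (omega d m k) : ℂ) ^ l) 2 volume).toReal

/-- `c_b = 16 ‖χ_I‖_{L¹} ‖χ_b‖² ‖χ_b/ω‖²`. -/
def cb {d : ℕ} (m : ℝ) (χb : Rd d → ℂ) (χI : Rd d → ℝ) : ℝ :=
  16 * (∫ x, |χI x|) * cutoffNorm m χb 0 ^ 2 * cutoffNorm m χb 2 ^ 2

/-- `d_b = ‖χ_I‖_{L¹} ‖χ_b‖² ‖χ_b/√ω‖²`. -/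
def db {d : ℕ} (m : ℝ) (χb : Rd d → ℂ) (χI : Rd d → ℝ) : ℝ :=
  (∫ x, |χI x|) * cutoffNorm m χb 0 ^ 2 * cutoffNorm m χb 1 ^ 2

/-- `λ_{ε,κ} = 1 / (1 - c_b ε κ)`. -/
def lambdaConst {d : ℕ} (m : ℝ) (χb : Rd d → ℂ) (χI : Rd d → ℝ) (ε κ : ℝ) : ℝ :=
  1 / (1 - cb m χb χI * ε * κ)

/-- `μ_{ε,κ} = κ / (1 - c_b ε κ) (4 d_b + c_b / (4 ε))`. -/
def muConst {d : ℕ} (m : ℝ) (χb : Rd d → ℂ) (χI : Rd d → ℝ) (ε κ : ℝ) : ℝ :=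
  κ / (1 - cb m χb χI * ε * κ) * (4 * db m χb χI + cb m χb χI / (4 * ε))

end PhiFour

end

open scoped NNReal

noncomputable section

namespace PhiFour

/-! ### Integration over the first momentum variable -/

/-! Expanding the square of `H₀Ψ + κ H_I Ψ` reduces the theorem to a lower bound for the cross term
`Re ⟨H₀Ψ, H_I Ψ⟩`. Put `s = a(ρₓ) + a†(ρₓ) = √2 φ(x)`. Formally `[[H₀, s], s]` is the scalar `-2 ‖√ω
ρₓ‖² = -2 ‖χ_b‖²`, and moving `H₀` between the two copies of `s²` gives `Re ⟨H₀Ψ, s⁴Ψ⟩ ≥ -4 ‖χ_b‖²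
‖sΨ‖²`, the discarded term being `⟨s²Ψ, H₀ s²Ψ⟩ ≥ 0`. Next, `‖sΨ‖² ≤ 4 ‖χ_b/ω‖² ⟨Ψ, H₀Ψ⟩ + 2
‖χ_b/√ω‖² ‖Ψ‖²`. Integrating against `χ_I ≥ 0` and applying Young's inequality to `⟨Ψ, H₀Ψ⟩ ≤ ‖Ψ‖
‖H₀Ψ‖` produces `c_b` and `d_b`.

For a general `Ψ` in the domain these products need not make sense, so `H₀` is replaced by `(1 -
exp(-t H₀)) / t` and applied to a truncation of `Ψ` to finitely many particles. The resulting vector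
`Φ` is a finite-particle vector, and against such vectors the closed interaction is computed weakly:
`⟨Φ, H_I Ψ⟩ = ∫ χ_I ⟨s⁴Φ, Ψ⟩ / 4` (`inner_closure_interaction`). No closability and no core is
needed.

The semigroup satisfies exact relations with creation and annihilation operators: commuting it
through `a(f)` replaces `f` by `exp(-t ω) f`. Hence the double commutator of `exp(-t H₀)` with `s`
is explicit, and `HeatRelations.sub_re_inner_eq` is the rigorous form of the formal identity. Its
leading part is `2 ⟨f - exp(-t ω) f, f⟩ exp(-t H₀)`, of size `t ‖χ_b‖²`; everything else is `o(t)`,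
by the relative bounds `norm_ann_le` and `norm_ann_ann_le` and by smoothing
(`fieldSum_commutator_bound`). Truncation is handled in `re_inner_fieldSum_pow_four_ge`, and
`re_inner_ge_of_trunc` removes first the particle cutoff and then `t`. -/

/-- The one-particle space `L²(ℝᵈ)`. -/
abbrev HL2 (d : ℕ) : Type := Lp ℂ 2 (volume : Measure (Rd d))

/-- The identification of `(ℝᵈ)ⁿ × ℝᵈ` with `(ℝᵈ)ⁿ⁺¹`, the last factor becoming the first
variable. -/
def consEquiv (d n : ℕ) : (Fin n → Rd d) × Rd d ≃ᵐ (Fin (n + 1) → Rd d) :=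
  MeasurableEquiv.prodComm.trans (MeasurableEquiv.piFinSuccAbove (fun _ => Rd d) 0).symm

theorem consEquiv_apply {d n : ℕ} (p : (Fin n → Rd d) × Rd d) :
    consEquiv d n p = Fin.cons p.2 p.1 := by
  rw [← Fin.insertNth_zero']
  rfl

theorem measurePreserving_cons (d n : ℕ) :
    MeasurePreserving (consEquiv d n) (volume.prod volume) volume :=
  (volume_preserving_piFinSuccAbove (fun _ : Fin (n + 1) => Rd d) 0).symm.comp
    Measure.measurePreserving_swap

theorem measurable_cons (d n : ℕ) :
    Measurable fun p : (Fin n → Rd d) × Rd d => (Fin.cons p.2 p.1 : Fin (n + 1) → Rd d) := by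
  have h := (consEquiv d n).measurable
  have h2 : (consEquiv d n : _ → _) =
      fun p : (Fin n → Rd d) × Rd d => (Fin.cons p.2 p.1 : Fin (n + 1) → Rd d) :=
    funext consEquiv_apply
  rwa [h2] at h

theorem ae_ae_cons {d n : ℕ} {P : (Fin (n + 1) → Rd d) → Prop} (h : ∀ᵐ k, P k) :
    ∀ᵐ x : Fin n → Rd d, ∀ᵐ y : Rd d, P (Fin.cons y x) := by
  have h2 := (measurePreserving_cons d n).quasiMeasurePreserving.ae h
  have h3 := Measure.ae_ae_of_ae_prod h2
  simpa only [consEquiv_apply] using h3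

theorem lintegral_cons {d n : ℕ} {F : (Fin (n + 1) → Rd d) → ℝ≥0∞} (hF : Measurable F) :
    ∫⁻ k, F k = ∫⁻ x : Fin n → Rd d, ∫⁻ y : Rd d, F (Fin.cons y x) := by
  rw [← (measurePreserving_cons d n).lintegral_comp hF, lintegral_prod]
  · simp only [consEquiv_apply]
  · exact (hF.comp (consEquiv d n).measurable).aemeasurable

theorem integral_cons {d n : ℕ} {F : (Fin (n + 1) → Rd d) → ℂ} (hF : Integrable F) :
    ∫ k, F k = ∫ x : Fin n → Rd d, ∫ y : Rd d, F (Fin.cons y x) := by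
  rw [← (measurePreserving_cons d n).integral_comp (consEquiv d n).measurableEmbedding,
    integral_prod]
  · simp only [consEquiv_apply]
  · exact (measurePreserving_cons d n).integrable_comp_of_integrable hF

theorem quasiMeasurePreserving_tail (d n : ℕ) : Measure.QuasiMeasurePreserving
    (fun (k : Fin (n + 1) → Rd d) (i : Fin n) => k i.succ) volume volume :=
  (Measure.quasiMeasurePreserving_snd (μ := (volume : Measure (Rd d)))
    (ν := (volume : Measure (Fin n → Rd d)))).comp
    (volume_preserving_piFinSuccAbove
      (fun _ : Fin (n + 1) => Rd d) 0).quasiMeasurePreserving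

theorem quasiMeasurePreserving_head (d n : ℕ) : Measure.QuasiMeasurePreserving
    (fun (k : Fin (n + 1) → Rd d) => k 0) volume volume :=
  (Measure.quasiMeasurePreserving_fst (μ := (volume : Measure (Rd d)))
    (ν := (volume : Measure (Fin n → Rd d)))).comp
    (volume_preserving_piFinSuccAbove
      (fun _ : Fin (n + 1) => Rd d) 0).quasiMeasurePreserving

theorem enorm_sq_eq_lintegral {X : Type*} [MeasurableSpace X] {μ : Measure X} (u : Lp ℂ 2 μ) :
    ‖u‖ₑ ^ 2 = ∫⁻ x, ‖u x‖ₑ ^ 2 ∂μ := by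
  rw [Lp.enorm_def, eLpNorm_eq_lintegral_rpow_enorm_toReal (by norm_num) (by norm_num)]
  simp only [ENNReal.toReal_ofNat, ENNReal.rpow_ofNat, one_div]
  rw [← ENNReal.rpow_ofNat, ← ENNReal.rpow_mul]
  norm_num

theorem memLp_two_of_lintegral_lt_top {X : Type*} [MeasurableSpace X] {μ : Measure X} {F : X → ℂ}
    (hF : AEStronglyMeasurable F μ) (h : ∫⁻ x, ‖F x‖ₑ ^ 2 ∂μ < ∞) : MemLp F 2 μ := by
  refine ⟨hF, ?_⟩
  rw [eLpNorm_eq_lintegral_rpow_enorm_toReal (by norm_num) (by norm_num)]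
  simp only [ENNReal.toReal_ofNat, ENNReal.rpow_ofNat, one_div]
  exact ENNReal.rpow_lt_top_of_nonneg (by norm_num) h.ne

theorem sq_lintegral_mul_le {Y : Type*} [MeasurableSpace Y] {ν : Measure Y} {F G : Y → ℝ≥0∞}
    (hF : AEMeasurable F ν) (hG : AEMeasurable G ν) :
    (∫⁻ y, F y * G y ∂ν) ^ 2 ≤ (∫⁻ y, F y ^ 2 ∂ν) * ∫⁻ y, G y ^ 2 ∂ν := by
  have h := ENNReal.lintegral_mul_le_Lp_mul_Lq ν Real.HolderConjugate.two_two hF hG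
  simp only [Pi.mul_apply, ENNReal.rpow_ofNat, one_div] at h
  calc (∫⁻ y, F y * G y ∂ν) ^ 2
      ≤ ((∫⁻ y, F y ^ 2 ∂ν) ^ (2 : ℝ)⁻¹ * (∫⁻ y, G y ^ 2 ∂ν) ^ (2 : ℝ)⁻¹) ^ 2 := by gcongr
    _ = _ := by
      rw [mul_pow, ← ENNReal.rpow_ofNat, ← ENNReal.rpow_mul, ← ENNReal.rpow_ofNat,
        ← ENNReal.rpow_mul]
      norm_num

/-- Weighted Cauchy-Schwarz inequality for the partial inner product `∫ conj f(y) G(x, y) dy`. -/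
theorem lintegral_contract_le {X Y : Type*} [MeasurableSpace X] [MeasurableSpace Y]
    (μ : Measure X) (ν : Measure Y) [SFinite ν]
    {f : Y → ℂ} {s F : Y → ℝ≥0∞} (hs : Measurable s) (hF : AEMeasurable F ν)
    (hf : ∀ᵐ y ∂ν, ‖f y‖ₑ ≤ F y * s y) {G : X × Y → ℂ} (hG : Measurable G) {W : X → ℝ≥0∞}
    (hW : Measurable W) :
    ∫⁻ x, W x * ‖∫ y, (starRingEnd ℂ) (f y) * G (x, y) ∂ν‖ₑ ^ 2 ∂μ ≤
      (∫⁻ y, F y ^ 2 ∂ν) * ∫⁻ x, W x * ∫⁻ y, s y ^ 2 * ‖G (x, y)‖ₑ ^ 2 ∂ν ∂μ := by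
  have hm : Measurable fun x => ∫⁻ y, s y ^ 2 * ‖G (x, y)‖ₑ ^ 2 ∂ν := by
    refine Measurable.lintegral_prod_right' (f := fun p : X × Y => s p.2 ^ 2 * ‖G p‖ₑ ^ 2) ?_
    fun_prop
  have hWm : Measurable fun x => W x * ∫⁻ y, s y ^ 2 * ‖G (x, y)‖ₑ ^ 2 ∂ν := hW.mul hm
  rw [← lintegral_const_mul _ hWm]
  refine lintegral_mono fun x => ?_
  rw [mul_left_comm]
  refine mul_le_mul_right ?_ _
  have hG' : Measurable fun y => G (x, y) := by fun_prop
  calc ‖∫ y, (starRingEnd ℂ) (f y) * G (x, y) ∂ν‖ₑ ^ 2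
      ≤ (∫⁻ y, F y * (s y * ‖G (x, y)‖ₑ) ∂ν) ^ 2 := by
        gcongr
        refine (enorm_integral_le_lintegral_enorm _).trans (lintegral_mono_ae ?_)
        filter_upwards [hf] with y hy
        rw [enorm_mul, ← mul_assoc, RCLike.enorm_conj]
        gcongr
    _ ≤ (∫⁻ y, F y ^ 2 ∂ν) * ∫⁻ y, (s y * ‖G (x, y)‖ₑ) ^ 2 ∂ν :=
        -- The factor `s` of `f` is shifted onto `G`, so only the quotient `F` has to be square
        -- integrable.
        sq_lintegral_mul_le hF (hs.mul hG'.enorm).aemeasurable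
    _ = _ := by simp only [mul_pow]

/-! ### The operator `u ↦ f ⊗ u` and its adjoint -/

theorem tensorLeft_coeFn {d n : ℕ} (f : HL2 d) (u : L2n d n) :
    tensorLeft n f u =ᵐ[volume] fun k => f (k 0) * u (fun i => k i.succ) :=
  MemLp.coeFn_toLp (memLp_tensor f u)

theorem inner_tensorLeft {d n : ℕ} (f : HL2 d) (w : L2n d n) (v : L2n d (n + 1)) :
    inner ℂ (tensorLeft n f w) v =
      ∫ x, (starRingEnd ℂ) (w x) * ∫ y, (starRingEnd ℂ) (f y) * v (Fin.cons y x) := by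
  have h1 : inner ℂ (tensorLeft n f w) v =
      ∫ k, (starRingEnd ℂ) (w (fun i => k i.succ)) * ((starRingEnd ℂ) (f (k 0)) * v k) := by
    rw [L2.inner_def]
    refine integral_congr_ae ?_
    filter_upwards [tensorLeft_coeFn f w] with k hk
    rw [hk, RCLike.inner_apply, map_mul]
    ring
  have h2 : Integrable fun k : Fin (n + 1) → Rd d =>
      (starRingEnd ℂ) (w (fun i => k i.succ)) * ((starRingEnd ℂ) (f (k 0)) * v k) := by
    refine (L2.integrable_inner (𝕜 := ℂ) (tensorLeft n f w) v).congr ?_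
    filter_upwards [tensorLeft_coeFn f w] with k hk
    rw [hk, RCLike.inner_apply, map_mul]
    ring
  rw [h1, integral_cons h2]
  refine integral_congr_ae (Filter.Eventually.of_forall fun x => ?_)
  simp only [Fin.cons_succ, Fin.cons_zero]
  rw [integral_const_mul]

theorem memLp_contract {d n : ℕ} (f : HL2 d) (v : L2n d (n + 1)) :
    MemLp (fun x : Fin n → Rd d => ∫ y, (starRingEnd ℂ) (f y) * v (Fin.cons y x)) 2 volume := by
  have hv : Measurable fun p : (Fin n → Rd d) × Rd d => v (Fin.cons p.2 p.1) :=
    (Lp.stronglyMeasurable v).measurable.comp (measurable_cons d n)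
  refine memLp_two_of_lintegral_lt_top ?_ ?_
  · have h : Measurable fun p : (Fin n → Rd d) × Rd d =>
        (starRingEnd ℂ) (f p.2) * v (Fin.cons p.2 p.1) := by
      have hf := (Lp.stronglyMeasurable f).measurable
      refine Measurable.mul ?_ hv
      exact (RCLike.continuous_conj.measurable).comp (hf.comp measurable_snd)
    exact (h.stronglyMeasurable.integral_prod_right').aestronglyMeasurable
  · have h := lintegral_contract_le (volume : Measure (Fin n → Rd d)) (volume : Measure (Rd d))
      (f := f) (s := fun _ => 1) (F := fun y => ‖f y‖ₑ) (W := fun _ => 1) measurable_const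
      (Lp.aestronglyMeasurable f).enorm (by simp) hv measurable_const
    simp only [one_mul, one_pow] at h
    refine h.trans_lt ?_
    rw [← enorm_sq_eq_lintegral, ← lintegral_cons (F := fun k => ‖v k‖ₑ ^ 2)
      ((Lp.stronglyMeasurable v).measurable.enorm.pow_const 2), ← enorm_sq_eq_lintegral]
    exact ENNReal.mul_lt_top (ENNReal.pow_lt_top enorm_lt_top) (ENNReal.pow_lt_top enorm_lt_top)

/-- The partial inner product `x ↦ ∫ conj f(y) v(y, x) dy`. -/
def contract {d : ℕ} (n : ℕ) (f : HL2 d) (v : L2n d (n + 1)) : L2n d n :=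
  (memLp_contract f v).toLp _

theorem contract_coeFn {d n : ℕ} (f : HL2 d) (v : L2n d (n + 1)) :
    contract n f v =ᵐ[volume] fun x => ∫ y, (starRingEnd ℂ) (f y) * v (Fin.cons y x) :=
  MemLp.coeFn_toLp (memLp_contract f v)

/-- Contraction is the adjoint of tensoring. Most of the algebra of annihilation operators below is
obtained from that of `f ⊗ u` by this duality. -/
theorem inner_tensorLeft_left {d n : ℕ} (f : HL2 d) (w : L2n d n) (v : L2n d (n + 1)) :
    inner ℂ (tensorLeft n f w) v = inner ℂ w (contract n f v) := by
  rw [inner_tensorLeft, L2.inner_def]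
  refine integral_congr_ae ?_
  filter_upwards [contract_coeFn f v] with x hx
  rw [hx, RCLike.inner_apply, mul_comm]

theorem inner_tensorLeft_right {d n : ℕ} (f : HL2 d) (w : L2n d n) (v : L2n d (n + 1)) :
    inner ℂ v (tensorLeft n f w) = inner ℂ (contract n f v) w := by
  rw [← inner_conj_symm, inner_tensorLeft_left, inner_conj_symm]

theorem contract_tensorLeft {d n : ℕ} (f g : HL2 d) (u : L2n d n) :
    contract n f (tensorLeft n g u) = (inner ℂ f g : ℂ) • u := by
  refine Lp.ext ?_
  filter_upwards [contract_coeFn f (tensorLeft n g u), Lp.coeFn_smul (inner ℂ f g : ℂ) u,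
    ae_ae_cons (tensorLeft_coeFn g u)] with x h1 h2 h3
  rw [h1, h2, Pi.smul_apply, smul_eq_mul, L2.inner_def, ← integral_mul_const]
  refine integral_congr_ae ?_
  filter_upwards [h3] with y hy
  rw [hy, RCLike.inner_apply]
  simp only [Fin.cons_succ, Fin.cons_zero]
  ring

/-- After the swap, the integrated variable sits in the first slot of `v` and `g` carries the next
variable, so the contraction passes through `g`. This is the source of the `a†(g) a(f)` term in the
commutation relations. -/
theorem contract_swap_tensorLeft {d n : ℕ} (f g : HL2 d) (v : L2n d (n + 1)) :
    contract (n + 1) f (permute d (Equiv.swap 0 1) (tensorLeft (n + 1) g v)) =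
      tensorLeft n g (contract n f v) := by
  refine Lp.ext ?_
  filter_upwards [contract_coeFn f (permute d (Equiv.swap 0 1) (tensorLeft (n + 1) g v)),
    tensorLeft_coeFn g (contract n f v),
    (quasiMeasurePreserving_tail d n).ae (contract_coeFn f v),
    ae_ae_cons (permute_coeFn (Equiv.swap 0 1) (tensorLeft (n + 1) g v)),
    ae_ae_cons ((measurePreserving_perm d (Equiv.swap (0 : Fin (n + 2)) 1)).quasiMeasurePreserving.ae
      (tensorLeft_coeFn g v))] with x h1 h2 h3 h4 h5
  rw [h1, h2, h3, ← integral_const_mul]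
  refine integral_congr_ae ?_
  filter_upwards [h4, h5] with y h6 h7
  rw [h6, h7, Equiv.swap_apply_left, ← Fin.succ_zero_eq_one, Fin.cons_succ]
  have : (fun i : Fin (n + 1) => (Fin.cons y x : Fin (n + 2) → Rd d)
      (Equiv.swap 0 (Fin.succ 0) i.succ)) = Fin.cons y fun i => x i.succ := by
    funext i
    refine Fin.cases ?_ (fun j => ?_) i
    · rw [Equiv.swap_apply_right, Fin.cons_zero, Fin.cons_zero]
    · rw [Equiv.swap_apply_of_ne_of_ne (Fin.succ_ne_zero _)
        (fun h => Fin.succ_ne_zero _ (Fin.succ_injective _ h)), Fin.cons_succ, Fin.cons_succ]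
  rw [this]
  ring

/-! ### Creation and annihilation operators between the `n`-particle spaces -/

theorem permute_one {d n : ℕ} (u : L2n d n) : permute d 1 u = u := by
  refine Lp.ext ?_
  filter_upwards [permute_coeFn 1 u] with k hk
  rw [hk]
  rfl

theorem inner_permute_left {d n : ℕ} (σ : Equiv.Perm (Fin n)) (u v : L2n d n) :
    inner ℂ (permute d σ u) v = inner ℂ u (permute d σ⁻¹ v) := by
  have h : permute d σ (permute d σ⁻¹ v) = v := by
    rw [permute_permute, mul_inv_cancel, permute_one]
  conv_lhs => rw [← h]
  exact (permute d σ).inner_map_map _ _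

/-! ### Cosets of the stabilizer of the first variable -/

/-- The extension of a permutation of `{0, …, n-1}` to `{0, …, n}` fixing `0`. -/
def extPerm {n : ℕ} (e : Equiv.Perm (Fin n)) : Equiv.Perm (Fin (n + 1)) :=
  Equiv.Perm.decomposeFin.symm (0, e)

theorem extPerm_zero {n : ℕ} (e : Equiv.Perm (Fin n)) : extPerm e 0 = 0 := by
  simp [extPerm]

theorem extPerm_succ {n : ℕ} (e : Equiv.Perm (Fin n)) (i : Fin n) :
    extPerm e i.succ = (e i).succ := by
  simp [extPerm]

theorem decomposeFin_symm_eq {n : ℕ} (p : Fin (n + 1)) (e : Equiv.Perm (Fin n)) :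
    Equiv.Perm.decomposeFin.symm (p, e) = Equiv.swap 0 p * extPerm e := by
  ext i
  refine Fin.cases ?_ (fun j => ?_) i
  · simp [extPerm_zero]
  · simp [extPerm_succ]

theorem permute_extPerm_tensorLeft {d n : ℕ} (e : Equiv.Perm (Fin n)) (f : HL2 d) (u : L2n d n) :
    permute d (extPerm e) (tensorLeft n f u) = tensorLeft n f (permute d e u) := by
  refine Lp.ext ?_
  filter_upwards [permute_coeFn (extPerm e) (tensorLeft n f u), tensorLeft_coeFn f (permute d e u),
    (measurePreserving_perm d (extPerm e)).quasiMeasurePreserving.ae (tensorLeft_coeFn f u),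
    (quasiMeasurePreserving_tail d n).ae (permute_coeFn e u)] with k h1 h2 h3 h4
  rw [h1, h2, h3, h4, extPerm_zero]
  simp only [extPerm_succ]

/-- Since `u` is symmetric, permutations fixing `0` leave `f ⊗ u` unchanged. The `(n+1)!` terms
therefore collapse to `n+1` cosets, represented by the transpositions `(0 p)`, each counted `n!`
times. -/
theorem symmetrize_tensorLeft {d n : ℕ} (f : HL2 d) (u : symL2 d n) :
    (symmetrize d (n + 1) (tensorLeft n f (u : L2n d n)) : L2n d (n + 1)) =
      ((n : ℂ) + 1)⁻¹ • ∑ p : Fin (n + 1), permute d (Equiv.swap 0 p) (tensorLeft n f (u : L2n d n)) := by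
  have h : (symmetrize d (n + 1) (tensorLeft n f (u : L2n d n)) : L2n d (n + 1)) =
      (((n + 1).factorial : ℂ)⁻¹) • ∑ σ : Equiv.Perm (Fin (n + 1)),
        permute d σ (tensorLeft n f (u : L2n d n)) := by
    have h0 : (symmetrize d (n + 1) (tensorLeft n f (u : L2n d n)) : L2n d (n + 1)) =
        ((((n + 1).factorial : ℂ)⁻¹) • ∑ σ : Equiv.Perm (Fin (n + 1)), (permute d σ).toLinearMap)
          (tensorLeft n f (u : L2n d n)) := rfl
    rw [h0, LinearMap.smul_apply, LinearMap.sum_apply]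
    rfl
  rw [h, ← Equiv.sum_comp Equiv.Perm.decomposeFin.symm, Fintype.sum_prod_type]
  have h2 : ∀ p : Fin (n + 1), ∑ e : Equiv.Perm (Fin n),
      permute d (Equiv.Perm.decomposeFin.symm (p, e)) (tensorLeft n f (u : L2n d n)) =
      (n.factorial : ℂ) • permute d (Equiv.swap 0 p) (tensorLeft n f (u : L2n d n)) := by
    intro p
    have h3 : ∀ e : Equiv.Perm (Fin n),
        permute d (Equiv.Perm.decomposeFin.symm (p, e)) (tensorLeft n f (u : L2n d n)) =
        permute d (Equiv.swap 0 p) (tensorLeft n f (u : L2n d n)) := fun e => by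
      rw [decomposeFin_symm_eq, ← permute_permute, permute_extPerm_tensorLeft, u.2 e]
    rw [Finset.sum_congr rfl fun e _ => h3 e, Finset.sum_const, Finset.card_univ, Fintype.card_perm,
      Fintype.card_fin, ← Nat.cast_smul_eq_nsmul ℂ]
  rw [Finset.sum_congr rfl fun p _ => h2 p, ← Finset.smul_sum, smul_smul]
  congr 1
  have := Nat.factorial_ne_zero n
  have h4 : (n.factorial : ℂ) ≠ 0 := by exact_mod_cast this
  have h5 : ((n : ℂ) + 1) ≠ 0 := by exact_mod_cast n.succ_ne_zero
  rw [Nat.factorial_succ]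
  push_cast
  field_simp

/-- Each transposition can be moved onto `v`, which absorbs it. -/
theorem inner_symmetrize_tensorLeft {d n : ℕ} (f : HL2 d) (u : symL2 d n) (v : symL2 d (n + 1)) :
    inner ℂ (symmetrize d (n + 1) (tensorLeft n f (u : L2n d n))) v =
      inner ℂ (tensorLeft n f (u : L2n d n)) (v : L2n d (n + 1)) := by
  rw [Submodule.coe_inner, symmetrize_tensorLeft, inner_smul_left, sum_inner]
  have h : ∀ p : Fin (n + 1), inner ℂ (permute d (Equiv.swap 0 p) (tensorLeft n f (u : L2n d n)))
      (v : L2n d (n + 1)) = inner ℂ (tensorLeft n f (u : L2n d n)) (v : L2n d (n + 1)) := by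
    intro p
    rw [inner_permute_left, v.2]
  have h5 : ((n : ℂ) + 1) ≠ 0 := by exact_mod_cast n.succ_ne_zero
  rw [Finset.sum_congr rfl fun p _ => h p, Finset.sum_const, Finset.card_univ, Fintype.card_fin,
    nsmul_eq_mul]
  simp only [map_inv₀, map_add, map_natCast, map_one]
  push_cast
  field_simp

/-- Tested against `w`, a permutation of the remaining variables becomes a permutation of all
variables fixing `0`, under which `v` is invariant. -/
theorem contract_mem {d n : ℕ} (f : HL2 d) (v : symL2 d (n + 1)) :
    contract n f (v : L2n d (n + 1)) ∈ symL2 d n := by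
  intro σ
  refine ext_inner_left ℂ fun w => ?_
  have h := inner_permute_left σ⁻¹ w (contract n f (v : L2n d (n + 1)))
  rw [inv_inv] at h
  rw [← h, ← inner_tensorLeft_left, ← permute_extPerm_tensorLeft, inner_permute_left, v.2,
    inner_tensorLeft_left]

theorem contract_add {d n : ℕ} (f : HL2 d) (u v : L2n d (n + 1)) :
    contract n f (u + v) = contract n f u + contract n f v := by
  refine ext_inner_left ℂ fun w => ?_
  simp only [inner_add_right, ← inner_tensorLeft_left]

theorem contract_smul {d n : ℕ} (f : HL2 d) (c : ℂ) (u : L2n d (n + 1)) :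
    contract n f (c • u) = c • contract n f u := by
  refine ext_inner_left ℂ fun w => ?_
  simp only [inner_smul_right, ← inner_tensorLeft_left]

theorem tensorLeft_sub_left {d n : ℕ} (f g : HL2 d) (u : L2n d n) :
    tensorLeft n (f - g) u = tensorLeft n f u - tensorLeft n g u := by
  refine Lp.ext ?_
  filter_upwards [tensorLeft_coeFn (f - g) u, tensorLeft_coeFn f u, tensorLeft_coeFn g u,
    Lp.coeFn_sub (tensorLeft n f u) (tensorLeft n g u),
    (quasiMeasurePreserving_head d n).ae (Lp.coeFn_sub f g)] with k h1 h2 h3 h4 h5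
  rw [h1, h4, Pi.sub_apply, h2, h3, h5, Pi.sub_apply, sub_mul]

/-- The creation operator from the `n`-particle space to the `(n+1)`-particle space. -/
def sectorCreate {d : ℕ} (n : ℕ) (f : HL2 d) : symL2 d n →ₗ[ℂ] symL2 d (n + 1) :=
  (Real.sqrt (n + 1) : ℂ) • (symmetrize d (n + 1) ∘ₗ tensorLeft n f ∘ₗ (symL2 d n).subtype)

/-- The annihilation operator from the `(n+1)`-particle space to the `n`-particle space. -/
def sectorAnnihilate {d : ℕ} (n : ℕ) (f : HL2 d) : symL2 d (n + 1) →ₗ[ℂ] symL2 d n :=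
  (Real.sqrt (n + 1) : ℂ) •
    { toFun := fun v => ⟨contract n f (v : L2n d (n + 1)), contract_mem f v⟩
      map_add' := fun _ _ => Subtype.ext (contract_add f _ _)
      map_smul' := fun c _ => Subtype.ext (contract_smul f c _) }

theorem sectorCreate_apply {d n : ℕ} (f : HL2 d) (u : symL2 d n) :
    sectorCreate n f u =
      (Real.sqrt (n + 1) : ℂ) • symmetrize d (n + 1) (tensorLeft n f (u : L2n d n)) := rfl

theorem coe_sectorAnnihilate {d n : ℕ} (f : HL2 d) (v : symL2 d (n + 1)) :
    (sectorAnnihilate n f v : L2n d n) =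
      (Real.sqrt (n + 1) : ℂ) • contract n f (v : L2n d (n + 1)) := rfl

theorem coe_sectorCreate {d n : ℕ} (f : HL2 d) (u : symL2 d n) :
    (sectorCreate n f u : L2n d (n + 1)) =
      (Real.sqrt (n + 1) : ℂ) •
        (symmetrize d (n + 1) (tensorLeft n f (u : L2n d n)) : L2n d (n + 1)) := rfl

theorem inner_sectorCreate_left {d n : ℕ} (f : HL2 d) (u : symL2 d n) (v : symL2 d (n + 1)) :
    inner ℂ (sectorCreate n f u) v = inner ℂ u (sectorAnnihilate n f v) := by
  have h := inner_symmetrize_tensorLeft f u v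
  rw [Submodule.coe_inner] at h
  rw [Submodule.coe_inner, Submodule.coe_inner, coe_sectorCreate, inner_smul_left, h,
    coe_sectorAnnihilate, inner_smul_right, inner_tensorLeft_left, Complex.conj_ofReal]

/-- The two factors `√(n+1)` cancel the average over the `n+1` cosets. -/
theorem inner_sectorCreate_eq_sum {d n : ℕ} (f g : HL2 d) (u v : symL2 d n) :
    inner ℂ (sectorCreate n f u) (sectorCreate n g v) =
      ∑ p : Fin (n + 1), inner ℂ (tensorLeft n f (u : L2n d n))
        (permute d (Equiv.swap 0 p) (tensorLeft n g (v : L2n d n))) := by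
  have h := inner_symmetrize_tensorLeft f u (sectorCreate n g v)
  rw [Submodule.coe_inner] at h
  rw [Submodule.coe_inner, coe_sectorCreate, inner_smul_left, h, coe_sectorCreate,
    inner_smul_right, symmetrize_tensorLeft, inner_smul_right, inner_sum,
    ← mul_assoc, ← mul_assoc, Complex.conj_ofReal, ← Complex.ofReal_mul,
    Real.mul_self_sqrt (by positivity)]
  have h5 : ((n : ℂ) + 1) ≠ 0 := by exact_mod_cast n.succ_ne_zero
  push_cast
  rw [mul_inv_cancel₀ h5, one_mul]

/-- Conjugation by a permutation fixing `0` turns `(0 i+1)` into `(0 1)`, so that one computation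
treats all nontrivial cosets. -/
theorem swap_zero_succ_eq {n : ℕ} (i : Fin (n + 1)) :
    Equiv.swap (0 : Fin (n + 2)) i.succ =
      extPerm (Equiv.swap 0 i) * (Equiv.swap 0 1 * (extPerm (Equiv.swap 0 i))⁻¹) := by
  have h := Equiv.mul_swap_eq_swap_mul (extPerm (Equiv.swap 0 i)) 0 (Fin.succ 0)
  rw [extPerm_zero, extPerm_succ, Equiv.swap_apply_left, Fin.succ_zero_eq_one] at h
  rw [← mul_assoc, h, mul_inv_cancel_right]

theorem permute_extPerm_inv_tensorLeft {d n : ℕ} (e : Equiv.Perm (Fin n)) (f : HL2 d)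
    (u : symL2 d n) :
    permute d (extPerm e)⁻¹ (tensorLeft n f (u : L2n d n)) = tensorLeft n f (u : L2n d n) := by
  conv_lhs => rw [← u.2 e, ← permute_extPerm_tensorLeft, permute_permute, inv_mul_cancel,
    permute_one]

/-- The conjugating permutations are absorbed by the symmetric vectors `u` and `v`, leaving the swap
of the first two variables. The result does not depend on `i`. -/
theorem inner_tensorLeft_swap_succ {d n : ℕ} (f g : HL2 d) (u v : symL2 d (n + 1))
    (i : Fin (n + 1)) :
    inner ℂ (tensorLeft (n + 1) f (u : L2n d (n + 1)))
        (permute d (Equiv.swap 0 i.succ) (tensorLeft (n + 1) g (v : L2n d (n + 1)))) =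
      inner ℂ (contract n g (u : L2n d (n + 1))) (contract n f (v : L2n d (n + 1))) := by
  rw [swap_zero_succ_eq, ← permute_permute, ← permute_permute, permute_extPerm_inv_tensorLeft,
    ← inner_conj_symm, inner_permute_left, inner_conj_symm, permute_extPerm_inv_tensorLeft,
    inner_tensorLeft_left, contract_swap_tensorLeft, inner_tensorLeft_right]

/-- The commutation relation in weak form: the trivial coset gives `⟨f, g⟩ ⟨u, v⟩`, and the other
`n+1` equal cosets account for the factor `√(n+1)²` of the annihilation operators. -/
theorem inner_sectorCreate_sectorCreate {d n : ℕ} (f g : HL2 d) (u v : symL2 d (n + 1)) :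
    inner ℂ (sectorCreate (n + 1) f u) (sectorCreate (n + 1) g v) =
      inner ℂ (sectorAnnihilate n g u) (sectorAnnihilate n f v) + inner ℂ f g * inner ℂ u v := by
  rw [inner_sectorCreate_eq_sum, Fin.sum_univ_succ, Equiv.swap_self, Submodule.coe_inner,
    Submodule.coe_inner, coe_sectorAnnihilate, coe_sectorAnnihilate]
  simp only [inner_tensorLeft_swap_succ, Finset.sum_const, Finset.card_univ, Fintype.card_fin,
    nsmul_eq_mul, inner_smul_left, inner_smul_right]
  rw [← mul_assoc, Complex.conj_ofReal, ← Complex.ofReal_mul, Real.mul_self_sqrt (by positivity),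
    add_comm]
  congr 1
  · push_cast
    ring
  · have h : permute d (Equiv.refl (Fin (n + 1 + 1))) (tensorLeft (n + 1) g (v : L2n d (n + 1))) =
        tensorLeft (n + 1) g (v : L2n d (n + 1)) := permute_one _
    rw [h, inner_tensorLeft_left, contract_tensorLeft, inner_smul_right]

/-- The canonical commutation relations on the `(n+1)`-particle space. -/
theorem sectorAnnihilate_sectorCreate_succ {d n : ℕ} (f g : HL2 d) (v : symL2 d (n + 1)) :
    sectorAnnihilate (n + 1) f (sectorCreate (n + 1) g v) =
      sectorCreate n g (sectorAnnihilate n f v) + (inner ℂ f g : ℂ) • v := by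
  refine ext_inner_left ℂ fun u => ?_
  have h1 : inner ℂ u (sectorCreate n g (sectorAnnihilate n f v)) =
      inner ℂ (sectorAnnihilate n g u) (sectorAnnihilate n f v) := by
    have := inner_sectorCreate_left g (sectorAnnihilate n f v) u
    rw [Submodule.coe_inner, Submodule.coe_inner] at this ⊢
    rw [← inner_conj_symm, this, inner_conj_symm]
  rw [← inner_sectorCreate_left, inner_sectorCreate_sectorCreate, ← h1]
  simp only [Submodule.coe_inner, Submodule.coe_smul, inner_add_right, inner_smul_right]

theorem sectorAnnihilate_sectorCreate_zero {d : ℕ} (f g : HL2 d) (v : symL2 d 0) :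
    sectorAnnihilate 0 f (sectorCreate 0 g v) = (inner ℂ f g : ℂ) • v := by
  refine ext_inner_left ℂ fun u => ?_
  rw [← inner_sectorCreate_left, inner_sectorCreate_eq_sum]
  have h : permute d (Equiv.refl (Fin (0 + 1))) (tensorLeft 0 g (v : L2n d 0)) =
        tensorLeft 0 g (v : L2n d 0) := permute_one _
  simp only [Nat.reduceAdd, Fin.isValue, Finset.univ_unique, Fin.default_eq_zero,
    Finset.sum_singleton, Equiv.swap_self]
  rw [h, inner_tensorLeft_left, contract_tensorLeft, inner_smul_right]
  simp only [Submodule.coe_inner, Submodule.coe_smul, inner_smul_right]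

theorem sectorCreate_sub_left {d n : ℕ} (f g : HL2 d) (u : symL2 d n) :
    sectorCreate n (f - g) u = sectorCreate n f u - sectorCreate n g u := by
  rw [sectorCreate_apply, tensorLeft_sub_left, map_sub, smul_sub]
  rfl

theorem permute_swap_tensorLeft_tensorLeft {d n : ℕ} (f g : HL2 d) (w : L2n d n) :
    permute d (Equiv.swap 0 1) (tensorLeft (n + 1) f (tensorLeft n g w)) =
      tensorLeft (n + 1) g (tensorLeft n f w) := by
  have q := (measurePreserving_perm d (Equiv.swap (0 : Fin (n + 2)) 1)).quasiMeasurePreserving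
  refine Lp.ext ?_
  filter_upwards [permute_coeFn (Equiv.swap 0 1) (tensorLeft (n + 1) f (tensorLeft n g w)),
    q.ae (tensorLeft_coeFn f (tensorLeft n g w)),
    q.ae ((quasiMeasurePreserving_tail d (n + 1)).ae (tensorLeft_coeFn g w)),
    tensorLeft_coeFn g (tensorLeft n f w),
    (quasiMeasurePreserving_tail d (n + 1)).ae (tensorLeft_coeFn f w)] with k h1 h2 h3 h4 h5
  rw [h1, h2, h3, h4, h5, Fin.succ_zero_eq_one, Equiv.swap_apply_left, Equiv.swap_apply_right]
  have : (fun i : Fin n => k (Equiv.swap 0 1 i.succ.succ)) = fun i : Fin n => k i.succ.succ := by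
    funext i
    rw [← Fin.succ_zero_eq_one, Equiv.swap_apply_of_ne_of_ne (Fin.succ_ne_zero _)
      (fun h => Fin.succ_ne_zero _ (Fin.succ_injective _ h))]
  rw [this]
  ring

/-- By duality this is the symmetry of `v` under exchange of the variables carried by `f` and `g`.
-/
theorem sectorAnnihilate_comm {d n : ℕ} (f g : HL2 d) (v : symL2 d (n + 2)) :
    sectorAnnihilate n f (sectorAnnihilate (n + 1) g v) =
      sectorAnnihilate n g (sectorAnnihilate (n + 1) f v) := by
  refine Subtype.ext ?_
  simp only [coe_sectorAnnihilate, contract_smul]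
  congr 2
  refine ext_inner_left ℂ fun w => ?_
  rw [← inner_tensorLeft_left, ← inner_tensorLeft_left, ← inner_tensorLeft_left,
    ← inner_tensorLeft_left, ← permute_swap_tensorLeft_tensorLeft, inner_permute_left, v.2]

/-! ### Multiplication by bounded functions and the heat semigroup -/

section Mul

variable {X : Type*} [MeasurableSpace X] {μ : Measure X}

theorem memLp_mul_of_le_one {q : X → ℝ} (hq : Measurable q) (h1 : ∀ x, |q x| ≤ 1) (u : Lp ℂ 2 μ) :
    MemLp (fun x => (q x : ℂ) * u x) 2 μ := by
  refine (Lp.memLp u).mono ?_ (Filter.Eventually.of_forall fun x => ?_)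
  · exact (Complex.measurable_ofReal.comp hq).aestronglyMeasurable.mul (Lp.aestronglyMeasurable u)
  · rw [norm_mul, Complex.norm_real, Real.norm_eq_abs]
    exact mul_le_of_le_one_left (norm_nonneg _) (h1 x)

/-- Multiplication by a measurable real function bounded by one, as an operator on `L²`. -/
def mulLp (μ : Measure X) {q : X → ℝ} (hq : Measurable q) (h1 : ∀ x, |q x| ≤ 1) :
    Lp ℂ 2 μ →ₗ[ℂ] Lp ℂ 2 μ where
  toFun u := (memLp_mul_of_le_one hq h1 u).toLp _
  map_add' u v := by
    rw [← MemLp.toLp_add]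
    refine MemLp.toLp_congr _ _ ?_
    filter_upwards [Lp.coeFn_add u v] with x hx
    simp only [hx, Pi.add_apply, mul_add]
  map_smul' c u := by
    rw [RingHom.id_apply, ← MemLp.toLp_const_smul]
    refine MemLp.toLp_congr _ _ ?_
    filter_upwards [Lp.coeFn_smul c u] with x hx
    simp only [hx, Pi.smul_apply, smul_eq_mul]
    ring

theorem mulLp_coeFn {q : X → ℝ} (hq : Measurable q) (h1 : ∀ x, |q x| ≤ 1) (u : Lp ℂ 2 μ) :
    mulLp μ hq h1 u =ᵐ[μ] fun x => (q x : ℂ) * u x :=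
  MemLp.coeFn_toLp (memLp_mul_of_le_one hq h1 u)

theorem inner_mulLp_left {q : X → ℝ} (hq : Measurable q) (h1 : ∀ x, |q x| ≤ 1) (u v : Lp ℂ 2 μ) :
    inner ℂ (mulLp μ hq h1 u) v = inner ℂ u (mulLp μ hq h1 v) := by
  rw [L2.inner_def, L2.inner_def]
  refine integral_congr_ae ?_
  filter_upwards [mulLp_coeFn hq h1 u, mulLp_coeFn hq h1 v] with x h2 h3
  rw [h2, h3, RCLike.inner_apply, RCLike.inner_apply, map_mul, Complex.conj_ofReal]
  ring

theorem norm_mulLp_le {q : X → ℝ} (hq : Measurable q) (h1 : ∀ x, |q x| ≤ 1) (u : Lp ℂ 2 μ) :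
    ‖mulLp μ hq h1 u‖ ≤ ‖u‖ := by
  refine Lp.norm_le_norm_of_ae_le ?_
  filter_upwards [mulLp_coeFn hq h1 u] with x hx
  rw [hx, norm_mul, Complex.norm_real, Real.norm_eq_abs]
  exact mul_le_of_le_one_left (norm_nonneg _) (h1 x)

end Mul

theorem omega_nonneg (d : ℕ) (m : ℝ) (k : Rd d) : 0 ≤ omega d m k := Real.sqrt_nonneg _

theorem measurable_omega (d : ℕ) (m : ℝ) : Measurable (omega d m) := by
  unfold omega
  fun_prop

/-- The factor `exp(-t (ω(k₁) + ⋯ + ω(kₙ)))`. -/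
def heatFactor (d : ℕ) (m : ℝ) (t : ℝ≥0) {n : ℕ} (k : Fin n → Rd d) : ℝ :=
  Real.exp (-(t * ∑ j, omega d m (k j)))

theorem measurable_heatFactor (d : ℕ) (m : ℝ) (t : ℝ≥0) (n : ℕ) :
    Measurable (heatFactor d m t (n := n)) := by
  have := measurable_omega d m
  unfold heatFactor
  fun_prop

theorem abs_heatFactor_le {d : ℕ} {m : ℝ} {t : ℝ≥0} {n : ℕ} (k : Fin n → Rd d) :
    |heatFactor d m t k| ≤ 1 := by
  rw [heatFactor, abs_of_pos (Real.exp_pos _), Real.exp_le_one_iff, neg_nonpos]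
  exact mul_nonneg t.2 (Finset.sum_nonneg fun j _ => omega_nonneg d m _)

/-- The factor `exp(-t ω(k))`. -/
def heatFactor₁ (d : ℕ) (m : ℝ) (t : ℝ≥0) (k : Rd d) : ℝ := Real.exp (-(t * omega d m k))

theorem measurable_heatFactor₁ (d : ℕ) (m : ℝ) (t : ℝ≥0) : Measurable (heatFactor₁ d m t) := by
  have := measurable_omega d m
  unfold heatFactor₁
  fun_prop

theorem abs_heatFactor₁_le {d : ℕ} {m : ℝ} {t : ℝ≥0} (k : Rd d) : |heatFactor₁ d m t k| ≤ 1 := by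
  rw [heatFactor₁, abs_of_pos (Real.exp_pos _), Real.exp_le_one_iff, neg_nonpos]
  exact mul_nonneg t.2 (omega_nonneg d m _)

/-- The one-particle operator `exp(-t ω)`. -/
def heat₁ (d : ℕ) (m : ℝ) (t : ℝ≥0) : HL2 d →ₗ[ℂ] HL2 d :=
  mulLp volume (measurable_heatFactor₁ d m t) abs_heatFactor₁_le

theorem heat₁_coeFn {d : ℕ} (m : ℝ) (t : ℝ≥0) (f : HL2 d) :
    heat₁ d m t f =ᵐ[volume] fun k => (heatFactor₁ d m t k : ℂ) * f k :=
  mulLp_coeFn _ _ f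

/-- The operator `exp(-t (ω(k₁) + ⋯ + ω(kₙ)))` on `L²((ℝᵈ)ⁿ)`. -/
def heatL2 (d : ℕ) (m : ℝ) (t : ℝ≥0) (n : ℕ) : L2n d n →ₗ[ℂ] L2n d n :=
  mulLp volume (measurable_heatFactor d m t n) abs_heatFactor_le

theorem heatL2_coeFn {d n : ℕ} (m : ℝ) (t : ℝ≥0) (u : L2n d n) :
    heatL2 d m t n u =ᵐ[volume] fun k => (heatFactor d m t k : ℂ) * u k :=
  mulLp_coeFn _ _ u

theorem permute_heatL2 {d n : ℕ} (m : ℝ) (t : ℝ≥0) (σ : Equiv.Perm (Fin n)) (u : L2n d n) :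
    permute d σ (heatL2 d m t n u) = heatL2 d m t n (permute d σ u) := by
  refine Lp.ext ?_
  filter_upwards [permute_coeFn σ (heatL2 d m t n u),
    (measurePreserving_perm d σ).quasiMeasurePreserving.ae (heatL2_coeFn m t u),
    heatL2_coeFn m t (permute d σ u), permute_coeFn σ u] with k h1 h2 h3 h4
  rw [h1, h2, h3, h4, heatFactor, heatFactor, Equiv.sum_comp σ (fun j => omega d m (k j))]

/-- The exponential of a sum of one-particle energies factorizes. This multiplicativity is what
makes the semigroup more convenient than `H₀`: it is bounded and its commutators with the fields are
exact. -/
theorem heatL2_tensorLeft {d n : ℕ} (m : ℝ) (t : ℝ≥0) (f : HL2 d) (u : L2n d n) :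
    heatL2 d m t (n + 1) (tensorLeft n f u) = tensorLeft n (heat₁ d m t f) (heatL2 d m t n u) := by
  refine Lp.ext ?_
  filter_upwards [heatL2_coeFn m t (tensorLeft n f u), tensorLeft_coeFn f u,
    tensorLeft_coeFn (heat₁ d m t f) (heatL2 d m t n u),
    (quasiMeasurePreserving_head d n).ae (heat₁_coeFn m t f),
    (quasiMeasurePreserving_tail d n).ae (heatL2_coeFn m t u)] with k h1 h2 h3 h4 h5
  rw [h1, h2, h3, h4, h5, heatFactor, heatFactor, heatFactor₁, Fin.sum_univ_succ, mul_add, neg_add,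
    Real.exp_add]
  push_cast
  ring

theorem heatL2_heatL2 {d n : ℕ} (m : ℝ) (s t : ℝ≥0) (u : L2n d n) :
    heatL2 d m s n (heatL2 d m t n u) = heatL2 d m (s + t) n u := by
  refine Lp.ext ?_
  filter_upwards [heatL2_coeFn m s (heatL2 d m t n u), heatL2_coeFn m t u,
    heatL2_coeFn m (s + t) u] with k h1 h2 h3
  rw [h1, h2, h3, ← mul_assoc, heatFactor, heatFactor, heatFactor, ← Complex.ofReal_mul,
    ← Real.exp_add]
  congr 4
  push_cast
  ring

/-- The operator `exp(-t H₀)` on the `n`-particle space. -/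
def sectorHeat (d : ℕ) (m : ℝ) (t : ℝ≥0) (n : ℕ) : symL2 d n →ₗ[ℂ] symL2 d n :=
  (heatL2 d m t n).restrict fun u hu σ => by rw [permute_heatL2, hu σ]

theorem coe_sectorHeat {d n : ℕ} (m : ℝ) (t : ℝ≥0) (u : symL2 d n) :
    (sectorHeat d m t n u : L2n d n) = heatL2 d m t n (u : L2n d n) := rfl

theorem inner_sectorHeat_left {d n : ℕ} (m : ℝ) (t : ℝ≥0) (u v : symL2 d n) :
    inner ℂ (sectorHeat d m t n u) v = inner ℂ u (sectorHeat d m t n v) := by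
  rw [Submodule.coe_inner, Submodule.coe_inner]
  exact inner_mulLp_left (measurable_heatFactor d m t n) abs_heatFactor_le _ _

theorem norm_sectorHeat_le {d n : ℕ} (m : ℝ) (t : ℝ≥0) (u : symL2 d n) :
    ‖sectorHeat d m t n u‖ ≤ ‖u‖ :=
  norm_mulLp_le (measurable_heatFactor d m t n) abs_heatFactor_le (u : L2n d n)

theorem sectorHeat_sectorHeat {d n : ℕ} (m : ℝ) (s t : ℝ≥0) (u : symL2 d n) :
    sectorHeat d m s n (sectorHeat d m t n u) = sectorHeat d m (s + t) n u :=
  Subtype.ext (heatL2_heatL2 m s t _)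

theorem sectorHeat_sectorCreate {d n : ℕ} (m : ℝ) (t : ℝ≥0) (f : HL2 d) (u : symL2 d n) :
    sectorHeat d m t (n + 1) (sectorCreate n f u) =
      sectorCreate n (heat₁ d m t f) (sectorHeat d m t n u) := by
  refine Subtype.ext ?_
  rw [coe_sectorHeat, coe_sectorCreate, coe_sectorCreate, symmetrize_tensorLeft,
    symmetrize_tensorLeft, map_smul, map_smul, map_sum]
  simp only [← permute_heatL2, heatL2_tensorLeft, coe_sectorHeat]

/-- The adjoint of the intertwining relation for creation operators. -/
theorem sectorAnnihilate_sectorHeat {d n : ℕ} (m : ℝ) (t : ℝ≥0) (f : HL2 d)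
    (v : symL2 d (n + 1)) :
    sectorAnnihilate n f (sectorHeat d m t (n + 1) v) =
      sectorHeat d m t n (sectorAnnihilate n (heat₁ d m t f) v) := by
  refine ext_inner_left ℂ fun u => ?_
  rw [← inner_sectorCreate_left, ← inner_sectorHeat_left, sectorHeat_sectorCreate,
    inner_sectorCreate_left, inner_sectorHeat_left]

/-! ### Energy weights -/

/-- The weighted square norm `∫ w(θ(k₁) + ⋯ + θ(kₙ)) |u(k₁, …, kₙ)|² dk`. -/
def sectorEnergy {d n : ℕ} (θ : Rd d → ℝ≥0∞) (w : ℝ≥0∞ → ℝ≥0∞) (u : L2n d n) : ℝ≥0∞ :=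
  ∫⁻ k, w (∑ j, θ (k j)) * ‖u k‖ₑ ^ 2

theorem sectorEnergy_one {d n : ℕ} (θ : Rd d → ℝ≥0∞) (u : L2n d n) :
    sectorEnergy θ (fun _ => 1) u = ‖u‖ₑ ^ 2 := by
  simp only [sectorEnergy, one_mul, enorm_sq_eq_lintegral]

theorem measurable_sum_comp {d n : ℕ} {θ : Rd d → ℝ≥0∞} (hθ : Measurable θ) :
    Measurable fun k : Fin n → Rd d => ∑ j, θ (k j) :=
  Finset.measurable_sum _ fun j _ => hθ.comp (measurable_pi_apply j)

theorem measurable_enorm_sq {d n : ℕ} (u : L2n d n) : Measurable fun k => ‖u k‖ₑ ^ 2 :=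
  (Lp.stronglyMeasurable u).measurable.enorm.pow_const 2

/-- The total weight and `|v|²` are symmetric, so the variables `j` and `0` may be exchanged. -/
theorem lintegral_weight_symm {d n : ℕ} {θ : Rd d → ℝ≥0∞} (hθ : Measurable θ) {w : ℝ≥0∞ → ℝ≥0∞}
    (hw : Measurable w) (v : symL2 d (n + 1)) (j : Fin (n + 1)) :
    ∫⁻ k, w (∑ i, θ (k i)) * (θ (k j) * ‖(v : L2n d (n + 1)) k‖ₑ ^ 2) =
      ∫⁻ k, w (∑ i, θ (k i)) * (θ (k 0) * ‖(v : L2n d (n + 1)) k‖ₑ ^ 2) := by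
  have hm : Measurable fun k : Fin (n + 1) → Rd d =>
      w (∑ i, θ (k i)) * (θ (k 0) * ‖(v : L2n d (n + 1)) k‖ₑ ^ 2) :=
    (hw.comp (measurable_sum_comp hθ)).mul
      ((hθ.comp (measurable_pi_apply 0)).mul (measurable_enorm_sq _))
  rw [← (measurePreserving_perm d (Equiv.swap 0 j)).lintegral_comp hm]
  refine lintegral_congr_ae ?_
  have h := permute_coeFn (Equiv.swap 0 j) (v : L2n d (n + 1))
  rw [v.2] at h
  filter_upwards [h] with k hk
  rw [← hk, Equiv.sum_comp (Equiv.swap 0 j) fun i => θ (k i), Equiv.swap_apply_left]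

/-- Cauchy-Schwarz puts the weight `θ = s²` on the annihilated variable. Monotonicity of `w`
replaces the energy of the remaining particles by the total energy, and by symmetry `(n+1) θ(k₀)`
may be replaced by the full sum of `θ(kⱼ)`. Annihilation thus costs one extra power of the energy.
-/
theorem sectorEnergy_annihilate_le {d n : ℕ} {θ s F : Rd d → ℝ≥0∞} (hs : Measurable s)
    (hsθ : ∀ y, s y ^ 2 = θ y) (hF : AEMeasurable F) {w : ℝ≥0∞ → ℝ≥0∞} (hw : Monotone w)
    {f : HL2 d} (hf : ∀ᵐ y, ‖f y‖ₑ ≤ F y * s y) (v : symL2 d (n + 1)) :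
    sectorEnergy θ w (sectorAnnihilate n f v : L2n d n) ≤
      (∫⁻ y, F y ^ 2) * sectorEnergy θ (fun x => w x * x) (v : L2n d (n + 1)) := by
  have hθ : Measurable θ := by
    have : θ = fun y => s y ^ 2 := funext fun y => (hsθ y).symm
    rw [this]
    exact hs.pow_const 2
  have hc : ‖(Real.sqrt (n + 1) : ℂ)‖ₑ ^ 2 = n + 1 := by
    rw [← enorm_pow, ← Complex.ofReal_pow, Real.sq_sqrt (by positivity)]
    rw [← ofReal_norm, Complex.norm_real, Real.norm_of_nonneg (by positivity)]
    rw [ENNReal.ofReal_add (by positivity) (by positivity)]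
    simp
  have h1 : sectorEnergy θ w (sectorAnnihilate n f v : L2n d n) =
      (n + 1) * ∫⁻ x : Fin n → Rd d, w (∑ j, θ (x j)) *
        ‖∫ y, (starRingEnd ℂ) (f y) * (v : L2n d (n + 1)) (Fin.cons y x)‖ₑ ^ 2 := by
    rw [sectorEnergy, ← lintegral_const_mul' _ _ (by finiteness)]
    refine lintegral_congr_ae ?_
    rw [coe_sectorAnnihilate]
    filter_upwards [Lp.coeFn_smul (Real.sqrt (n + 1) : ℂ) (contract n f (v : L2n d (n + 1))),
      contract_coeFn f (v : L2n d (n + 1))] with x hx hx2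
    rw [hx, Pi.smul_apply, smul_eq_mul, hx2, enorm_mul, mul_pow, hc]
    ring
  have hv : Measurable fun p : (Fin n → Rd d) × Rd d =>
      (v : L2n d (n + 1)) (Fin.cons p.2 p.1) :=
    (Lp.stronglyMeasurable (v : L2n d (n + 1))).measurable.comp (measurable_cons d n)
  have h2 := lintegral_contract_le (volume : Measure (Fin n → Rd d)) (volume : Measure (Rd d))
    hs hF hf hv (hw.measurable.comp (measurable_sum_comp (n := n) hθ))
  have hm : Measurable fun k : Fin (n + 1) → Rd d =>
      w (∑ i, θ (k i)) * (θ (k 0) * ‖(v : L2n d (n + 1)) k‖ₑ ^ 2) :=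
    (hw.measurable.comp (measurable_sum_comp hθ)).mul
      ((hθ.comp (measurable_pi_apply 0)).mul (measurable_enorm_sq _))
  have h3 : ∫⁻ x : Fin n → Rd d, w (∑ j, θ (x j)) *
      ∫⁻ y, s y ^ 2 * ‖(v : L2n d (n + 1)) (Fin.cons y x)‖ₑ ^ 2 ≤
      ∫⁻ k : Fin (n + 1) → Rd d,
        w (∑ i, θ (k i)) * (θ (k 0) * ‖(v : L2n d (n + 1)) k‖ₑ ^ 2) := by
    rw [lintegral_cons hm]
    refine lintegral_mono fun x => ?_
    have hm2 : Measurable fun y => s y ^ 2 * ‖(v : L2n d (n + 1)) (Fin.cons y x)‖ₑ ^ 2 :=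
      (hs.pow_const 2).mul ((hv.comp measurable_prodMk_left).enorm.pow_const 2)
    rw [← lintegral_const_mul _ hm2]
    refine lintegral_mono fun y => ?_
    simp only [Fin.cons_zero, hsθ]
    gcongr
    refine hw ?_
    rw [Fin.sum_univ_succ]
    simp only [Fin.cons_succ]
    exact le_add_self
  have h4 : (n + 1) * ∫⁻ k : Fin (n + 1) → Rd d,
        w (∑ i, θ (k i)) * (θ (k 0) * ‖(v : L2n d (n + 1)) k‖ₑ ^ 2) =
      sectorEnergy θ (fun x => w x * x) (v : L2n d (n + 1)) := by
    have h5 : ∑ j : Fin (n + 1), ∫⁻ k : Fin (n + 1) → Rd d,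
        w (∑ i, θ (k i)) * (θ (k j) * ‖(v : L2n d (n + 1)) k‖ₑ ^ 2) =
        (n + 1) * ∫⁻ k : Fin (n + 1) → Rd d,
        w (∑ i, θ (k i)) * (θ (k 0) * ‖(v : L2n d (n + 1)) k‖ₑ ^ 2) := by
      rw [Finset.sum_congr rfl fun j _ => lintegral_weight_symm hθ hw.measurable v j]
      simp
    rw [← h5, sectorEnergy, ← lintegral_finsetSum]
    · refine lintegral_congr fun k => ?_
      rw [← Finset.mul_sum, ← Finset.sum_mul, mul_assoc]
    · intro j _
      exact (hw.measurable.comp (measurable_sum_comp hθ)).mul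
        ((hθ.comp (measurable_pi_apply j)).mul (measurable_enorm_sq _))
  rw [h1, ← h4]
  calc _ ≤ (n + 1) * ((∫⁻ y, F y ^ 2) * _) := mul_le_mul_right h2 _
    _ ≤ (n + 1) * ((∫⁻ y, F y ^ 2) * _) := mul_le_mul_right (mul_le_mul_right h3 _) _
    _ = _ := by ring

/-! ### An abstract double commutator inequality -/

section Abstract

variable {V : Type*} [NormedAddCommGroup V] [InnerProductSpace ℂ V]

/-- The algebraic relations between `a = a(f)`, `c = a†(f)`, `b = a(g)`, `b' = a†(g)` and
`E = exp(-t H₀) = T²`, for `g = f - exp(-t ω) f`, `β = ‖f‖`, `η = ‖g‖` and `c₀ = ⟨g, f⟩`. -/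
structure HeatRelations (a c b b' E T : V →ₗ[ℂ] V) (β η c₀ : ℝ) : Prop where
  inner_c : ∀ x y, inner ℂ (c x) y = inner ℂ x (a y)
  inner_b' : ∀ x y, inner ℂ (b' x) y = inner ℂ x (b y)
  inner_T : ∀ x y, inner ℂ (T x) y = inner ℂ x (T y)
  E_eq : ∀ x, E x = T (T x)
  norm_T : ∀ x, ‖T x‖ ≤ ‖x‖
  E_c : ∀ x, E (c x) = c (E x) - b' (E x)
  a_E : ∀ x, a (E x) = E (a x) - E (b x)
  a_c : ∀ x, a (c x) = c (a x) + ((β ^ 2 : ℝ) : ℂ) • x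
  b_b' : ∀ x, b (b' x) = b' (b x) + ((η ^ 2 : ℝ) : ℂ) • x
  b_c : ∀ x, b (c x) = c (b x) + (c₀ : ℂ) • x
  a_b : ∀ x, a (b x) = b (a x)
  β_nonneg : 0 ≤ β
  η_nonneg : 0 ≤ η
  c₀_nonneg : 0 ≤ c₀

/-- Move `c` to the other side of `⟨c x, c x⟩` and commute `a c = c a + β²`. -/
theorem norm_le_add_of_comm {a c : V →ₗ[ℂ] V} {β : ℝ} (hβ : 0 ≤ β)
    (hc : ∀ x y, inner ℂ (c x) y = inner ℂ x (a y))
    (hac : ∀ x, a (c x) = c (a x) + ((β ^ 2 : ℝ) : ℂ) • x) (x : V) :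
    ‖c x‖ ^ 2 = ‖a x‖ ^ 2 + β ^ 2 * ‖x‖ ^ 2 ∧ ‖c x‖ ≤ ‖a x‖ + β * ‖x‖ := by
  have h : ‖c x‖ ^ 2 = ‖a x‖ ^ 2 + β ^ 2 * ‖x‖ ^ 2 := by
    have h1 : inner ℂ (c x) (c x) = inner ℂ (a x) (a x) + ((β ^ 2 : ℝ) : ℂ) * inner ℂ x x := by
      rw [hc, hac, inner_add_right, inner_smul_right, ← inner_conj_symm, hc, inner_conj_symm]
    rw [inner_self_eq_norm_sq_to_K, inner_self_eq_norm_sq_to_K, inner_self_eq_norm_sq_to_K] at h1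
    apply Complex.ofReal_injective
    push_cast at h1 ⊢
    exact h1
  refine ⟨h, ?_⟩
  refine abs_le_of_sq_le_sq' ?_ (by positivity) |>.2
  rw [h]
  have : 0 ≤ ‖a x‖ * (β * ‖x‖) := by positivity
  nlinarith

namespace HeatRelations

variable {a c b b' E T : V →ₗ[ℂ] V} {β η c₀ : ℝ}

theorem inner_a (R : HeatRelations a c b b' E T β η c₀) (x y : V) :
    inner ℂ (a x) y = inner ℂ x (c y) := by
  rw [← inner_conj_symm, ← R.inner_c, inner_conj_symm]

theorem inner_b (R : HeatRelations a c b b' E T β η c₀) (x y : V) :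
    inner ℂ (b x) y = inner ℂ x (b' y) := by
  rw [← inner_conj_symm, ← R.inner_b', inner_conj_symm]

theorem inner_E (R : HeatRelations a c b b' E T β η c₀) (x y : V) :
    inner ℂ (E x) y = inner ℂ x (E y) := by
  rw [R.E_eq, R.E_eq, R.inner_T, R.inner_T]

theorem norm_E (R : HeatRelations a c b b' E T β η c₀) (x : V) : ‖E x‖ ≤ ‖x‖ := by
  rw [R.E_eq]
  exact (R.norm_T _).trans (R.norm_T _)

theorem inner_s (R : HeatRelations a c b b' E T β η c₀) (x y : V) :
    inner ℂ ((a + c) x) y = inner ℂ x ((a + c) y) := by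
  rw [LinearMap.add_apply, LinearMap.add_apply, inner_add_left, inner_add_right, R.inner_a,
    R.inner_c, add_comm]

/-- Only the creation part of `s = a + c` fails to commute with `b`, and that commutator is the
scalar `c₀`. -/
theorem b_s (R : HeatRelations a c b b' E T β η c₀) (x : V) :
    b ((a + c) x) = (a + c) (b x) + (c₀ : ℂ) • x := by
  simp only [LinearMap.add_apply, map_add, R.b_c, R.a_b, add_assoc]

theorem s_b' (R : HeatRelations a c b b' E T β η c₀) (x : V) :
    (a + c) (b' x) = b' ((a + c) x) + (c₀ : ℂ) • x := by
  refine ext_inner_right ℂ fun y => ?_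
  rw [R.inner_s, R.inner_b', R.b_s, inner_add_right, inner_add_left, R.inner_b', inner_smul_right,
    inner_smul_left, Complex.conj_ofReal, R.inner_s]

/-- Identifies the single commutator `K = [E, s]` as `E b - b' E`. -/
theorem E_s (R : HeatRelations a c b b' E T β η c₀) (x : V) :
    E ((a + c) x) = (a + c) (E x) + (E (b x) - b' (E x)) := by
  simp only [LinearMap.add_apply, map_add, R.E_c, R.a_E]
  abel

/-- The double commutator `[[E, s], s]` with `s = a + c`. -/
theorem double_commutator (R : HeatRelations a c b b' E T β η c₀) (x : V) :
    (E (b ((a + c) x)) - b' (E ((a + c) x))) - (a + c) (E (b x) - b' (E x)) =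
      E (b (b x)) - (2 : ℂ) • b' (E (b x)) + b' (b' (E x)) + (2 * c₀ : ℂ) • E x := by
  rw [map_sub (a + c), R.s_b', R.b_s, map_add E, R.E_s, R.E_s, map_smul, map_add b', map_sub b',
    two_mul, add_smul, two_smul]
  abel

/-- The commutator of two symmetric operators is antisymmetric. -/
theorem inner_commutator (R : HeatRelations a c b b' E T β η c₀) (x y : V) :
    inner ℂ (E (b x) - b' (E x)) y = - inner ℂ x (E (b y) - b' (E y)) := by
  rw [inner_sub_left, inner_sub_right, R.inner_E, R.inner_b, R.inner_b', R.inner_E]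
  ring

/-- With `K = [E, s]` and `D = [K, s]` one has `s² E = E s² - 2 K s + D`. Since `K` is antisymmetric
and `s` symmetric, `2 Re ⟨s z, K z⟩ = -Re ⟨z, D z⟩`; for `z = s x` this eliminates the single
commutator, and only the smaller `D` has to be estimated. -/
theorem sub_re_inner_eq (R : HeatRelations a c b b' E T β η c₀) (x : V) (D : V → V)
    (hD : ∀ x, D x =
      E (b (b x)) - (2 : ℂ) • b' (E (b x)) + b' (b' (E x)) + (2 * c₀ : ℂ) • E x) :
    ‖(a + c) ((a + c) x)‖ ^ 2 - (inner ℂ ((a + c) ((a + c) x)) ((a + c) ((a + c) (E x)))).re =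
      ‖(a + c) ((a + c) x)‖ ^ 2 - ‖T ((a + c) ((a + c) x))‖ ^ 2
        - (inner ℂ ((a + c) ((a + c) x)) (D x)).re - (inner ℂ ((a + c) x) (D ((a + c) x))).re := by
  have hs := R.inner_s
  have hE := R.E_s
  have hK := R.inner_commutator
  have hD' : ∀ x, (E (b ((a + c) x)) - b' (E ((a + c) x))) - (a + c) (E (b x) - b' (E x)) = D x :=
    fun x => (R.double_commutator x).trans (hD x).symm
  clear hD
  generalize a + c = s at *
  obtain ⟨K, hKdef⟩ : ∃ K : V → V, K = fun x => E (b x) - b' (E x) := ⟨_, rfl⟩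
  have hE' : ∀ x, E (s x) = s (E x) + K x := fun x => by rw [hE, hKdef]
  have hK' : ∀ x y, inner ℂ (K x) y = - inner ℂ x (K y) := fun x y => by simp only [hKdef, hK]
  have hD'' : ∀ x, K (s x) = s (K x) + D x := fun x => by
    rw [← hD' x]
    simp only [hKdef]
    abel
  have h1 : s (s (E x)) = E (s (s x)) - K (s x) - s (K x) := by
    rw [hE', hE', map_add]
    abel
  have h2 : s (K x) = K (s x) - D x := by rw [hD'']; abel
  have h3 : inner ℂ (s (s x)) (E (s (s x))) = ((‖T (s (s x))‖ ^ 2 : ℝ) : ℂ) := by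
    rw [R.E_eq, ← R.inner_T, inner_self_eq_norm_sq_to_K]
    push_cast
    rfl
  have h4 : 2 * (inner ℂ (s (s x)) (K (s x))).re = - (inner ℂ (s x) (D (s x))).re := by
    have e1 : inner ℂ (s (s x)) (K (s x)) = inner ℂ (s x) (s (K (s x))) := hs _ _
    have e2 : (inner ℂ (s (s x)) (K (s x))).re = - (inner ℂ (s x) (K (s (s x)))).re := by
      rw [← Complex.neg_re, ← hK', ← inner_conj_symm, Complex.conj_re]
    have e3 : inner ℂ (s x) (K (s (s x))) =
        inner ℂ (s x) (s (K (s x))) + inner ℂ (s x) (D (s x)) := by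
      rw [hD'' (s x), inner_add_right]
    rw [e3, Complex.add_re, ← e1] at e2
    linarith
  rw [h1, h2, inner_sub_right, inner_sub_right, inner_sub_right, h3]
  simp only [Complex.sub_re, Complex.ofReal_re]
  linarith

/-- The bound for `s² x`, where `s = a + c`. -/
theorem norm_s_s_le (R : HeatRelations a c b b' E T β η c₀) {x : V} {u₁ u₂ : ℝ}
    (hu₁ : ‖a x‖ ≤ u₁) (hu₂ : ‖a (a x)‖ ≤ u₂) :
    ‖(a + c) ((a + c) x)‖ ≤ 4 * u₂ + 4 * (β * u₁) + 3 * (β ^ 2 * ‖x‖) := by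
  have hβ := R.β_nonneg
  have hn := fun x => (norm_le_add_of_comm hβ R.inner_c R.a_c x).2
  have e : (a + c) ((a + c) x) =
      a (a x) + (c (a x) + c (a x)) + ((β ^ 2 : ℝ) : ℂ) • x + c (c x) := by
    simp only [LinearMap.add_apply, map_add, R.a_c]
    abel
  have n1 : ‖((β ^ 2 : ℝ) : ℂ) • x‖ = β ^ 2 * ‖x‖ := by
    rw [norm_smul, Complex.norm_real, Real.norm_of_nonneg (by positivity)]
  have h1 : ‖c (a x)‖ ≤ u₂ + β * u₁ :=
    (hn _).trans (add_le_add hu₂ (mul_le_mul_of_nonneg_left hu₁ hβ))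
  have h2 : ‖a (c x)‖ ≤ u₂ + β * u₁ + β ^ 2 * ‖x‖ := by
    rw [R.a_c]
    exact (norm_add_le _ _).trans (add_le_add h1 n1.le)
  have h3 : ‖c (c x)‖ ≤ (u₂ + β * u₁ + β ^ 2 * ‖x‖) + β * (u₁ + β * ‖x‖) :=
    (hn _).trans (add_le_add h2 (mul_le_mul_of_nonneg_left
      ((hn x).trans (add_le_add hu₁ le_rfl)) hβ))
  rw [e]
  have h4 := norm_add_le (a (a x) + (c (a x) + c (a x)) + ((β ^ 2 : ℝ) : ℂ) • x) (c (c x))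
  have h5 := norm_add_le (a (a x) + (c (a x) + c (a x))) (((β ^ 2 : ℝ) : ℂ) • x)
  have h6 := norm_add_le (a (a x)) (c (a x) + c (a x))
  have h7 := norm_add_le (c (a x)) (c (a x))
  rw [n1] at h5
  linarith

/-- The inequality `‖y + z‖² ≤ 2 ‖y‖² + 2 ‖z‖²` for `y = a x`, `z = c x`. Its coefficients 4 and 2
survive into `c_b` and `d_b`. -/
theorem norm_s_sq_le (R : HeatRelations a c b b' E T β η c₀) {x : V} {u₁ : ℝ}
    (hu₁ : ‖a x‖ ≤ u₁) : ‖(a + c) x‖ ^ 2 ≤ 4 * u₁ ^ 2 + 2 * (β ^ 2 * ‖x‖ ^ 2) := by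
  have h1 := (norm_le_add_of_comm R.β_nonneg R.inner_c R.a_c x).1
  have h2 : ‖(a + c) x‖ ^ 2 ≤ (‖a x‖ + ‖c x‖) ^ 2 := by
    gcongr
    exact norm_add_le _ _
  have h3 : ‖a x‖ ^ 2 ≤ u₁ ^ 2 := by gcongr
  nlinarith [sq_nonneg (‖a x‖ - ‖c x‖)]

/-- The quantitative double commutator inequality. -/
theorem sub_re_inner_ge (R : HeatRelations a c b b' E T β η c₀) {x : V}
    {u₁ u₂ v₁ v₂ w κ : ℝ} (hu₁ : ‖a x‖ ≤ u₁) (hu₂ : ‖a (a x)‖ ≤ u₂) (hv₁ : ‖b x‖ ≤ v₁)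
    (hv₂ : ‖b (b x)‖ ≤ v₂) (hw : ‖a (b x)‖ ≤ w) (hEu₁ : ‖a (E x)‖ ≤ u₁) (hEv₁ : ‖b (E x)‖ ≤ v₁)
    (hEv₂ : ‖b (b (E x))‖ ≤ v₂) (hκ0 : 0 ≤ κ) (hκ : ∀ y, ‖b (E y)‖ ≤ κ * ‖y‖) :
    - (4 * c₀ * (4 * u₁ ^ 2 + 2 * (β ^ 2 * ‖x‖ ^ 2)))
      - (4 * u₂ + 4 * (β * u₁) + 3 * (β ^ 2 * ‖x‖)) *
          (2 * v₂ + 2 * ((κ + η) * v₁) + 2 * (η * v₁) + 2 * (η ^ 2 * ‖x‖))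
      - 2 * ((2 * w + β * v₁ + c₀ * ‖x‖) * ((κ + η) * (2 * u₁ + β * ‖x‖))) ≤
    ‖(a + c) ((a + c) x)‖ ^ 2 - (inner ℂ ((a + c) ((a + c) x)) ((a + c) ((a + c) (E x)))).re := by
  have hβ := R.β_nonneg
  have hη := R.η_nonneg
  have hc₀ := R.c₀_nonneg
  have hn := fun x => (norm_le_add_of_comm hβ R.inner_c R.a_c x).2
  have hn' := fun x => (norm_le_add_of_comm hη R.inner_b' R.b_b' x).2
  -- The bound `κ` comes from the smoothing by `E` and needs no energy bound on `y`; it will be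
  -- applied to `b x` and to `s x`.
  have hb'E : ∀ y, ‖b' (E y)‖ ≤ (κ + η) * ‖y‖ := fun y => by
    rw [add_mul]
    exact (hn' _).trans (add_le_add (hκ y) (mul_le_mul_of_nonneg_left (R.norm_E y) hη))
  have hy := R.norm_s_s_le hu₁ hu₂
  have hS := R.norm_s_sq_le hu₁
  have hSE : ‖(a + c) (E x)‖ ^ 2 ≤ 4 * u₁ ^ 2 + 2 * (β ^ 2 * ‖x‖ ^ 2) := by
    refine (R.norm_s_sq_le hEu₁).trans ?_
    gcongr
    exact R.norm_E x
  have hz : ‖(a + c) x‖ ≤ 2 * u₁ + β * ‖x‖ := by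
    have := norm_add_le (a x) (c x)
    rw [LinearMap.add_apply]
    linarith [hn x]
  rw [R.sub_re_inner_eq x _ fun _ => rfl]
  -- The nonnegative quantity `‖s² x‖² - ‖T s² x‖²`, the counterpart of `t ⟨s²x, H₀ s²x⟩`, is simply
  -- discarded.
  have hTy : ‖T ((a + c) ((a + c) x))‖ ^ 2 ≤ ‖(a + c) ((a + c) x)‖ ^ 2 := by
    gcongr
    exact R.norm_T _
  have hsmul : ∀ z : V, (inner ℂ ((a + c) ((a + c) x)) z).re ≤
      (4 * u₂ + 4 * (β * u₁) + 3 * (β ^ 2 * ‖x‖)) * ‖z‖ := fun z =>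
    (Complex.re_le_norm _).trans ((norm_inner_le_norm _ _).trans
      (mul_le_mul_of_nonneg_right hy (norm_nonneg _)))
  have hY0 : 0 ≤ 4 * u₂ + 4 * (β * u₁) + 3 * (β ^ 2 * ‖x‖) := (norm_nonneg _).trans hy
  -- the first double commutator term
  have hA : (inner ℂ ((a + c) ((a + c) x)) (E (b (b x)) - (2 : ℂ) • b' (E (b x)) + b' (b' (E x)) +
      (2 * c₀ : ℂ) • E x)).re ≤
      (4 * u₂ + 4 * (β * u₁) + 3 * (β ^ 2 * ‖x‖)) *
          (2 * v₂ + 2 * ((κ + η) * v₁) + 2 * (η * v₁) + 2 * (η ^ 2 * ‖x‖))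
        + 2 * c₀ * (4 * u₁ ^ 2 + 2 * (β ^ 2 * ‖x‖ ^ 2)) := by
    rw [inner_add_right, Complex.add_re]
    refine add_le_add ((hsmul _).trans (mul_le_mul_of_nonneg_left ?_ hY0)) ?_
    · have e1 : ‖E (b (b x))‖ ≤ v₂ := (R.norm_E _).trans hv₂
      have e2 : ‖(2 : ℂ) • b' (E (b x))‖ ≤ 2 * ((κ + η) * v₁) := by
        rw [norm_smul, Complex.norm_ofNat]
        have := (hb'E (b x)).trans (mul_le_mul_of_nonneg_left hv₁ (by positivity))
        linarith
      -- Normal ordering leaves only powers of `b` on `E x`, which are controlled by hypothesis.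
      have e3 : ‖b (b' (E x))‖ ≤ (v₂ + η * v₁) + η ^ 2 * ‖x‖ := by
        rw [R.b_b']
        refine (norm_add_le _ _).trans (add_le_add ?_ ?_)
        · exact (hn' _).trans (add_le_add hEv₂ (mul_le_mul_of_nonneg_left hEv₁ hη))
        · rw [norm_smul, Complex.norm_real, Real.norm_of_nonneg (by positivity)]
          exact mul_le_mul_of_nonneg_left (R.norm_E x) (by positivity)
      have e4 : ‖b' (E x)‖ ≤ v₁ + η * ‖x‖ :=
        (hn' _).trans (add_le_add hEv₁ (mul_le_mul_of_nonneg_left (R.norm_E x) hη))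
      have e5 : ‖b' (b' (E x))‖ ≤ (v₂ + η * v₁ + η ^ 2 * ‖x‖) + η * (v₁ + η * ‖x‖) :=
        (hn' _).trans (add_le_add e3 (mul_le_mul_of_nonneg_left e4 hη))
      have e6 := norm_add_le (E (b (b x)) - (2 : ℂ) • b' (E (b x))) (b' (b' (E x)))
      have e7 := norm_sub_le (E (b (b x))) ((2 : ℂ) • b' (E (b x)))
      linarith
    · have e1 : (inner ℂ ((a + c) ((a + c) x)) ((2 * c₀ : ℂ) • E x)).re =
          2 * c₀ * (inner ℂ ((a + c) x) ((a + c) (E x))).re := by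
        -- One `s` is moved to the right, so the leading term involves `‖s x‖ ‖s E x‖` and hence
        -- only the first power of the energy.
        rw [inner_smul_right, R.inner_s, ← Complex.ofReal_ofNat, ← Complex.ofReal_mul,
          Complex.re_ofReal_mul]
      have e2 : (inner ℂ ((a + c) x) ((a + c) (E x))).re ≤
          4 * u₁ ^ 2 + 2 * (β ^ 2 * ‖x‖ ^ 2) := by
        refine (Complex.re_le_norm _).trans ((norm_inner_le_norm _ _).trans ?_)
        nlinarith [sq_nonneg (‖(a + c) x‖ - ‖(a + c) (E x)‖)]
      rw [e1]
      exact mul_le_mul_of_nonneg_left e2 (by positivity)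
  -- the second double commutator term
  have hB : (inner ℂ ((a + c) x) (E (b (b ((a + c) x))) - (2 : ℂ) • b' (E (b ((a + c) x))) +
      b' (b' (E ((a + c) x))) + (2 * c₀ : ℂ) • E ((a + c) x))).re ≤
      2 * ((2 * w + β * v₁ + c₀ * ‖x‖) * ((κ + η) * (2 * u₁ + β * ‖x‖)))
        + 2 * c₀ * (4 * u₁ ^ 2 + 2 * (β ^ 2 * ‖x‖ ^ 2)) := by
    -- Nothing is assumed about `b` on `s x`, so `b` is commuted through `s`.
    have hbz : ‖b ((a + c) x)‖ ≤ 2 * w + β * v₁ + c₀ * ‖x‖ := by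
      rw [R.b_s, LinearMap.add_apply]
      have e1 := norm_add_le (a (b x) + c (b x)) ((c₀ : ℂ) • x)
      have e2 := norm_add_le (a (b x)) (c (b x))
      have e3 : ‖c (b x)‖ ≤ w + β * v₁ :=
        (hn _).trans (add_le_add hw (mul_le_mul_of_nonneg_left hv₁ hβ))
      rw [norm_smul, Complex.norm_real, Real.norm_of_nonneg hc₀] at e1
      linarith
    generalize (a + c) x = z at *
    have hbb : ‖b z‖ * ‖b' (E z)‖ ≤
        (2 * w + β * v₁ + c₀ * ‖x‖) * ((κ + η) * (2 * u₁ + β * ‖x‖)) :=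
      mul_le_mul hbz ((hb'E z).trans (mul_le_mul_of_nonneg_left hz (by positivity)))
        (norm_nonneg _) ((norm_nonneg _).trans hbz)
    have e1 : (inner ℂ z (E (b (b z)))).re ≤ ‖b z‖ * ‖b' (E z)‖ := by
      rw [← R.inner_E, ← R.inner_b', mul_comm]
      exact (Complex.re_le_norm _).trans (norm_inner_le_norm _ _)
    have e2 : (inner ℂ z (b' (b' (E z)))).re ≤ ‖b z‖ * ‖b' (E z)‖ := by
      rw [← R.inner_b]
      exact (Complex.re_le_norm _).trans (norm_inner_le_norm _ _)
    -- This term enters `D` with a minus sign, so it has the favourable sign and is dropped.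
    have e3 : (inner ℂ z ((2 : ℂ) • b' (E (b z)))).re = 2 * ‖T (b z)‖ ^ 2 := by
      rw [inner_smul_right, ← R.inner_b, R.E_eq, ← R.inner_T, inner_self_eq_norm_sq_to_K,
        ← Complex.ofReal_ofNat, Complex.re_ofReal_mul]
      norm_cast
    have e4 : (inner ℂ z ((2 * c₀ : ℂ) • E z)).re ≤ 2 * c₀ * ‖z‖ ^ 2 := by
      rw [inner_smul_right, ← Complex.ofReal_ofNat, ← Complex.ofReal_mul, Complex.re_ofReal_mul]
      refine mul_le_mul_of_nonneg_left ?_ (by positivity)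
      refine (Complex.re_le_norm _).trans ((norm_inner_le_norm _ _).trans ?_)
      rw [sq]
      exact mul_le_mul_of_nonneg_left (R.norm_E z) (norm_nonneg _)
    have e5 : 2 * c₀ * ‖z‖ ^ 2 ≤ 2 * c₀ * (4 * u₁ ^ 2 + 2 * (β ^ 2 * ‖x‖ ^ 2)) :=
      mul_le_mul_of_nonneg_left hS (by positivity)
    rw [inner_add_right, inner_add_right, inner_sub_right, Complex.add_re, Complex.add_re,
      Complex.sub_re, e3]
    have e6 : 0 ≤ ‖T (b z)‖ ^ 2 := by positivity
    linarith
  linarith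

end HeatRelations

end Abstract

/-! ### Finite-particle vectors in a Hilbert space direct sum -/

section Graded

variable {G : ℕ → Type*} [∀ n, NormedAddCommGroup (G n)]

/-- A sequence which vanishes from some index on. -/
def IsFin (Ψ : ∀ n, G n) : Prop := ∃ N, ∀ n, N ≤ n → Ψ n = 0

theorem IsFin.memℓp {Ψ : ∀ n, G n} (h : IsFin Ψ) : Memℓp Ψ 2 := by
  obtain ⟨N, hN⟩ := h
  refine memℓp_gen (summable_of_hasFiniteSupport ((Set.finite_lt_nat N).subset fun n hn => ?_))
  by_contra h
  exact hn (by simp [hN n (not_lt.1 h)])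

theorem enorm_sq_eq_tsum (Ψ : lp G 2) : ‖Ψ‖ₑ ^ 2 = ∑' n, ‖Ψ n‖ₑ ^ 2 := by
  have h : HasSum (fun n => ‖Ψ n‖ ^ 2) (‖Ψ‖ ^ 2) := by
    have := lp.hasSum_norm (p := 2) (by norm_num) Ψ
    simpa using this
  have h2 := ENNReal.ofReal_tsum_of_nonneg (fun n => sq_nonneg ‖Ψ n‖) h.summable
  rw [h.tsum_eq, ENNReal.ofReal_pow (norm_nonneg _), ofReal_norm] at h2
  rw [h2]
  refine tsum_congr fun n => ?_
  rw [ENNReal.ofReal_pow (norm_nonneg _), ofReal_norm]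

variable [∀ n, InnerProductSpace ℂ (G n)]

variable (G) in
/-- The submodule of finite-particle vectors. -/
def finiteSubmodule : Submodule ℂ (lp G 2) where
  carrier := {Ψ | IsFin (Ψ : ∀ n, G n)}
  zero_mem' := ⟨0, fun _ _ => rfl⟩
  add_mem' := by
    rintro Ψ Φ ⟨N, hN⟩ ⟨M, hM⟩
    refine ⟨max N M, fun n hn => ?_⟩
    rw [lp.coeFn_add, Pi.add_apply, hN n ((le_max_left _ _).trans hn),
      hM n ((le_max_right _ _).trans hn), add_zero]
  smul_mem' := by
    rintro c Ψ ⟨N, hN⟩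
    refine ⟨N, fun n hn => ?_⟩
    rw [lp.coeFn_smul, Pi.smul_apply, hN n hn, smul_zero]

variable (G) in
/-- The finite-particle vectors, as an inner product space. -/
def FiniteVec : Type _ := finiteSubmodule G

instance : NormedAddCommGroup (FiniteVec G) := inferInstanceAs (NormedAddCommGroup (finiteSubmodule G))

instance : InnerProductSpace ℂ (FiniteVec G) :=
  inferInstanceAs (InnerProductSpace ℂ (finiteSubmodule G))

/-- A finite-particle vector as an element of the Hilbert space direct sum. -/
def FiniteVec.val (Ψ : FiniteVec G) : lp G 2 := Subtype.val (p := (· ∈ finiteSubmodule G)) Ψ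

theorem FiniteVec.isFin (Ψ : FiniteVec G) : IsFin (Ψ.val : ∀ n, G n) :=
  Subtype.property (p := (· ∈ finiteSubmodule G)) Ψ

theorem FiniteVec.inner_val (Ψ Φ : FiniteVec G) : inner ℂ Ψ.val Φ.val = inner ℂ Ψ Φ := rfl

theorem FiniteVec.norm_val (Ψ : FiniteVec G) : ‖Ψ.val‖ = ‖Ψ‖ := rfl

/-- The finite-particle vector with given components. -/
def mkFiniteVec (Ψ : ∀ n, G n) (h : IsFin Ψ) : FiniteVec G := ⟨⟨Ψ, h.memℓp⟩, h⟩

theorem FiniteVec.ext {Ψ Φ : FiniteVec G} (h : ∀ n, Ψ.val n = Φ.val n) : Ψ = Φ :=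
  Subtype.ext (Subtype.ext (funext h))

/-- The components of a raising operator. -/
def raiseSeq (C : ∀ n, G n →ₗ[ℂ] G (n + 1)) (Ψ : ∀ n, G n) : ∀ n, G n
  | 0 => 0
  | n + 1 => C n (Ψ n)

/-- The operator on finite-particle vectors mapping the `n`-th component to the `(n+1)`-st one. -/
def raise (C : ∀ n, G n →ₗ[ℂ] G (n + 1)) : FiniteVec G →ₗ[ℂ] FiniteVec G where
  toFun Ψ := mkFiniteVec (raiseSeq C Ψ.val) (by
    obtain ⟨N, hN⟩ := Ψ.isFin
    refine ⟨N + 1, fun n hn => ?_⟩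
    obtain ⟨k, rfl⟩ : ∃ k, n = k + 1 := ⟨n - 1, by omega⟩
    simp only [raiseSeq]
    rw [hN k (by omega), map_zero])
  map_add' Ψ Φ := FiniteVec.ext fun n => by
    cases n with
    | zero => exact (add_zero (0 : G 0)).symm
    | succ n => exact map_add (C n) _ _
  map_smul' c Ψ := FiniteVec.ext fun n => by
    cases n with
    | zero => exact (smul_zero (A := G 0) c).symm
    | succ n => exact map_smul (C n) _ _

/-- The operator on finite-particle vectors mapping the `(n+1)`-st component to the `n`-th one. -/
def lower (A : ∀ n, G (n + 1) →ₗ[ℂ] G n) : FiniteVec G →ₗ[ℂ] FiniteVec G where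
  toFun Ψ := mkFiniteVec (fun n => A n (Ψ.val (n + 1))) (by
    obtain ⟨N, hN⟩ := Ψ.isFin
    exact ⟨N, fun n hn => (congrArg (A n) (hN (n + 1) (by omega))).trans (map_zero _)⟩)
  map_add' _ _ := FiniteVec.ext fun n => map_add (A n) _ _
  map_smul' _ _ := FiniteVec.ext fun n => map_smul (A n) _ _

/-- The operator on finite-particle vectors acting on each component. -/
def diag (D : ∀ n, G n →ₗ[ℂ] G n) : FiniteVec G →ₗ[ℂ] FiniteVec G where
  toFun Ψ := mkFiniteVec (fun n => D n (Ψ.val n)) (by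
    obtain ⟨N, hN⟩ := Ψ.isFin
    exact ⟨N, fun n hn => (congrArg (D n) (hN n hn)).trans (map_zero _)⟩)
  map_add' _ _ := FiniteVec.ext fun n => map_add (D n) _ _
  map_smul' _ _ := FiniteVec.ext fun n => map_smul (D n) _ _

theorem raise_zero (C : ∀ n, G n →ₗ[ℂ] G (n + 1)) (Ψ : FiniteVec G) : (raise C Ψ).val 0 = 0 := rfl

theorem raise_succ (C : ∀ n, G n →ₗ[ℂ] G (n + 1)) (Ψ : FiniteVec G) (n : ℕ) :
    (raise C Ψ).val (n + 1) = C n (Ψ.val n) := rfl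

theorem lower_apply (A : ∀ n, G (n + 1) →ₗ[ℂ] G n) (Ψ : FiniteVec G) (n : ℕ) :
    (lower A Ψ).val n = A n (Ψ.val (n + 1)) := rfl

theorem diag_apply (D : ∀ n, G n →ₗ[ℂ] G n) (Ψ : FiniteVec G) (n : ℕ) :
    (diag D Ψ).val n = D n (Ψ.val n) := rfl

theorem FiniteVec.add_apply (Ψ Φ : FiniteVec G) (n : ℕ) : (Ψ + Φ).val n = Ψ.val n + Φ.val n := rfl

theorem FiniteVec.sub_apply (Ψ Φ : FiniteVec G) (n : ℕ) : (Ψ - Φ).val n = Ψ.val n - Φ.val n := rfl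

theorem FiniteVec.smul_apply (c : ℂ) (Ψ : FiniteVec G) (n : ℕ) : (c • Ψ).val n = c • Ψ.val n := rfl

/-- A shift of the summation index, the lost component of `Ψ'` being zero. It is stated through
components so that it applies equally to finite-particle vectors and to the unbounded creation
operator on its maximal domain. -/
theorem inner_raise {C : ∀ n, G n →ₗ[ℂ] G (n + 1)} {A : ∀ n, G (n + 1) →ₗ[ℂ] G n}
    (h : ∀ (n : ℕ) (u : G n) (v : G (n + 1)), inner ℂ (C n u) v = inner ℂ u (A n v)) {Ψ Ψ' Φ Φ' : lp G 2} (h0 : Ψ' 0 = 0)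
    (hs : ∀ n, Ψ' (n + 1) = C n (Ψ n)) (hΦ : ∀ n, Φ' n = A n (Φ (n + 1))) :
    inner ℂ Ψ' Φ = inner ℂ Ψ Φ' := by
  rw [lp.inner_eq_tsum, lp.inner_eq_tsum, (lp.summable_inner (𝕜 := ℂ) Ψ' Φ).tsum_eq_zero_add, h0,
    inner_zero_left, zero_add]
  exact tsum_congr fun n => by rw [hs, hΦ, h]

theorem inner_raise_left {C : ∀ n, G n →ₗ[ℂ] G (n + 1)} {A : ∀ n, G (n + 1) →ₗ[ℂ] G n}
    (h : ∀ (n : ℕ) (u : G n) (v : G (n + 1)), inner ℂ (C n u) v = inner ℂ u (A n v)) (Ψ Φ : FiniteVec G) :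
    inner ℂ (raise C Ψ) Φ = inner ℂ Ψ (lower A Φ) :=
  inner_raise (Ψ := Ψ.val) (Ψ' := (raise C Ψ).val) (Φ := Φ.val) (Φ' := (lower A Φ).val) h
    (raise_zero C Ψ) (raise_succ C Ψ) (lower_apply A Φ)

theorem inner_diag_left {D : ∀ n, G n →ₗ[ℂ] G n}
    (h : ∀ (n : ℕ) (u v : G n), inner ℂ (D n u) v = inner ℂ u (D n v)) (Ψ Φ : FiniteVec G) :
    inner ℂ (diag D Ψ) Φ = inner ℂ Ψ (diag D Φ) := by
  rw [← FiniteVec.inner_val, ← FiniteVec.inner_val, lp.inner_eq_tsum, lp.inner_eq_tsum]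
  exact tsum_congr fun n => h n _ _

theorem norm_diag_le {D : ∀ n, G n →ₗ[ℂ] G n} (h : ∀ n u, ‖D n u‖ ≤ ‖u‖) (Ψ : FiniteVec G) :
    ‖diag D Ψ‖ ≤ ‖Ψ‖ := by
  refine enorm_le_iff_norm_le.1 ?_
  refine (ENNReal.pow_le_pow_left_iff two_ne_zero).1 ?_
  change ‖(diag D Ψ).val‖ₑ ^ 2 ≤ ‖Ψ.val‖ₑ ^ 2
  rw [enorm_sq_eq_tsum, enorm_sq_eq_tsum]
  refine ENNReal.tsum_le_tsum fun n => ?_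
  gcongr
  exact enorm_le_iff_norm_le.2 (h n _)

/-- The truncation of a vector to the components with index below `N`. -/
def trunc (N : ℕ) (Ψ : lp G 2) : FiniteVec G :=
  mkFiniteVec (fun n => if n < N then Ψ n else 0) ⟨N, fun _ hn => if_neg (not_lt.2 hn)⟩

theorem trunc_apply (N : ℕ) (Ψ : lp G 2) (n : ℕ) :
    (trunc N Ψ).val n = if n < N then Ψ n else 0 := rfl

/-- A finite-particle vector sees only finitely many components of `Ψ`; the replacement of `Ψ` by a
truncation is exact, not a limit. -/
theorem exists_inner_eq_inner_trunc (Ψ : lp G 2) (Φ : FiniteVec G) :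
    ∃ N, ∀ M, N ≤ M → inner ℂ Ψ Φ.val = inner ℂ (trunc M Ψ) Φ := by
  obtain ⟨N, hN⟩ := Φ.isFin
  refine ⟨N, fun M hM => ?_⟩
  rw [← FiniteVec.inner_val, lp.inner_eq_tsum, lp.inner_eq_tsum]
  refine tsum_congr fun n => ?_
  rw [trunc_apply]
  split_ifs with h
  · rfl
  · rw [hN n (by omega), inner_zero_right, inner_zero_right]

theorem tendsto_trunc (Ψ : lp G 2) :
    Filter.Tendsto (fun N => (trunc N Ψ).val) Filter.atTop (nhds Ψ) := by
  have h := (lp.hasSum_single (p := 2) (by norm_num) Ψ).tendsto_sum_nat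
  refine h.congr fun N => ?_
  ext n
  rw [lp.coeFn_sum, Finset.sum_apply, trunc_apply]
  simp only [lp.single_apply]
  rw [Finset.sum_pi_single]
  simp only [Finset.mem_range]

theorem dense_finiteVec : Dense (finiteSubmodule G : Set (lp G 2)) := fun Ψ =>
  mem_closure_of_tendsto (tendsto_trunc Ψ) (Filter.Eventually.of_forall fun N => (trunc N Ψ).isFin)

end Graded

/-! ### Creation, annihilation and the heat semigroup on finite-particle vectors -/

/-- The finite-particle vectors in Fock space. -/
abbrev FiniteFock (d : ℕ) : Type := FiniteVec fun n => symL2 d n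

/-- The creation operator on finite-particle vectors. -/
def cre {d : ℕ} (f : HL2 d) : FiniteFock d →ₗ[ℂ] FiniteFock d := raise (G := fun n => symL2 d n) fun n => sectorCreate n f

/-- The annihilation operator on finite-particle vectors. -/
def ann {d : ℕ} (f : HL2 d) : FiniteFock d →ₗ[ℂ] FiniteFock d :=
  lower (G := fun n => symL2 d n) fun n => sectorAnnihilate n f

/-- The operator `exp(-t H₀)` on finite-particle vectors. -/
def heat (d : ℕ) (m : ℝ) (t : ℝ≥0) : FiniteFock d →ₗ[ℂ] FiniteFock d :=
  diag (G := fun n => symL2 d n) (sectorHeat d m t)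

theorem inner_cre_left {d : ℕ} (f : HL2 d) (Ψ Φ : FiniteFock d) :
    inner ℂ (cre f Ψ) Φ = inner ℂ Ψ (ann f Φ) :=
  inner_raise_left (G := fun n => symL2 d n) (fun _ => inner_sectorCreate_left f) Ψ Φ

theorem inner_heat_left {d : ℕ} (m : ℝ) (t : ℝ≥0) (Ψ Φ : FiniteFock d) :
    inner ℂ (heat d m t Ψ) Φ = inner ℂ Ψ (heat d m t Φ) :=
  inner_diag_left (G := fun n => symL2 d n) (fun _ => inner_sectorHeat_left m t) Ψ Φ

theorem norm_heat_le {d : ℕ} (m : ℝ) (t : ℝ≥0) (Ψ : FiniteFock d) : ‖heat d m t Ψ‖ ≤ ‖Ψ‖ :=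
  norm_diag_le (G := fun n => symL2 d n) (fun _ => norm_sectorHeat_le m t) Ψ

theorem heat_heat {d : ℕ} (m : ℝ) (s t : ℝ≥0) (Ψ : FiniteFock d) :
    heat d m s (heat d m t Ψ) = heat d m (s + t) Ψ :=
  FiniteVec.ext fun _ => sectorHeat_sectorHeat m s t _

/-- The canonical commutation relations. -/
theorem ann_cre {d : ℕ} (f g : HL2 d) (Ψ : FiniteFock d) :
    ann f (cre g Ψ) = cre g (ann f Ψ) + (inner ℂ f g : ℂ) • Ψ := by
  refine FiniteVec.ext fun n => ?_
  rw [FiniteVec.add_apply, FiniteVec.smul_apply]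
  cases n with
  | zero => exact (sectorAnnihilate_sectorCreate_zero f g _).trans (zero_add _).symm
  | succ n => exact sectorAnnihilate_sectorCreate_succ f g _

theorem ann_ann {d : ℕ} (f g : HL2 d) (Ψ : FiniteFock d) : ann f (ann g Ψ) = ann g (ann f Ψ) :=
  FiniteVec.ext fun _ => sectorAnnihilate_comm f g _

theorem heat_cre {d : ℕ} (m : ℝ) (t : ℝ≥0) (f : HL2 d) (Ψ : FiniteFock d) :
    heat d m t (cre f Ψ) = cre (heat₁ d m t f) (heat d m t Ψ) := by
  refine FiniteVec.ext fun n => ?_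
  cases n with
  | zero => exact map_zero (sectorHeat d m t 0)
  | succ n => exact sectorHeat_sectorCreate m t f _

theorem ann_heat {d : ℕ} (m : ℝ) (t : ℝ≥0) (f : HL2 d) (Ψ : FiniteFock d) :
    ann f (heat d m t Ψ) = heat d m t (ann (heat₁ d m t f) Ψ) :=
  FiniteVec.ext fun _ => sectorAnnihilate_sectorHeat m t f _

theorem cre_sub_left {d : ℕ} (f g : HL2 d) (Ψ : FiniteFock d) :
    cre (f - g) Ψ = cre f Ψ - cre g Ψ := by
  refine FiniteVec.ext fun n => ?_
  rw [FiniteVec.sub_apply]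
  cases n with
  | zero => exact (sub_zero (0 : symL2 d 0)).symm
  | succ n => exact sectorCreate_sub_left f g _

theorem ann_sub_left {d : ℕ} (f g : HL2 d) (Ψ : FiniteFock d) :
    ann (f - g) Ψ = ann f Ψ - ann g Ψ := by
  refine ext_inner_left ℂ fun Φ => ?_
  rw [← inner_cre_left, cre_sub_left, inner_sub_left, inner_sub_right, inner_cre_left,
    inner_cre_left]

/-- The difference `f - exp(-t ω) f`. -/
def heatDiff {d : ℕ} (m : ℝ) (t : ℝ≥0) (f : HL2 d) : HL2 d := f - heat₁ d m t f

/-- The operator `exp(-t ω)` is a symmetric contraction, so `1 - exp(-t ω)` has a nonnegative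
quadratic form. -/
theorem inner_heatDiff_self {d : ℕ} (m : ℝ) (t : ℝ≥0) (f : HL2 d) :
    inner ℂ (heatDiff m t f) f = (((inner ℂ (heatDiff m t f) f : ℂ).re : ℝ) : ℂ) ∧
      0 ≤ (inner ℂ (heatDiff m t f) f : ℂ).re := by
  have h1 : inner ℂ (heat₁ d m t f) f = inner ℂ f (heat₁ d m t f) := inner_mulLp_left _ _ _ _
  have h2 : ((inner ℂ (heat₁ d m t f) f : ℂ)).im = 0 := by
    have := inner_conj_symm (𝕜 := ℂ) (heat₁ d m t f) f
    rw [← h1] at this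
    exact Complex.conj_eq_iff_im.1 this
  have h3 : inner ℂ f f = ((‖f‖ ^ 2 : ℝ) : ℂ) := by
    rw [inner_self_eq_norm_sq_to_K]
    push_cast
    rfl
  have h4 : (inner ℂ (heat₁ d m t f) f : ℂ).re ≤ ‖f‖ ^ 2 := by
    refine (Complex.re_le_norm _).trans ((norm_inner_le_norm _ _).trans ?_)
    rw [sq]
    exact mul_le_mul_of_nonneg_right
      (norm_mulLp_le (measurable_heatFactor₁ d m t) abs_heatFactor₁_le f) (norm_nonneg _)
  rw [heatDiff, inner_sub_left, h3]
  constructor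
  · refine Complex.ext rfl ?_
    rw [Complex.sub_im, h2, Complex.ofReal_im, Complex.ofReal_im, sub_zero]
  · rw [Complex.sub_re, Complex.ofReal_re]
    linarith

/-- The square root `T` of the semigroup is its value at half the time, and `heat₁ f = f - g` turns
the intertwining relations into the commutators with `b` and `b'`. -/
theorem heatRelations {d : ℕ} (m : ℝ) (t : ℝ≥0) (f : HL2 d) :
    HeatRelations (ann f) (cre f) (ann (heatDiff m t f)) (cre (heatDiff m t f)) (heat d m t)
      (heat d m (t / 2)) ‖f‖ ‖heatDiff m t f‖ (inner ℂ (heatDiff m t f) f : ℂ).re where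
  inner_c := inner_cre_left f
  inner_b' := inner_cre_left _
  inner_T := inner_heat_left m _
  E_eq Ψ := by rw [heat_heat, add_halves]
  norm_T := norm_heat_le m _
  E_c Ψ := by rw [heat_cre, heatDiff, cre_sub_left, sub_sub_cancel]
  a_E Ψ := by rw [ann_heat, heatDiff, ann_sub_left, map_sub, sub_sub_cancel]
  a_c Ψ := by
    rw [ann_cre, inner_self_eq_norm_sq_to_K]
    push_cast
    rfl
  b_b' Ψ := by
    rw [ann_cre, inner_self_eq_norm_sq_to_K]
    push_cast
    rfl
  b_c Ψ := by rw [ann_cre, ← (inner_heatDiff_self m t f).1]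
  a_b := ann_ann f _
  β_nonneg := norm_nonneg _
  η_nonneg := norm_nonneg _
  c₀_nonneg := (inner_heatDiff_self m t f).2

/-! ### Energy bounds on finite-particle vectors -/

/-- The weighted square norm `∑ₙ ∫ w(θ(k₁) + ⋯ + θ(kₙ)) |Ψₙ(k₁, …, kₙ)|² dk`. -/
def energy {d : ℕ} (θ : Rd d → ℝ≥0∞) (w : ℝ≥0∞ → ℝ≥0∞) (Ψ : Fock d) : ℝ≥0∞ :=
  ∑' n, sectorEnergy θ w (Ψ n : L2n d n)

theorem energy_one {d : ℕ} (θ : Rd d → ℝ≥0∞) (Ψ : Fock d) :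
    energy θ (fun _ => 1) Ψ = ‖Ψ‖ₑ ^ 2 := by
  rw [enorm_sq_eq_tsum, energy]
  exact tsum_congr fun n => sectorEnergy_one θ _

/-- The sector bounds are summed; the vacuum component of `Ψ` is annihilated and is added on the
right for free. -/
theorem energy_ann_le {d : ℕ} {s F : Rd d → ℝ≥0∞} (hs : Measurable s) (hF : AEMeasurable F)
    {w : ℝ≥0∞ → ℝ≥0∞} (hw : Monotone w) {f : HL2 d} (hf : ∀ᵐ y, ‖f y‖ₑ ≤ F y * s y)
    (Ψ : FiniteFock d) :
    energy (fun y => s y ^ 2) w (ann f Ψ).val ≤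
      (∫⁻ y, F y ^ 2) * energy (fun y => s y ^ 2) (fun x => w x * x) Ψ.val := by
  rw [energy, energy, ← ENNReal.tsum_mul_left]
  rw [tsum_eq_zero_add' (f := fun n => (∫⁻ y, F y ^ 2) * sectorEnergy (fun y => s y ^ 2)
    (fun x => w x * x) (Ψ.val n : L2n d n)) ENNReal.summable]
  refine le_add_left (ENNReal.tsum_le_tsum fun n => ?_)
  exact sectorEnergy_annihilate_le hs (fun _ => rfl) hF hw hf _

/-! ### Relative bounds for annihilation operators -/

/-- The one-particle vector `f` is `s` times a function of norm at most `α`. -/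
def WeightBound {d : ℕ} (s : Rd d → ℝ≥0∞) (f : HL2 d) (α : ℝ) : Prop :=
  ∃ F : Rd d → ℝ≥0∞, AEMeasurable F ∧ (∀ᵐ y, ‖f y‖ₑ ≤ F y * s y) ∧
    ∫⁻ y, F y ^ 2 ≤ ENNReal.ofReal α ^ 2

theorem weightBound_one {d : ℕ} (f : HL2 d) : WeightBound (fun _ => 1) f ‖f‖ := by
  refine ⟨fun y => ‖f y‖ₑ, (Lp.aestronglyMeasurable f).enorm, by simp, ?_⟩
  rw [← enorm_sq_eq_lintegral, ofReal_norm]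

theorem norm_le_of_enorm_sq_le {E : Type*} [SeminormedAddCommGroup E] {x : E} {r : ℝ} (hr : 0 ≤ r)
    (h : ‖x‖ₑ ^ 2 ≤ ENNReal.ofReal r ^ 2) : ‖x‖ ≤ r := by
  rw [ENNReal.pow_le_pow_left_iff two_ne_zero, ← ofReal_norm] at h
  exact (ENNReal.ofReal_le_ofReal_iff hr).1 h

/-- The bound `‖a(f) Ψ‖ ≤ ‖f / √θ‖ ‖dΓ(θ)^(1/2) Ψ‖`, with `h` bounding the last norm. -/
theorem norm_ann_le {d : ℕ} {s : Rd d → ℝ≥0∞} (hs : Measurable s) {f : HL2 d} {α h : ℝ}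
    (hα : 0 ≤ α) (hh : 0 ≤ h) (hf : WeightBound s f α) {Ψ : FiniteFock d}
    (hΨ : energy (fun y => s y ^ 2) (fun x => x) Ψ.val ≤ ENNReal.ofReal h ^ 2) :
    ‖ann f Ψ‖ ≤ α * h := by
  obtain ⟨F, hF, hfF, hFα⟩ := hf
  refine norm_le_of_enorm_sq_le (by positivity) ?_
  have h1 := energy_ann_le hs hF (w := fun _ => 1) monotone_const hfF Ψ
  rw [energy_one] at h1
  simp only [one_mul] at h1
  rw [ENNReal.ofReal_mul hα, mul_pow]
  exact h1.trans (mul_le_mul' hFα hΨ)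

/-- The inner annihilation operator raises the weight from `x` to `x²`, so two of them are
controlled by `‖dΓ(θ) Ψ‖`. -/
theorem norm_ann_ann_le {d : ℕ} {s : Rd d → ℝ≥0∞} (hs : Measurable s) {f g : HL2 d} {α β h : ℝ}
    (hα : 0 ≤ α) (hβ : 0 ≤ β) (hh : 0 ≤ h) (hf : WeightBound s f α) (hg : WeightBound s g β)
    {Ψ : FiniteFock d}
    (hΨ : energy (fun y => s y ^ 2) (fun x => x * x) Ψ.val ≤ ENNReal.ofReal h ^ 2) :
    ‖ann f (ann g Ψ)‖ ≤ α * (β * h) := by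
  refine norm_ann_le hs hα (by positivity) hf ?_
  obtain ⟨F, hF, hfF, hFα⟩ := hg
  rw [ENNReal.ofReal_mul hβ, mul_pow]
  exact (energy_ann_le hs hF (w := fun x => x) monotone_id hfF Ψ).trans (mul_le_mul' hFα hΨ)

theorem energy_heat_le {d : ℕ} (m : ℝ) (t : ℝ≥0) (θ : Rd d → ℝ≥0∞) (w : ℝ≥0∞ → ℝ≥0∞)
    (Ψ : FiniteFock d) : energy θ w (heat d m t Ψ).val ≤ energy θ w Ψ.val := by
  refine ENNReal.tsum_le_tsum fun n => lintegral_mono_ae ?_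
  filter_upwards [heatL2_coeFn m t (Ψ.val n : L2n d n)] with k hk
  have h : ((heat d m t Ψ).val n : L2n d n) k = (heatFactor d m t k : ℂ) * (Ψ.val n : L2n d n) k := hk
  rw [h, enorm_mul]
  gcongr
  refine mul_le_of_le_one_left' ?_
  rw [← ofReal_norm, Complex.norm_real, Real.norm_eq_abs, ← ENNReal.ofReal_one]
  exact ENNReal.ofReal_le_ofReal (abs_heatFactor_le k)

/-! ### The weight `√ω` and smoothing by the heat semigroup -/

/-- The square root of the dispersion relation. -/
def sqrtOmega (d : ℕ) (m : ℝ) (k : Rd d) : ℝ≥0∞ := ENNReal.ofReal (Real.sqrt (omega d m k))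

theorem measurable_sqrtOmega (d : ℕ) (m : ℝ) : Measurable (sqrtOmega d m) :=
  ENNReal.measurable_ofReal.comp (measurable_omega d m).sqrt

theorem sqrtOmega_sq {d : ℕ} (m : ℝ) (k : Rd d) :
    sqrtOmega d m k ^ 2 = ENNReal.ofReal (omega d m k) := by
  rw [sqrtOmega, ← ENNReal.ofReal_pow (Real.sqrt_nonneg _), Real.sq_sqrt (omega_nonneg d m k)]

theorem sum_sqrtOmega_sq {d n : ℕ} (m : ℝ) (k : Fin n → Rd d) :
    ∑ j, sqrtOmega d m (k j) ^ 2 = ENNReal.ofReal (∑ j, omega d m (k j)) := by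
  rw [ENNReal.ofReal_sum_of_nonneg fun j _ => omega_nonneg d m _]
  exact Finset.sum_congr rfl fun j _ => sqrtOmega_sq m _

/-- Pointwise `Ω exp(-2 t Ω) ≤ 1 / t`. With the weight bound of order `t` for `f - exp(-t ω) f`,
this makes `b exp(-t H₀)` of order `√t` on all finite-particle vectors. -/
theorem energy_heat_smoothing {d : ℕ} (m : ℝ) {t : ℝ≥0} (ht : 0 < t) (Ψ : FiniteFock d) :
    energy (fun y => sqrtOmega d m y ^ 2) (fun x => x) (heat d m t Ψ).val ≤
      ENNReal.ofReal (Real.sqrt (1 / t) * ‖Ψ‖) ^ 2 := by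
  have h0 : ENNReal.ofReal (Real.sqrt (1 / t) * ‖Ψ‖) ^ 2 =
      ENNReal.ofReal (1 / t) * energy (fun y => sqrtOmega d m y ^ 2) (fun _ => 1) Ψ.val := by
    rw [energy_one, ENNReal.ofReal_mul (Real.sqrt_nonneg _), mul_pow,
      ← ENNReal.ofReal_pow (Real.sqrt_nonneg _), Real.sq_sqrt (by positivity), ofReal_norm]
    rfl
  rw [h0, energy, energy, ← ENNReal.tsum_mul_left]
  refine ENNReal.tsum_le_tsum fun n => ?_
  rw [sectorEnergy, sectorEnergy, ← lintegral_const_mul' _ _ ENNReal.ofReal_ne_top]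
  refine lintegral_mono_ae ?_
  filter_upwards [heatL2_coeFn m t (Ψ.val n : L2n d n)] with k hk
  have h : ((heat d m t Ψ).val n : L2n d n) k = (heatFactor d m t k : ℂ) * (Ψ.val n : L2n d n) k := hk
  rw [h, enorm_mul, mul_pow, ← mul_assoc, one_mul, sum_sqrtOmega_sq]
  gcongr
  have hΩ : 0 ≤ ∑ j, omega d m (k j) := Finset.sum_nonneg fun j _ => omega_nonneg d m _
  have ht' : (0 : ℝ) < t := ht
  rw [← ofReal_norm, Complex.norm_real, heatFactor, Real.norm_of_nonneg (Real.exp_pos _).le,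
    ← ENNReal.ofReal_pow (Real.exp_pos _).le, ← ENNReal.ofReal_mul hΩ]
  refine ENNReal.ofReal_le_ofReal ?_
  rw [← Real.exp_nat_mul, le_div_iff₀ ht']
  generalize ∑ j, omega d m (k j) = Ω at hΩ
  -- One of the two factors `exp(-t Ω)` absorbs `t Ω`; the other is at most one.
  have e1 : (t : ℝ) * Ω ≤ Real.exp (t * Ω) := by linarith [Real.add_one_le_exp ((t : ℝ) * Ω)]
  have e2 : Real.exp ((2 : ℕ) * -((t : ℝ) * Ω)) * Real.exp (t * Ω) ≤ 1 := by
    rw [← Real.exp_add, Real.exp_le_one_iff]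
    push_cast
    nlinarith [mul_nonneg ht'.le hΩ]
  nlinarith [mul_le_mul_of_nonneg_left e1 (Real.exp_pos ((2 : ℕ) * -((t : ℝ) * Ω))).le]

/-! ### Weak forms of unbounded operators -/

section Weak

variable {H : Type*} [NormedAddCommGroup H] [InnerProductSpace ℂ H]

/-- For a non-closable operator `LinearPMap.closure` is the operator itself, so the statement holds
in either case and closability never has to be shown. -/
theorem mem_closure_graph_of_mem_closure (T : H →ₗ.[ℂ] H) (Ψ : T.closure.domain) :
    ((Ψ : H), T.closure Ψ) ∈ closure (T.graph : Set (H × H)) := by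
  have h := T.closure.mem_graph Ψ
  by_cases hT : T.IsClosable
  · rw [← hT.graph_closure_eq_closure_graph] at h
    exact h
  · have e : T.closure.graph = T.graph := by rw [LinearPMap.closure_def' hT]
    rw [e] at h
    exact subset_closure h

/-- The weak identity is a closed condition on the graph. -/
theorem inner_closure {T : H →ₗ.[ℂ] H} {Φ Φ' : H}
    (h : ∀ Ψ : T.domain, inner ℂ Φ (T Ψ) = inner ℂ Φ' (Ψ : H)) (Ψ : T.closure.domain) :
    inner ℂ Φ (T.closure Ψ) = inner ℂ Φ' (Ψ : H) := by
  have hc : IsClosed {p : H × H | inner ℂ Φ p.2 = inner ℂ Φ' p.1} :=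
    isClosed_eq (by fun_prop) (by fun_prop)
  refine hc.closure_subset_iff.2 ?_ (mem_closure_graph_of_mem_closure T Ψ)
  rintro ⟨x, y⟩ hxy
  obtain ⟨z, hz1, hz2⟩ := (LinearPMap.mem_graph_iff T).1 hxy
  have := h z
  simp only at hz1 hz2
  rw [hz1, hz2] at this
  exact this

theorem inner_opMul {A B : H →ₗ.[ℂ] H} {Φ Φ₁ Φ₂ : H}
    (hB : ∀ Ψ : B.domain, inner ℂ Φ (B Ψ) = inner ℂ Φ₁ (Ψ : H))
    (hA : ∀ Ψ : A.domain, inner ℂ Φ₁ (A Ψ) = inner ℂ Φ₂ (Ψ : H)) (Ψ : (opMul B A).domain) :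
    inner ℂ Φ (opMul B A Ψ) = inner ℂ Φ₂ (Ψ : H) :=
  (hB _).trans (hA _)

theorem inner_opVal {T : H →ₗ.[ℂ] H} {Φ Φ' : H}
    (h : ∀ Ψ : T.domain, inner ℂ Φ (T Ψ) = inner ℂ Φ' (Ψ : H)) {Ψ : H} (hΨ : Ψ ∈ T.domain) :
    inner ℂ Φ (opVal T Ψ) = inner ℂ Φ' Ψ := by
  rw [opVal, dif_pos hΨ]
  exact h ⟨Ψ, hΨ⟩

theorem integrable_inner_opIntegral [CompleteSpace H] {X : Type*} [MeasurableSpace X]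
    {ν : Measure X} {w : X → ℝ} {T : X → (H →ₗ.[ℂ] H)} {Φ : H} {Φ' : X → H}
    (h : ∀ x, ∀ Ψ : (T x).domain, inner ℂ Φ (T x Ψ) = inner ℂ (Φ' x) (Ψ : H))
    (Ψ : (opIntegral ν w T).domain) :
    Integrable (fun x => (w x : ℂ) * inner ℂ (Φ' x) (Ψ : H)) ν ∧
      inner ℂ Φ (opIntegral ν w T Ψ) = ∫ x, (w x : ℂ) * inner ℂ (Φ' x) (Ψ : H) ∂ν := by
  obtain ⟨h1, h2⟩ := Ψ.2
  have h3 : (fun x => inner ℂ Φ ((w x : ℂ) • opVal (T x) (Ψ : H))) =ᵐ[ν]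
      fun x => (w x : ℂ) * inner ℂ (Φ' x) (Ψ : H) := by
    filter_upwards [h1] with x hx
    rw [inner_smul_right]
    by_cases hw : w x = 0
    · simp [hw]
    · rw [inner_opVal (h x) (hx hw)]
  refine ⟨(h2.const_inner Φ).congr h3, ?_⟩
  rw [← integral_congr_ae h3]
  exact (integral_inner h2 Φ).symm

/-- A point of the closed graph is a limit of points of the graph, and the integrals converge by
domination with `|w|`. The measurability of the limiting integrand is inherited from the
approximants, so none is needed for `x ↦ Φ' x`. -/
theorem integrable_inner_closure_opIntegral [CompleteSpace H] {X : Type*} [MeasurableSpace X]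
    {ν : Measure X} {w : X → ℝ} (hw : Integrable w ν) {T : X → (H →ₗ.[ℂ] H)} {Φ : H} {Φ' : X → H}
    {C : ℝ} (hC : ∀ x, ‖Φ' x‖ ≤ C)
    (h : ∀ x, ∀ Ψ : (T x).domain, inner ℂ Φ (T x Ψ) = inner ℂ (Φ' x) (Ψ : H))
    (Ψ : (opIntegral ν w T).closure.domain) :
    Integrable (fun x => (w x : ℂ) * inner ℂ (Φ' x) (Ψ : H)) ν ∧
      inner ℂ Φ ((opIntegral ν w T).closure Ψ) = ∫ x, (w x : ℂ) * inner ℂ (Φ' x) (Ψ : H) ∂ν := by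
  obtain ⟨p, hp, hlim⟩ := mem_closure_iff_seq_limit.1 (mem_closure_graph_of_mem_closure _ Ψ)
  have hz : ∀ n, ∃ z : (opIntegral ν w T).domain, (z : H) = (p n).1 ∧
      opIntegral ν w T z = (p n).2 := fun n => (LinearPMap.mem_graph_iff _).1 (hp n)
  choose z hz1 hz2 using hz
  have l1 : Filter.Tendsto (fun n => (z n : H)) Filter.atTop (nhds (Ψ : H)) := by
    simp only [hz1]
    exact (continuous_fst.tendsto _).comp hlim
  have l2 : Filter.Tendsto (fun n => opIntegral ν w T (z n)) Filter.atTop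
      (nhds ((opIntegral ν w T).closure Ψ)) := by
    simp only [hz2]
    exact (continuous_snd.tendsto _).comp hlim
  have hi := fun n => integrable_inner_opIntegral h (z n)
  obtain ⟨R, hR⟩ := l1.norm.bddAbove_range
  have hR' : ∀ n, ‖(z n : H)‖ ≤ R := fun n => hR ⟨n, rfl⟩
  have hlim' : ∀ x, Filter.Tendsto (fun n => (w x : ℂ) * inner ℂ (Φ' x) (z n : H)) Filter.atTop
      (nhds ((w x : ℂ) * inner ℂ (Φ' x) (Ψ : H))) := fun x =>
    (tendsto_const_nhds.inner l1).const_mul _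
  have hm : AEStronglyMeasurable (fun x => (w x : ℂ) * inner ℂ (Φ' x) (Ψ : H)) ν :=
    aestronglyMeasurable_of_tendsto_ae Filter.atTop (fun n => (hi n).1.1)
      (Filter.Eventually.of_forall hlim')
  have hb : ∀ x, ∀ y : H, ‖(w x : ℂ) * inner ℂ (Φ' x) y‖ ≤ |w x| * (C * ‖y‖) := fun x y => by
    rw [norm_mul, Complex.norm_real, Real.norm_eq_abs]
    gcongr
    exact (norm_inner_le_norm _ _).trans (mul_le_mul_of_nonneg_right (hC x) (norm_nonneg _))
  refine ⟨(hw.abs.mul_const (C * ‖(Ψ : H)‖)).mono' hm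
    (Filter.Eventually.of_forall fun x => hb x _), ?_⟩
  have l3 := tendsto_integral_of_dominated_convergence (fun x => |w x| * (C * R))
    (fun n => (hi n).1.1) (hw.abs.mul_const _)
    (fun n => Filter.Eventually.of_forall fun x => (hb x (z n)).trans (by
      have hC0 : 0 ≤ C := (norm_nonneg _).trans (hC x)
      have := hR' n
      gcongr)) (Filter.Eventually.of_forall hlim')
  refine tendsto_nhds_unique (tendsto_const_nhds.inner l2) (l3.congr fun n => ?_)
  exact (hi n).2.symm

end Weak

/-! ### The field operators on finite-particle vectors -/

/-- The operator `a(f) + a†(f)` on finite-particle vectors. -/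
def fieldSum {d : ℕ} (f : HL2 d) : FiniteFock d →ₗ[ℂ] FiniteFock d := ann f + cre f

theorem coe_cre_eq {d : ℕ} (f : HL2 d) (Φ : FiniteFock d) :
    ((cre f Φ).val : ∀ n, symL2 d n) = creationSeq f Φ.val := by
  funext n
  cases n with
  | zero => rfl
  | succ n => rfl

theorem mem_creation_domain {d : ℕ} (f : HL2 d) (Φ : FiniteFock d) :
    Φ.val ∈ (creation f).domain := by
  have h := lp.memℓp (cre f Φ).val
  rw [coe_cre_eq] at h
  exact h

theorem creation_apply_finite {d : ℕ} (f : HL2 d) (Φ : FiniteFock d) :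
    creation f ⟨Φ.val, mem_creation_domain f Φ⟩ = (cre f Φ).val :=
  lp.ext (coe_cre_eq f Φ).symm

theorem dense_creation_domain {d : ℕ} (f : HL2 d) :
    Dense ((creation f).domain : Set (Fock d)) :=
  dense_finiteVec.mono fun Ψ hΨ => mem_creation_domain f ⟨Ψ, hΨ⟩

theorem inner_creation {d : ℕ} (f : HL2 d) (Φ : FiniteFock d) (Ψ : (creation f).domain) :
    inner ℂ Φ.val (creation f Ψ) = inner ℂ (ann f Φ).val (Ψ : Fock d) := by
  have h := inner_raise (G := fun n => symL2 d n) (fun _ => inner_sectorCreate_left f)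
    (Ψ := Ψ) (Ψ' := creation f Ψ) (Φ := Φ.val) (Φ' := (ann f Φ).val) rfl (fun _ => rfl)
    (fun _ => rfl)
  rw [← inner_conj_symm, h, inner_conj_symm]

/-- The defining property of the adjoint, available because finite-particle vectors make the
creation operator densely defined. -/
theorem inner_annihilation {d : ℕ} (f : HL2 d) (Φ : FiniteFock d) (Ψ : (annihilation f).domain) :
    inner ℂ Φ.val (annihilation f Ψ) = inner ℂ (cre f Φ).val (Ψ : Fock d) := by
  have h := LinearPMap.adjoint_isFormalAdjoint (dense_creation_domain f) Ψ
    ⟨Φ.val, mem_creation_domain f Φ⟩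
  rw [creation_apply_finite] at h
  rw [← inner_conj_symm, ← inner_conj_symm (cre f Φ).val, ← h]
  rfl

/-- The field operator `2^(-1/2) (a(f) + a†(f))` on finite-particle vectors. -/
def finiteField {d : ℕ} (f : HL2 d) : FiniteFock d →ₗ[ℂ] FiniteFock d :=
  ((Real.sqrt 2)⁻¹ : ℂ) • fieldSum f

/-- Finite-particle vectors are mapped among themselves by the formal adjoint of the field. The
identity passes to the closure and can then be iterated four times. -/
theorem inner_segalField {d : ℕ} (f : HL2 d) (Φ : FiniteFock d) (Ψ : (segalField f).domain) :
    inner ℂ Φ.val (segalField f Ψ) =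
      inner ℂ (finiteField f Φ).val (Ψ : Fock d) := by
  have h : ∀ Ψ : (annihilation f + creation f).domain,
      inner ℂ Φ.val ((annihilation f + creation f) Ψ) = inner ℂ (fieldSum f Φ).val (Ψ : Fock d) := by
    intro Ψ
    rw [LinearPMap.add_apply]
    have h1 := inner_annihilation f Φ ⟨Ψ, Ψ.2.1⟩
    have h2 := inner_creation f Φ ⟨Ψ, Ψ.2.2⟩
    refine (inner_add_right _ _ _).trans ?_
    rw [h1, h2, add_comm]
    exact (inner_add_left _ _ _).symm
  have h3 := inner_closure h Ψ
  refine (inner_smul_right _ _ _).trans ?_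
  refine (congrArg (((Real.sqrt 2 : ℂ)⁻¹) * ·) h3).trans ?_
  refine Eq.trans ?_ (inner_smul_left _ _ _).symm
  rw [← Complex.ofReal_inv, Complex.conj_ofReal]
  rfl

theorem inner_opPow4_segalField {d : ℕ} (f : HL2 d) (Φ : FiniteFock d)
    (Ψ : (opPow4 (segalField f)).domain) :
    inner ℂ Φ.val (opPow4 (segalField f) Ψ) =
      inner ℂ (finiteField f (finiteField f (finiteField f (finiteField f Φ)))).val (Ψ : Fock d) :=
  inner_opMul (inner_segalField f Φ) (inner_opMul (inner_segalField f _)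
    (inner_opMul (inner_segalField f _) (inner_segalField f _))) Ψ

theorem finiteField_pow_four {d : ℕ} (f : HL2 d) (Φ : FiniteFock d) :
    finiteField f (finiteField f (finiteField f (finiteField f Φ))) =
      ((1 / 4 : ℝ) : ℂ) • fieldSum f (fieldSum f (fieldSum f (fieldSum f Φ))) := by
  have h : ((Real.sqrt 2 : ℂ)⁻¹) * (Real.sqrt 2 : ℂ)⁻¹ = 1 / 2 := by
    rw [← mul_inv, ← Complex.ofReal_mul, Real.mul_self_sqrt (by norm_num)]
    norm_num
  simp only [finiteField, LinearMap.smul_apply, map_smul, smul_smul]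
  congr 1
  rw [mul_assoc, mul_assoc, ← mul_assoc, h]
  norm_num

/-- For the constant weight one, the energy is the particle number, at most `N` here. -/
theorem energy_one_weight_le {d N : ℕ} {Φ : FiniteFock d} (hN : ∀ n, N ≤ n → Φ.val n = 0) :
    energy (fun _ => (1 : ℝ≥0∞) ^ 2) (fun x => x) Φ.val ≤
      ENNReal.ofReal (Real.sqrt N * ‖Φ‖) ^ 2 := by
  have h0 : ENNReal.ofReal (Real.sqrt N * ‖Φ‖) ^ 2 =
      N * energy (fun _ => (1 : ℝ≥0∞) ^ 2) (fun _ => 1) Φ.val := by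
    rw [energy_one, ENNReal.ofReal_mul (Real.sqrt_nonneg _), mul_pow,
      ← ENNReal.ofReal_pow (Real.sqrt_nonneg _), Real.sq_sqrt (by positivity), ofReal_norm,
      ENNReal.ofReal_natCast]
    rfl
  rw [h0, energy, energy, ← ENNReal.tsum_mul_left]
  refine ENNReal.tsum_le_tsum fun n => ?_
  rw [sectorEnergy, sectorEnergy, ← lintegral_const_mul' _ _ (ENNReal.natCast_ne_top N)]
  by_cases hn : N ≤ n
  · have h1 : (Φ.val n : L2n d n) = 0 := by rw [hN n hn]; rfl
    rw [h1]
    refine lintegral_mono_ae ?_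
    filter_upwards [Lp.coeFn_zero ℂ 2 (volume : Measure (Fin n → Rd d))] with k hk
    rw [hk]
    simp
  · refine lintegral_mono fun k => ?_
    simp only [one_pow, Finset.sum_const, Finset.card_univ, Fintype.card_fin, nsmul_eq_mul,
      mul_one, one_mul]
    gcongr
    exact_mod_cast (not_le.1 hn).le

theorem norm_cre_le {d : ℕ} (f : HL2 d) (Φ : FiniteFock d) :
    ‖cre f Φ‖ ≤ ‖ann f Φ‖ + ‖f‖ * ‖Φ‖ := by
  refine (norm_le_add_of_comm (norm_nonneg f) (inner_cre_left f) (fun x => ?_) Φ).2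
  rw [ann_cre, inner_self_eq_norm_sq_to_K]
  push_cast
  rfl

theorem norm_fieldSum_le {d N : ℕ} (f : HL2 d) {Φ : FiniteFock d}
    (hN : ∀ n, N ≤ n → Φ.val n = 0) :
    ‖fieldSum f Φ‖ ≤ ‖f‖ * (2 * Real.sqrt N + 1) * ‖Φ‖ := by
  have h1 := norm_ann_le measurable_const (norm_nonneg f) (by positivity) (weightBound_one f)
    (energy_one_weight_le hN)
  have h2 := norm_cre_le f Φ
  have h3 := norm_add_le (ann f Φ) (cre f Φ)
  rw [fieldSum, LinearMap.add_apply]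
  linarith

theorem fieldSum_support {d N : ℕ} (f : HL2 d) {Φ : FiniteFock d}
    (hN : ∀ n, N ≤ n → Φ.val n = 0) : ∀ n, N + 1 ≤ n → (fieldSum f Φ).val n = 0 := by
  intro n hn
  obtain ⟨k, rfl⟩ : ∃ k, n = k + 1 := ⟨n - 1, by omega⟩
  have h : (fieldSum f Φ).val (k + 1) =
      sectorAnnihilate (k + 1) f (Φ.val (k + 1 + 1)) + sectorCreate k f (Φ.val k) := rfl
  rw [h, hN k (by omega), hN (k + 1 + 1) (by omega), map_zero, map_zero, add_zero]

/-- The constant depends on `f` only through the bound `β`; this uniformity in `x` is what dominates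
the interaction integral. -/
theorem exists_norm_iterate_fieldSum_le (d : ℕ) {β : ℝ} (hβ : 0 ≤ β) (j N : ℕ) :
    ∃ C : ℝ, 0 ≤ C ∧ ∀ (f : HL2 d) (Φ : FiniteFock d), ‖f‖ ≤ β → (∀ n, N ≤ n → Φ.val n = 0) →
      ‖(fieldSum f)^[j] Φ‖ ≤ C * ‖Φ‖ := by
  induction j generalizing N with
  | zero => exact ⟨1, zero_le_one, fun f Φ _ _ => by simp⟩
  | succ j ih =>
    -- One application of the field raises the particle number by at most one.
    obtain ⟨C, hC, h⟩ := ih (N + 1)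
    refine ⟨C * (β * (2 * Real.sqrt N + 1)), by positivity, fun f Φ hf hΦ => ?_⟩
    rw [Function.iterate_succ_apply, mul_assoc]
    refine (h f _ hf (fieldSum_support f hΦ)).trans (mul_le_mul_of_nonneg_left ?_ hC)
    exact (norm_fieldSum_le f hΦ).trans (by gcongr)

/-- The matrix elements of the closed interaction against finite-particle vectors. -/
theorem inner_closure_interaction {d : ℕ} (m : ℝ) (χb : Rd d → ℂ) {χI : Rd d → ℝ}
    (hI : Integrable χI volume) {β : ℝ} (hβ : ∀ x, ‖toL2 (rho m χb x)‖ ≤ β) (Φ : FiniteFock d)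
    (Ψ : (interaction m χb χI).closure.domain) :
    Integrable (fun x => (χI x : ℂ) * inner ℂ (((1 / 4 : ℝ) : ℂ) •
      (fieldSum (toL2 (rho m χb x)))^[4] Φ).val (Ψ : Fock d)) ∧
      inner ℂ Φ.val ((interaction m χb χI).closure Ψ) =
        ∫ x, (χI x : ℂ) * inner ℂ (((1 / 4 : ℝ) : ℂ) •
          (fieldSum (toL2 (rho m χb x)))^[4] Φ).val (Ψ : Fock d) := by
  have hβ0 : 0 ≤ β := (norm_nonneg _).trans (hβ 0)
  obtain ⟨N, hN⟩ := Φ.isFin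
  obtain ⟨C, hC, h⟩ := exists_norm_iterate_fieldSum_le d hβ0 4 N
  refine integrable_inner_closure_opIntegral hI (C := 1 / 4 * (C * ‖Φ‖)) (fun x => ?_)
    (fun x Ψ => ?_) Ψ
  · rw [FiniteVec.norm_val, norm_smul, Complex.norm_real, Real.norm_of_nonneg (by norm_num)]
    exact mul_le_mul_of_nonneg_left (h _ Φ (hβ x) hN) (by norm_num)
  · have := inner_opPow4_segalField (toL2 (rho m χb x)) Φ Ψ
    rw [finiteField_pow_four] at this
    exact this

/-! ### Bounds for the one-particle vectors `ρₓ` -/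

theorem lintegral_enorm_sq_eq_eLpNorm_sq {X : Type*} [MeasurableSpace X] {μ : Measure X} (φ : X → ℂ) :
    ∫⁻ x, ‖φ x‖ₑ ^ 2 ∂μ = eLpNorm φ 2 μ ^ 2 := by
  rw [eLpNorm_eq_lintegral_rpow_enorm_toReal (by norm_num) (by norm_num)]
  simp only [ENNReal.toReal_ofNat, ENNReal.rpow_ofNat, one_div]
  rw [← ENNReal.rpow_ofNat, ← ENNReal.rpow_mul]
  norm_num

theorem norm_rho {d : ℕ} (m : ℝ) (χb : Rd d → ℂ) (x k : Rd d) :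
    ‖rho m χb x k‖ = ‖χb k / (Real.sqrt (omega d m k) : ℂ) ^ 1‖ := by
  have h : ‖Complex.exp (-Complex.I * (inner ℝ k x : ℝ))‖ = 1 := by
    rw [Complex.norm_exp]
    simp
  rw [rho, norm_mul, h, mul_one, pow_one]

theorem memLp_rho {d : ℕ} {m : ℝ} {χb : Rd d → ℂ}
    (hb : MemLp (fun k => χb k / (Real.sqrt (omega d m k) : ℂ) ^ 1) 2 volume) (x : Rd d) :
    MemLp (rho m χb x) 2 volume := by
  refine hb.of_le ?_ (Filter.Eventually.of_forall fun k => (norm_rho m χb x k).le)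
  have h := hb.1
  simp only [pow_one] at h
  exact h.mul (by fun_prop : Continuous fun k : Rd d =>
    Complex.exp (-Complex.I * (inner ℝ k x : ℝ))).aestronglyMeasurable

theorem toL2_rho_coeFn {d : ℕ} {m : ℝ} {χb : Rd d → ℂ}
    (hb : MemLp (fun k => χb k / (Real.sqrt (omega d m k) : ℂ) ^ 1) 2 volume) (x : Rd d) :
    toL2 (rho m χb x) =ᵐ[volume] rho m χb x := by
  rw [toL2, dif_pos (memLp_rho hb x)]
  exact MemLp.coeFn_toLp _

theorem norm_toL2_rho {d : ℕ} {m : ℝ} {χb : Rd d → ℂ}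
    (hb : MemLp (fun k => χb k / (Real.sqrt (omega d m k) : ℂ) ^ 1) 2 volume) (x : Rd d) :
    ‖toL2 (rho m χb x)‖ = cutoffNorm m χb 1 := by
  rw [toL2, dif_pos (memLp_rho hb x), Lp.norm_toLp, cutoffNorm]
  congr 1
  exact eLpNorm_congr_norm_ae (Filter.Eventually.of_forall (norm_rho m χb x))

theorem ofReal_cutoffNorm {d : ℕ} {m : ℝ} {χb : Rd d → ℂ} {l : ℕ}
    (hb : MemLp (fun k => χb k / (Real.sqrt (omega d m k) : ℂ) ^ l) 2 volume) :
    ENNReal.ofReal (cutoffNorm m χb l) ^ 2 =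
      ∫⁻ k, ‖χb k / (Real.sqrt (omega d m k) : ℂ) ^ l‖ₑ ^ 2 := by
  rw [lintegral_enorm_sq_eq_eLpNorm_sq, cutoffNorm, ENNReal.ofReal_toReal hb.2.ne]

theorem heatDiff_coeFn {d : ℕ} (m : ℝ) (t : ℝ≥0) (f : HL2 d) :
    heatDiff m t f =ᵐ[volume] fun k => ((1 - heatFactor₁ d m t k : ℝ) : ℂ) * f k := by
  filter_upwards [Lp.coeFn_sub f (heat₁ d m t f), heat₁_coeFn m t f] with k h1 h2
  rw [heatDiff, h1, Pi.sub_apply, h2]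
  push_cast
  ring

theorem one_sub_heatFactor₁_nonneg {d : ℕ} (m : ℝ) (t : ℝ≥0) (k : Rd d) :
    0 ≤ 1 - heatFactor₁ d m t k :=
  sub_nonneg.2 ((le_abs_self _).trans (abs_heatFactor₁_le k))

theorem one_sub_heatFactor₁_le {d : ℕ} (m : ℝ) (t : ℝ≥0) (k : Rd d) :
    1 - heatFactor₁ d m t k ≤ t * omega d m k := by
  have := Real.add_one_le_exp (-((t : ℝ) * omega d m k))
  rw [heatFactor₁]
  linarith

/-- Where `ω` vanishes, the quotients by positive powers of `√ω` are zero by convention; hence the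
second relation is only an inequality. -/
theorem norm_div_sqrt_pow_mul {d : ℕ} (m : ℝ) (χb : Rd d → ℂ) (k : Rd d) :
    ‖χb k / (Real.sqrt (omega d m k) : ℂ) ^ 1‖ =
      ‖χb k / (Real.sqrt (omega d m k) : ℂ) ^ 2‖ * Real.sqrt (omega d m k) ∧
    ‖χb k / (Real.sqrt (omega d m k) : ℂ) ^ 1‖ * Real.sqrt (omega d m k) ≤
      ‖χb k / (Real.sqrt (omega d m k) : ℂ) ^ 0‖ := by
  have h0 := Real.sqrt_nonneg (omega d m k)
  generalize Real.sqrt (omega d m k) = r at h0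
  rcases h0.eq_or_lt with rfl | h
  · simp
  · rw [norm_div, norm_div, norm_div, norm_pow, norm_pow, norm_pow, Complex.norm_real,
      Real.norm_of_nonneg h0]
    constructor
    · field_simp
    · rw [pow_one, pow_zero, div_one, div_mul_cancel₀ _ h.ne']

/-- In modulus `ρₓ = √ω · χ_b/ω`. -/
theorem weightBound_rho {d : ℕ} {m : ℝ} {χb : Rd d → ℂ}
    (hb : ∀ l : ℕ, l ≤ 2 → MemLp (fun k => χb k / (Real.sqrt (omega d m k) : ℂ) ^ l) 2 volume)
    (x : Rd d) : WeightBound (sqrtOmega d m) (toL2 (rho m χb x)) (cutoffNorm m χb 2) := by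
  refine ⟨fun k => ‖χb k / (Real.sqrt (omega d m k) : ℂ) ^ 2‖ₑ, (hb 2 le_rfl).1.enorm, ?_,
    (ofReal_cutoffNorm (hb 2 le_rfl)).ge⟩
  filter_upwards [toL2_rho_coeFn (hb 1 one_le_two) x] with k hk
  rw [hk, ← ofReal_norm, norm_rho, (norm_div_sqrt_pow_mul m χb k).1,
    ENNReal.ofReal_mul (norm_nonneg _), ofReal_norm, sqrtOmega]

theorem norm_heatDiff_rho_le {d : ℕ} {m : ℝ} {χb : Rd d → ℂ}
    (hb : MemLp (fun k => χb k / (Real.sqrt (omega d m k) : ℂ) ^ 1) 2 volume) (t : ℝ≥0)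
    (x : Rd d) : ∀ᵐ k, ‖heatDiff m t (toL2 (rho m χb x)) k‖ ≤
      t * ‖χb k / (Real.sqrt (omega d m k) : ℂ) ^ 0‖ * Real.sqrt (omega d m k) := by
  filter_upwards [toL2_rho_coeFn hb x, heatDiff_coeFn m t (toL2 (rho m χb x))] with k h1 h2
  rw [h2, h1, norm_mul, Complex.norm_real, Real.norm_of_nonneg (one_sub_heatFactor₁_nonneg m t k),
    norm_rho]
  refine (mul_le_mul_of_nonneg_right (one_sub_heatFactor₁_le m t k) (norm_nonneg _)).trans ?_
  have h3 := (norm_div_sqrt_pow_mul m χb k).2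
  have h4 := Real.mul_self_sqrt (omega_nonneg d m k)
  calc (t : ℝ) * omega d m k * ‖χb k / (Real.sqrt (omega d m k) : ℂ) ^ 1‖
      = t * (‖χb k / (Real.sqrt (omega d m k) : ℂ) ^ 1‖ * Real.sqrt (omega d m k)) *
          Real.sqrt (omega d m k) := by
        rw [← h4, Real.sqrt_mul_self (Real.sqrt_nonneg _)]
        ring
    _ ≤ _ := by gcongr

/-- From `1 - exp(-t ω) ≤ t ω` one gets `|f - exp(-t ω) f| ≤ t |χ_b| √ω`, so the quotient by `√ω`
has norm at most `t ‖χ_b‖`. -/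
theorem weightBound_heatDiff_rho {d : ℕ} {m : ℝ} {χb : Rd d → ℂ}
    (hb : ∀ l : ℕ, l ≤ 2 → MemLp (fun k => χb k / (Real.sqrt (omega d m k) : ℂ) ^ l) 2 volume)
    (t : ℝ≥0) (x : Rd d) :
    WeightBound (sqrtOmega d m) (heatDiff m t (toL2 (rho m χb x))) (t * cutoffNorm m χb 0) := by
  refine ⟨fun k => ENNReal.ofReal t * ‖χb k / (Real.sqrt (omega d m k) : ℂ) ^ 0‖ₑ,
    (hb 0 (by norm_num)).1.enorm.const_mul _, ?_, ?_⟩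
  · filter_upwards [norm_heatDiff_rho_le (hb 1 one_le_two) t x] with k hk
    rw [← ofReal_norm, ← ofReal_norm, sqrtOmega, ← ENNReal.ofReal_mul t.coe_nonneg,
      ← ENNReal.ofReal_mul (by positivity)]
    exact ENNReal.ofReal_le_ofReal hk
  · simp only [mul_pow]
    rw [lintegral_const_mul' _ _ (by finiteness), ← ofReal_cutoffNorm (hb 0 (by norm_num)),
      ENNReal.ofReal_mul t.coe_nonneg, mul_pow]

theorem re_inner_heatDiff_rho_le {d : ℕ} {m : ℝ} {χb : Rd d → ℂ}
    (hb : ∀ l : ℕ, l ≤ 2 → MemLp (fun k => χb k / (Real.sqrt (omega d m k) : ℂ) ^ l) 2 volume)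
    (t : ℝ≥0) (x : Rd d) :
    (inner ℂ (heatDiff m t (toL2 (rho m χb x))) (toL2 (rho m χb x)) : ℂ).re ≤
      t * cutoffNorm m χb 0 ^ 2 := by
  refine (Complex.re_le_norm _).trans ?_
  have h0 : 0 ≤ cutoffNorm m χb 0 := ENNReal.toReal_nonneg
  rw [← ENNReal.ofReal_le_ofReal_iff (by positivity), ofReal_norm, L2.inner_def,
    ENNReal.ofReal_mul t.coe_nonneg, ENNReal.ofReal_pow h0, ofReal_cutoffNorm (hb 0 (by norm_num)),
    ← lintegral_const_mul' _ _ ENNReal.ofReal_ne_top]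
  refine (enorm_integral_le_lintegral_enorm _).trans (lintegral_mono_ae ?_)
  filter_upwards [norm_heatDiff_rho_le (hb 1 one_le_two) t x,
    toL2_rho_coeFn (hb 1 one_le_two) x] with k h1 h2
  rw [← ofReal_norm, ← ofReal_norm, ← ENNReal.ofReal_pow (norm_nonneg _), ← ENNReal.ofReal_mul t.coe_nonneg]
  refine ENNReal.ofReal_le_ofReal ((norm_inner_le_norm _ _).trans ?_)
  rw [h2, norm_rho]
  have h3 := (norm_div_sqrt_pow_mul m χb k).2
  calc _ ≤ t * ‖χb k / (Real.sqrt (omega d m k) : ℂ) ^ 0‖ * Real.sqrt (omega d m k) *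
        ‖χb k / (Real.sqrt (omega d m k) : ℂ) ^ 1‖ := mul_le_mul_of_nonneg_right h1 (norm_nonneg _)
    _ = t * ‖χb k / (Real.sqrt (omega d m k) : ℂ) ^ 0‖ *
        (‖χb k / (Real.sqrt (omega d m k) : ℂ) ^ 1‖ * Real.sqrt (omega d m k)) := by ring
    _ ≤ t * ‖χb k / (Real.sqrt (omega d m k) : ℂ) ^ 0‖ *
        ‖χb k / (Real.sqrt (omega d m k) : ℂ) ^ 0‖ := by gcongr
    _ = _ := by ring

/-- The phase carrying `x` drops out, so the limit `t → 0` is uniform in `x`. -/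
theorem norm_heatDiff_rho_eq {d : ℕ} {m : ℝ} {χb : Rd d → ℂ}
    (hb : MemLp (fun k => χb k / (Real.sqrt (omega d m k) : ℂ) ^ 1) 2 volume) (t : ℝ≥0)
    (x : Rd d) :
    ‖heatDiff m t (toL2 (rho m χb x))‖ = ‖heatDiff m t (toL2 (rho m χb 0))‖ := by
  have h : ∀ᵐ k, ‖heatDiff m t (toL2 (rho m χb x)) k‖ =
      ‖heatDiff m t (toL2 (rho m χb 0)) k‖ := by
    filter_upwards [toL2_rho_coeFn hb x, heatDiff_coeFn m t (toL2 (rho m χb x)),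
      toL2_rho_coeFn hb 0, heatDiff_coeFn m t (toL2 (rho m χb 0))] with k h1 h2 h3 h4
    rw [h2, h4, h1, h3, norm_mul, norm_mul, norm_rho, norm_rho]
  exact le_antisymm (Lp.norm_le_norm_of_ae_le (h.mono fun _ hk => hk.le))
    (Lp.norm_le_norm_of_ae_le (h.mono fun _ hk => hk.ge))

/-! ### The limit of small times -/

/-- The sequence `1 / (j + 1)` of times. -/
def time (j : ℕ) : ℝ≥0 := 1 / (j + 1)

theorem coe_time (j : ℕ) : (time j : ℝ) = 1 / ((j : ℝ) + 1) := by
  simp [time]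

theorem time_pos (j : ℕ) : 0 < time j := by
  unfold time
  positivity

theorem tendsto_time : Filter.Tendsto (fun j => (time j : ℝ)) Filter.atTop (nhds 0) := by
  simp only [coe_time]
  exact tendsto_one_div_add_atTop_nhds_zero_nat

/-- The function `(1 - exp(-t ω))² / t` is at most `ω`, which gives the dominating function
`|χ_b|²`, and at most `t ω²`, which gives pointwise convergence to zero. The bound by `ω` alone
would only show `‖f - exp(-t ω) f‖² = O(t)`, whereas `o(t)` is required. -/
theorem tendsto_norm_heatDiff_rho_sq_div {d : ℕ} {m : ℝ} {χb : Rd d → ℂ}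
    (hb : ∀ l : ℕ, l ≤ 2 → MemLp (fun k => χb k / (Real.sqrt (omega d m k) : ℂ) ^ l) 2 volume) :
    Filter.Tendsto (fun j => ‖heatDiff m (time j) (toL2 (rho m χb 0))‖ ^ 2 / (time j : ℝ))
      Filter.atTop (nhds 0) := by
  set f := toL2 (rho m χb 0) with hf
  have h1 : ∀ j, ENNReal.ofReal (‖heatDiff m (time j) f‖ ^ 2 / (time j : ℝ)) =
      ∫⁻ k, ENNReal.ofReal ((1 - heatFactor₁ d m (time j) k) ^ 2 / (time j : ℝ)) * ‖f k‖ₑ ^ 2 := by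
    intro j
    have hj : (0 : ℝ) < time j := time_pos j
    rw [div_eq_inv_mul, ENNReal.ofReal_mul (by positivity), ENNReal.ofReal_pow (norm_nonneg _),
      ofReal_norm, enorm_sq_eq_lintegral, ← lintegral_const_mul' _ _ ENNReal.ofReal_ne_top]
    refine lintegral_congr_ae ?_
    filter_upwards [heatDiff_coeFn m (time j) f] with k hk
    rw [hk, enorm_mul, mul_pow, ← mul_assoc]
    congr 1
    rw [← ofReal_norm, Complex.norm_real,
      Real.norm_of_nonneg (one_sub_heatFactor₁_nonneg m (time j) k),
      ← ENNReal.ofReal_pow (one_sub_heatFactor₁_nonneg m (time j) k),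
      ← ENNReal.ofReal_mul (by positivity), inv_mul_eq_div]
  have h2 : Filter.Tendsto (fun j => ∫⁻ k,
      ENNReal.ofReal ((1 - heatFactor₁ d m (time j) k) ^ 2 / (time j : ℝ)) * ‖f k‖ₑ ^ 2)
      Filter.atTop (nhds (∫⁻ _ : Rd d, 0)) := by
    refine tendsto_lintegral_of_dominated_convergence'
      (fun k => ‖χb k / (Real.sqrt (omega d m k) : ℂ) ^ 0‖ₑ ^ 2) (fun j => ?_) (fun j => ?_) ?_ ?_
    · refine AEMeasurable.mul ?_ ((Lp.aestronglyMeasurable f).enorm.pow_const 2)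
      have := measurable_heatFactor₁ d m (time j)
      exact (by fun_prop : Measurable fun k => ENNReal.ofReal
        ((1 - heatFactor₁ d m (time j) k) ^ 2 / (time j : ℝ))).aemeasurable
    · filter_upwards [toL2_rho_coeFn (hb 1 one_le_two) 0] with k hk
      have hj : (0 : ℝ) < time j := time_pos j
      have e0 := one_sub_heatFactor₁_nonneg m (time j) k
      have e1 := one_sub_heatFactor₁_le m (time j) k
      have e2 : 1 - heatFactor₁ d m (time j) k ≤ 1 := by
        have : 0 ≤ heatFactor₁ d m (time j) k := (Real.exp_pos _).le
        linarith
      have e3 : (1 - heatFactor₁ d m (time j) k) ^ 2 / (time j : ℝ) ≤ omega d m k := by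
        rw [div_le_iff₀ hj]
        nlinarith
      rw [hf, hk, ← ofReal_norm, ← ofReal_norm, norm_rho, ← ENNReal.ofReal_pow (norm_nonneg _),
        ← ENNReal.ofReal_pow (norm_nonneg _), ← ENNReal.ofReal_mul (by positivity)]
      refine ENNReal.ofReal_le_ofReal ((mul_le_mul_of_nonneg_right e3 (by positivity)).trans ?_)
      have h3 := (norm_div_sqrt_pow_mul m χb k).2
      calc omega d m k * ‖χb k / (Real.sqrt (omega d m k) : ℂ) ^ 1‖ ^ 2
          = (‖χb k / (Real.sqrt (omega d m k) : ℂ) ^ 1‖ * Real.sqrt (omega d m k)) ^ 2 := by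
            rw [mul_pow, Real.sq_sqrt (omega_nonneg d m k), mul_comm]
        _ ≤ _ := by gcongr
    · rw [← ofReal_cutoffNorm (hb 0 (by norm_num))]
      finiteness
    · refine Filter.Eventually.of_forall fun k => ?_
      have l1 : Filter.Tendsto (fun j => (time j : ℝ) * omega d m k ^ 2) Filter.atTop (nhds 0) := by
        have := tendsto_time.mul_const (omega d m k ^ 2)
        rwa [zero_mul] at this
      have l2 : Filter.Tendsto (fun j => (1 - heatFactor₁ d m (time j) k) ^ 2 / (time j : ℝ))
          Filter.atTop (nhds 0) := by
        refine squeeze_zero (fun j => ?_) (fun j => ?_) l1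
        · positivity
        · have hj : (0 : ℝ) < time j := time_pos j
          have e0 := one_sub_heatFactor₁_nonneg m (time j) k
          have e1 := one_sub_heatFactor₁_le m (time j) k
          rw [div_le_iff₀ hj]
          nlinarith
      have l3 := ENNReal.tendsto_ofReal l2
      rw [ENNReal.ofReal_zero] at l3
      have l4 := ENNReal.Tendsto.mul_const (b := ‖f k‖ₑ ^ 2) l3 (Or.inr (by finiteness))
      rwa [zero_mul] at l4
  simp only [← h1, lintegral_zero] at h2
  have h3 := (ENNReal.tendsto_toReal ENNReal.zero_ne_top).comp h2
  refine h3.congr fun j => ?_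
  exact ENNReal.toReal_ofReal (by positivity)

/-! ### The double commutator inequality for the field operators -/

/-- The error term in the double commutator inequality. -/
def commutatorError (α β γ h H p t κ η ζ : ℝ) : ℝ :=
  (4 * (α * (α * H)) + 4 * (β * (α * h)) + 3 * (β ^ 2 * p)) *
      (2 * (t * γ ^ 2 * H) + 2 * ((κ + η) * (γ * h)) + 2 * (η * (γ * h)) + 2 * (ζ * p)) +
    2 * ((2 * (α * γ * H) + β * (γ * h) + γ ^ 2 * p) * ((κ + η) * (2 * (α * h) + β * p)))

theorem tendsto_commutatorError (α β γ h H p : ℝ) {t κ η ζ : ℕ → ℝ}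
    (ht : Filter.Tendsto t Filter.atTop (nhds 0)) (hκ : Filter.Tendsto κ Filter.atTop (nhds 0))
    (hη : Filter.Tendsto η Filter.atTop (nhds 0)) (hζ : Filter.Tendsto ζ Filter.atTop (nhds 0)) :
    Filter.Tendsto (fun j => commutatorError α β γ h H p (t j) (κ j) (η j) (ζ j)) Filter.atTop
      (nhds 0) := by
  have hc : Continuous fun q : (ℝ × ℝ) × (ℝ × ℝ) =>
      commutatorError α β γ h H p q.1.1 q.1.2 q.2.1 q.2.2 := by
    unfold commutatorError
    fun_prop
  have h0 : commutatorError α β γ h H p 0 0 0 0 = 0 := by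
    unfold commutatorError
    ring
  have := (hc.tendsto ((0, 0), (0, 0))).comp ((ht.prodMk_nhds hκ).prodMk_nhds (hη.prodMk_nhds hζ))
  simp only [h0] at this
  exact this

/-- The constant in the bound of `(a(f) + a†(f))²` by the free energy. -/
def fieldConst (α β h H p : ℝ) : ℝ := 4 * (α * (α * H)) + 4 * (β * (α * h)) + 3 * (β ^ 2 * p)

theorem norm_fieldSum_fieldSum_le {d : ℕ} {m : ℝ} {f : HL2 d} {α h H p : ℝ}
    (hα : 0 ≤ α) (hh : 0 ≤ h) (hH : 0 ≤ H)
    (hf : WeightBound (sqrtOmega d m) f α) {Φ : FiniteFock d}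
    (h1 : energy (fun y => sqrtOmega d m y ^ 2) (fun x => x) Φ.val ≤ ENNReal.ofReal h ^ 2)
    (h2 : energy (fun y => sqrtOmega d m y ^ 2) (fun x => x * x) Φ.val ≤ ENNReal.ofReal H ^ 2)
    (hp : ‖Φ‖ ≤ p) : ‖fieldSum f (fieldSum f Φ)‖ ≤ fieldConst α ‖f‖ h H p := by
  have hs := measurable_sqrtOmega d m
  refine ((heatRelations m 0 f).norm_s_s_le (norm_ann_le hs hα hh hf h1)
    (norm_ann_ann_le hs hα hα hH hf hf h2)).trans ?_
  unfold fieldConst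
  gcongr

/-- The abstract inequality with `u₁ = α h`, `u₂ = α² H`, `v₁ = t γ h`, `v₂ = t² γ² H`, `w = α t γ
H` and `κ = t γ √(1/t)`. The term with `c₀ ≤ t γ²` has order exactly `t` and is kept; all others
carry `t` times a factor that vanishes as `t → 0`. -/
theorem fieldSum_commutator_bound {d : ℕ} {m : ℝ} {f : HL2 d} {α γ h H p : ℝ}
    (hα : 0 ≤ α) (hγ : 0 ≤ γ) (hh : 0 ≤ h) (hH : 0 ≤ H) {t : ℝ≥0} (ht : 0 < t)
    (hf : WeightBound (sqrtOmega d m) f α)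
    (hg : WeightBound (sqrtOmega d m) (heatDiff m t f) (t * γ))
    (hc : (inner ℂ (heatDiff m t f) f : ℂ).re ≤ t * γ ^ 2) {Φ : FiniteFock d}
    (h1 : energy (fun y => sqrtOmega d m y ^ 2) (fun x => x) Φ.val ≤ ENNReal.ofReal h ^ 2)
    (h2 : energy (fun y => sqrtOmega d m y ^ 2) (fun x => x * x) Φ.val ≤ ENNReal.ofReal H ^ 2)
    (hp : ‖Φ‖ ≤ p) :
    -(t * (4 * γ ^ 2 * (4 * (α * h) ^ 2 + 2 * (‖f‖ ^ 2 * p ^ 2)))) -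
      t * commutatorError α ‖f‖ γ h H p t (t * γ * Real.sqrt (1 / t)) ‖heatDiff m t f‖
        (‖heatDiff m t f‖ ^ 2 / t) ≤
    (inner ℂ (fieldSum f (fieldSum f Φ)) (fieldSum f (fieldSum f (Φ - heat d m t Φ))) : ℂ).re := by
  have hs := measurable_sqrtOmega d m
  have R := heatRelations m t f
  have htγ : 0 ≤ t * γ := mul_nonneg t.coe_nonneg hγ
  have E1 := (energy_heat_le m t (fun y => sqrtOmega d m y ^ 2) (fun x => x) Φ).trans h1
  have E2 := (energy_heat_le m t (fun y => sqrtOmega d m y ^ 2) (fun x => x * x) Φ).trans h2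
  have hκ : ∀ y, ‖ann (heatDiff m t f) (heat d m t y)‖ ≤ t * γ * Real.sqrt (1 / t) * ‖y‖ := by
    intro y
    rw [mul_assoc]
    exact norm_ann_le hs htγ (by positivity) hg (energy_heat_smoothing m ht y)
  have key := R.sub_re_inner_ge (norm_ann_le hs hα hh hf h1) (norm_ann_ann_le hs hα hα hH hf hf h2)
    (norm_ann_le hs htγ hh hg h1) (norm_ann_ann_le hs htγ htγ hH hg hg h2)
    (norm_ann_ann_le hs hα htγ hH hf hg h2) (norm_ann_le hs hα hh hf E1)
    (norm_ann_le hs htγ hh hg E1) (norm_ann_ann_le hs htγ htγ hH hg hg E2) (by positivity) hκ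
  have e0 : (inner ℂ (fieldSum f (fieldSum f Φ)) (fieldSum f (fieldSum f (Φ - heat d m t Φ))) : ℂ).re
      = ‖fieldSum f (fieldSum f Φ)‖ ^ 2 -
        (inner ℂ (fieldSum f (fieldSum f Φ)) (fieldSum f (fieldSum f (heat d m t Φ))) : ℂ).re := by
    rw [map_sub, map_sub, inner_sub_right, Complex.sub_re, inner_self_eq_norm_sq_to_K]
    norm_cast
  rw [e0]
  refine le_trans ?_ key
  have hc0 := R.c₀_nonneg
  have ht' : (0 : ℝ) < t := ht
  have hΦ := norm_nonneg Φ
  set c₀ := (inner ℂ (heatDiff m t f) f : ℂ).re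
  set η := ‖heatDiff m t f‖
  set κ := (t : ℝ) * γ * Real.sqrt (1 / t)
  have hη : 0 ≤ η := norm_nonneg _
  have hκ0 : 0 ≤ κ := by positivity
  have hp0 : 0 ≤ p := hΦ.trans hp
  have b1 : 4 * c₀ * (4 * (α * h) ^ 2 + 2 * (‖f‖ ^ 2 * ‖Φ‖ ^ 2)) ≤
      4 * (t * γ ^ 2) * (4 * (α * h) ^ 2 + 2 * (‖f‖ ^ 2 * p ^ 2)) := by gcongr
  have b2 : (4 * (α * (α * H)) + 4 * (‖f‖ * (α * h)) + 3 * (‖f‖ ^ 2 * ‖Φ‖)) *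
      (2 * (t * γ * (t * γ * H)) + 2 * ((κ + η) * (t * γ * h)) + 2 * (η * (t * γ * h)) +
        2 * (η ^ 2 * ‖Φ‖)) ≤
      (4 * (α * (α * H)) + 4 * (‖f‖ * (α * h)) + 3 * (‖f‖ ^ 2 * p)) *
      (2 * (t * γ * (t * γ * H)) + 2 * ((κ + η) * (t * γ * h)) + 2 * (η * (t * γ * h)) +
        2 * (η ^ 2 * p)) := by gcongr
  have b3 : (2 * (α * (t * γ * H)) + ‖f‖ * (t * γ * h) + c₀ * ‖Φ‖) *
      ((κ + η) * (2 * (α * h) + ‖f‖ * ‖Φ‖)) ≤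
      (2 * (α * (t * γ * H)) + ‖f‖ * (t * γ * h) + t * γ ^ 2 * p) *
      ((κ + η) * (2 * (α * h) + ‖f‖ * p)) := by gcongr
  have b4 : (t : ℝ) * commutatorError α ‖f‖ γ h H p t κ η (η ^ 2 / t) =
      (4 * (α * (α * H)) + 4 * (‖f‖ * (α * h)) + 3 * (‖f‖ ^ 2 * p)) *
      (2 * (t * γ * (t * γ * H)) + 2 * ((κ + η) * (t * γ * h)) + 2 * (η * (t * γ * h)) +
        2 * (η ^ 2 * p)) +
      2 * ((2 * (α * (t * γ * H)) + ‖f‖ * (t * γ * h) + t * γ ^ 2 * p) *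
      ((κ + η) * (2 * (α * h) + ‖f‖ * p))) := by
    unfold commutatorError
    -- A factor `t` is extracted also from the only error term in which it is not explicit.
    have e : η ^ 2 = t * (η ^ 2 / t) := by field_simp
    conv_rhs => rw [e]
    ring
  rw [b4]
  linarith

/-! ### Truncation to finitely many particles -/

theorem tsum_trunc_sub_le {G : ℕ → Type*} [∀ n, NormedAddCommGroup (G n)]
    [∀ n, InnerProductSpace ℂ (G n)] (F F' : ∀ n, G n → ℝ≥0∞) (h0 : ∀ n, F n 0 = 0)
    (h : ∀ n u, F n u ≤ F' n u) {N M : ℕ} (hNM : N ≤ M) (Ψ : lp G 2) :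
    ∑' n, F n ((trunc M Ψ - trunc N Ψ).val n) ≤ ∑' k, F' (k + N) (Ψ (k + N)) := by
  have h1 : ∀ n, (trunc M Ψ - trunc N Ψ).val n =
      if n < M then (if n < N then 0 else Ψ n) else 0 := by
    intro n
    rw [FiniteVec.sub_apply, trunc_apply, trunc_apply]
    split_ifs
    · exact sub_self _
    · exact sub_zero _
    · omega
    · exact sub_zero _
  rw [← (ENNReal.summable (f := fun n => F (n + N)
    ((trunc M Ψ - trunc N Ψ).val (n + N)))).sum_add_tsum_nat_add'
    (f := fun n => F n ((trunc M Ψ - trunc N Ψ).val n)), Finset.sum_eq_zero, zero_add]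
  · refine ENNReal.tsum_le_tsum fun k => ?_
    rw [h1]
    split_ifs
    · rw [h0]
      exact zero_le
    · exact h _ _
    · rw [h0]
      exact zero_le
  · intro n hn
    have hn' := Finset.mem_range.1 hn
    rw [h1, if_pos (hn'.trans_le hNM), if_pos hn', h0]

theorem sectorEnergy_zero {d n : ℕ} (θ : Rd d → ℝ≥0∞) (w : ℝ≥0∞ → ℝ≥0∞) :
    sectorEnergy θ w ((0 : symL2 d n) : L2n d n) = 0 := by
  rw [sectorEnergy]
  refine (lintegral_congr_ae ?_).trans lintegral_zero
  filter_upwards [Lp.coeFn_zero ℂ 2 (volume : Measure (Fin n → Rd d))] with k hk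
  have h : ((0 : symL2 d n) : L2n d n) k = 0 := hk
  rw [h]
  simp

theorem energy_trunc_le {d : ℕ} (θ : Rd d → ℝ≥0∞) (w : ℝ≥0∞ → ℝ≥0∞) (N : ℕ) (Ψ : Fock d) :
    energy θ w (trunc N Ψ).val ≤ energy θ w Ψ := by
  refine ENNReal.tsum_le_tsum fun n => ?_
  rw [trunc_apply]
  split_ifs
  · exact le_rfl
  · rw [sectorEnergy_zero]
    exact zero_le

theorem sectorEnergy_mono {d n : ℕ} (θ : Rd d → ℝ≥0∞) {w w' : ℝ≥0∞ → ℝ≥0∞} (h : ∀ x, w x ≤ w' x)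
    (u : L2n d n) : sectorEnergy θ w u ≤ sectorEnergy θ w' u :=
  lintegral_mono fun _ => mul_le_mul_left (h _) _

theorem energy_trunc_sub_le {d : ℕ} (θ : Rd d → ℝ≥0∞) {w w' : ℝ≥0∞ → ℝ≥0∞} (h : ∀ x, w x ≤ w' x)
    {N M : ℕ} (hNM : N ≤ M) (Ψ : Fock d) :
    energy θ w (trunc M Ψ - trunc N Ψ).val ≤ ∑' k, sectorEnergy θ w' (Ψ (k + N) : L2n d (k + N)) := by
  exact tsum_trunc_sub_le (G := fun n => symL2 d n) (fun n u => sectorEnergy θ w (u : L2n d n))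
    (fun n u => sectorEnergy θ w' (u : L2n d n)) (fun n => sectorEnergy_zero θ w)
    (fun n u => sectorEnergy_mono θ h _) hNM Ψ

/-- The lower bound for the matrix elements of the fourth power of the field. -/
theorem re_inner_fieldSum_pow_four_ge {d : ℕ} {m : ℝ} {f : HL2 d} {α γ h H p r : ℝ}
    (hα : 0 ≤ α) (hγ : 0 ≤ γ) (hh : 0 ≤ h) (hH : 0 ≤ H) (hr : 0 ≤ r) {t : ℝ≥0} (ht : 0 < t)
    (hf : WeightBound (sqrtOmega d m) f α)
    (hg : WeightBound (sqrtOmega d m) (heatDiff m t f) (t * γ))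
    (hc : (inner ℂ (heatDiff m t f) f : ℂ).re ≤ t * γ ^ 2) {Ψ : Fock d}
    (h1 : energy (fun y => sqrtOmega d m y ^ 2) (fun x => x) Ψ ≤ ENNReal.ofReal h ^ 2)
    (h2 : energy (fun y => sqrtOmega d m y ^ 2) (fun x => x * x) Ψ ≤ ENNReal.ofReal H ^ 2)
    (hp : ‖Ψ‖ ≤ p) (N : ℕ)
    (hN : ∑' k, sectorEnergy (fun y => sqrtOmega d m y ^ 2) (fun x => 1 + x + x * x)
      (Ψ (k + N) : L2n d (k + N)) ≤ ENNReal.ofReal r ^ 2) :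
    -(t * (4 * γ ^ 2 * (4 * (α * h) ^ 2 + 2 * (‖f‖ ^ 2 * p ^ 2)))) -
      t * commutatorError α ‖f‖ γ h H p t (t * γ * Real.sqrt (1 / t)) ‖heatDiff m t f‖
        (‖heatDiff m t f‖ ^ 2 / t) - 2 * fieldConst α ‖f‖ h H p * fieldConst α ‖f‖ r r r ≤
    (inner ℂ ((fieldSum f)^[4] (trunc N Ψ - heat d m t (trunc N Ψ))).val Ψ : ℂ).re := by
  have hsq : ∀ (w : ℝ≥0∞ → ℝ≥0∞) (M : ℕ) {c : ℝ≥0∞},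
      energy (fun y => sqrtOmega d m y ^ 2) w Ψ ≤ c →
      energy (fun y => sqrtOmega d m y ^ 2) w (trunc M Ψ).val ≤ c := fun w M _ hw =>
    (energy_trunc_le _ w M Ψ).trans hw
  have hpN : ‖trunc N Ψ‖ ≤ p := by
    have hp0 : 0 ≤ p := (norm_nonneg _).trans hp
    refine norm_le_of_enorm_sq_le hp0 ?_
    have e := energy_trunc_le (fun y => sqrtOmega d m y ^ 2) (fun _ => 1) N Ψ
    rw [energy_one, energy_one] at e
    refine e.trans ?_
    rw [← ofReal_norm]
    gcongr
  have R := heatRelations m t f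
  have main := fieldSum_commutator_bound hα hγ hh hH ht hf hg hc (hsq _ N h1) (hsq _ N h2) hpN
  set Φ := trunc N Ψ with hΦ
  obtain ⟨M, hM⟩ := exists_inner_eq_inner_trunc Ψ ((fieldSum f)^[4] (Φ - heat d m t Φ))
  -- `Ψ` is now replaced by a truncation at a level at least `N`, and `Δ` collects its components
  -- above `N`.
  have hM' := hM (max M N) (le_max_left _ _)
  set Δ := trunc (max M N) Ψ - trunc N Ψ with hΔ
  have hs : ∀ x y, inner ℂ (fieldSum f x) y = inner ℂ x (fieldSum f y) := R.inner_s
  have e1 : (inner ℂ ((fieldSum f)^[4] (Φ - heat d m t Φ)).val Ψ : ℂ).re =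
      (inner ℂ (fieldSum f (fieldSum f Φ)) (fieldSum f (fieldSum f (Φ - heat d m t Φ))) : ℂ).re +
      (inner ℂ (fieldSum f (fieldSum f Δ)) (fieldSum f (fieldSum f (Φ - heat d m t Φ))) : ℂ).re := by
    rw [← inner_conj_symm, Complex.conj_re, hM', ← Complex.add_re, ← inner_add_left]
    have e2 : fieldSum f (fieldSum f Φ) + fieldSum f (fieldSum f Δ) =
        fieldSum f (fieldSum f (trunc (max M N) Ψ)) := by
      rw [← map_add, ← map_add, hΔ, hΦ, add_sub_cancel]
    -- Two of the four fields are moved to the left, so that each side needs only second-order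
    -- energy bounds.
    rw [e2, hs, hs]
    rfl
  have n1 : ‖fieldSum f (fieldSum f (Φ - heat d m t Φ))‖ ≤ 2 * fieldConst α ‖f‖ h H p := by
    rw [map_sub, map_sub]
    have a1 := norm_fieldSum_fieldSum_le hα hh hH hf (hsq _ N h1) (hsq _ N h2) hpN
    have a2 := norm_fieldSum_fieldSum_le hα hh hH hf ((energy_heat_le m t _ _ Φ).trans (hsq _ N h1))
      ((energy_heat_le m t _ _ Φ).trans (hsq _ N h2)) ((norm_heat_le m t Φ).trans hpN)
    have a3 := norm_sub_le (fieldSum f (fieldSum f Φ)) (fieldSum f (fieldSum f (heat d m t Φ)))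
    linarith
  -- The single tail with weight `1 + x + x²` controls the weights `1`, `x` and `x²` at once.
  have hΔe : ∀ w : ℝ≥0∞ → ℝ≥0∞, (∀ x, w x ≤ 1 + x + x * x) →
      energy (fun y => sqrtOmega d m y ^ 2) w Δ.val ≤ ENNReal.ofReal r ^ 2 := fun w hw =>
    (energy_trunc_sub_le _ hw (le_max_right _ _) Ψ).trans hN
  have n2 : ‖fieldSum f (fieldSum f Δ)‖ ≤ fieldConst α ‖f‖ r r r := by
    refine norm_fieldSum_fieldSum_le hα hr hr hf (hΔe _ fun x => ?_) (hΔe _ fun x => ?_) ?_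
    · exact le_add_self.trans le_self_add
    · exact le_add_self
    · refine norm_le_of_enorm_sq_le hr ?_
      have e := hΔe (fun _ => 1) fun x => le_self_add.trans le_self_add
      rw [energy_one] at e
      exact e
  have n3 : -(2 * fieldConst α ‖f‖ h H p * fieldConst α ‖f‖ r r r) ≤
      (inner ℂ (fieldSum f (fieldSum f Δ)) (fieldSum f (fieldSum f (Φ - heat d m t Φ))) : ℂ).re := by
    refine neg_le_of_abs_le ((Complex.abs_re_le_norm _).trans ((norm_inner_le_norm _ _).trans ?_))
    rw [mul_comm]
    exact mul_le_mul n1 n2 (norm_nonneg _) ((norm_nonneg _).trans n1)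
  rw [e1]
  linarith

/-! ### Difference quotients on the truncated vectors -/

section Graded

variable {G : ℕ → Type*} [∀ n, NormedAddCommGroup (G n)] [∀ n, InnerProductSpace ℂ (G n)]

theorem inner_trunc_sub_diag (D : ∀ n, G n →ₗ[ℂ] G n) (N : ℕ) (Ψ Y : lp G 2) :
    inner ℂ (trunc N Ψ - diag D (trunc N Ψ)).val Y =
      ∑ n ∈ Finset.range N, inner ℂ (Ψ n - D n (Ψ n)) (Y n) := by
  rw [lp.inner_eq_tsum, tsum_eq_sum (s := Finset.range N)]
  · refine Finset.sum_congr rfl fun n hn => ?_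
    rw [FiniteVec.sub_apply, diag_apply, trunc_apply, if_pos (Finset.mem_range.1 hn)]
  · intro n hn
    rw [FiniteVec.sub_apply, diag_apply, trunc_apply, if_neg (by simpa using hn), map_zero, sub_zero,
      inner_zero_left]

/-- The order of limits matters: the truncation error `s N` is not proportional to `t j`, so `N → ∞`
is taken first, with `j` fixed. Only then is the inequality, already divided by `t j`, passed to the
limit in `j`, with `‖Θ n‖ ‖Y n‖` as a summable bound uniform in `j`. -/
theorem re_inner_ge_of_trunc {D : ℕ → ∀ n, G n →ₗ[ℂ] G n} {t e s : ℕ → ℝ} {C : ℝ}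
    {Ψ Θ Y : lp G 2} (ht : ∀ j, 0 < t j)
    (hb : ∀ j n, ‖Ψ n - D j n (Ψ n)‖ ≤ t j * ‖Θ n‖)
    (hl : ∀ n, Filter.Tendsto (fun j => (inner ℂ (Ψ n - D j n (Ψ n)) (Y n) : ℂ).re / t j)
      Filter.atTop (nhds (inner ℂ (Θ n) (Y n) : ℂ).re))
    (he : Filter.Tendsto e Filter.atTop (nhds 0)) (hs : Filter.Tendsto s Filter.atTop (nhds 0))
    (h : ∀ N j, -(t j * (C + e j)) - s N ≤
      (inner ℂ (trunc N Ψ - diag (D j) (trunc N Ψ)).val Y : ℂ).re) :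
    -C ≤ (inner ℂ Θ Y : ℂ).re := by
  set a : ℕ → ℕ → ℝ := fun j n => (inner ℂ (Ψ n - D j n (Ψ n)) (Y n) : ℂ).re / t j with ha
  have hS : Summable fun n => ‖Θ n‖ * ‖Y n‖ :=
    lp.summable_mul (p := 2) (q := 2) (by simpa using Real.HolderConjugate.two_two) Θ Y
  have hab : ∀ j n, ‖a j n‖ ≤ ‖Θ n‖ * ‖Y n‖ := fun j n => by
    rw [ha, norm_div, Real.norm_of_nonneg (ht j).le, div_le_iff₀ (ht j), Real.norm_eq_abs]
    refine (Complex.abs_re_le_norm _).trans ((norm_inner_le_norm _ _).trans ?_)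
    calc _ ≤ t j * ‖Θ n‖ * ‖Y n‖ := mul_le_mul_of_nonneg_right (hb j n) (norm_nonneg _)
      _ = _ := by ring
  have h1 : ∀ j, -(C + e j) ≤ ∑' n, a j n := fun j => by
    have hsum : Summable (a j) := Summable.of_norm_bounded hS (hab j)
    have h2 : Filter.Tendsto (fun N => -(C + e j) - s N / t j) Filter.atTop
        (nhds (-(C + e j) - 0 / t j)) := tendsto_const_nhds.sub (hs.div_const _)
    rw [zero_div, sub_zero] at h2
    refine le_of_tendsto_of_tendsto' h2 hsum.hasSum.tendsto_sum_nat fun N => ?_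
    have h3 := h N j
    rw [inner_trunc_sub_diag, Complex.re_sum] at h3
    rw [ha, ← Finset.sum_div, le_div_iff₀ (ht j)]
    refine le_trans (le_of_eq ?_) h3
    have := (ht j).ne'
    field_simp
  have h4 : Filter.Tendsto (fun j => ∑' n, a j n) Filter.atTop
      (nhds (∑' n, (inner ℂ (Θ n) (Y n) : ℂ).re)) :=
    tendsto_tsum_of_dominated_convergence hS hl (Filter.Eventually.of_forall fun j n => hab j n)
  rw [← Complex.re_tsum (lp.summable_inner (𝕜 := ℂ) Θ Y), ← lp.inner_eq_tsum] at h4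
  have h5 := (he.const_add C).neg
  rw [add_zero] at h5
  exact le_of_tendsto_of_tendsto' h5 h4 h1

end Graded

/-! ### The free Hamiltonian -/

theorem sumMulToFun_coeFn {d n : ℕ} (h : Rd d → ℝ) (u : sumMulDomain d h n) :
    ((sumMulToFun h u : symL2 d n) : L2n d n) =ᵐ[volume]
      fun k => ((∑ j, h (k j) : ℝ) : ℂ) * (u.1 : L2n d n) k :=
  MemLp.coeFn_toLp (memLp_of_mem_sumMulDomain u)

theorem coe_sub_sectorHeat {d n : ℕ} (m : ℝ) (t : ℝ≥0) (u : symL2 d n) :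
    ((u - sectorHeat d m t n u : symL2 d n) : L2n d n) =ᵐ[volume]
      fun k => ((1 - heatFactor d m t k : ℝ) : ℂ) * (u : L2n d n) k := by
  filter_upwards [Lp.coeFn_sub (u : L2n d n) (heatL2 d m t n (u : L2n d n)),
    heatL2_coeFn m t (u : L2n d n)] with k h1 h2
  refine h1.trans ?_
  rw [Pi.sub_apply, h2]
  push_cast
  ring

theorem one_sub_heatFactor_nonneg {d n : ℕ} (m : ℝ) (t : ℝ≥0) (k : Fin n → Rd d) :
    0 ≤ 1 - heatFactor d m t k :=
  sub_nonneg.2 ((le_abs_self _).trans (abs_heatFactor_le k))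

theorem one_sub_heatFactor_le {d n : ℕ} (m : ℝ) (t : ℝ≥0) (k : Fin n → Rd d) :
    1 - heatFactor d m t k ≤ t * ∑ j, omega d m (k j) := by
  have := Real.add_one_le_exp (-((t : ℝ) * ∑ j, omega d m (k j)))
  rw [heatFactor]
  linarith

theorem norm_sub_sectorHeat_le {d n : ℕ} (m : ℝ) (t : ℝ≥0) (u : sumMulDomain d (omega d m) n) :
    ‖u.1 - sectorHeat d m t n u.1‖ ≤ t * ‖sumMulToFun (omega d m) u‖ := by
  refine Lp.norm_le_mul_norm_of_ae_le_mul (f := ((u.1 - sectorHeat d m t n u.1 : symL2 d n) : L2n d n))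
    (g := ((sumMulToFun (omega d m) u : symL2 d n) : L2n d n)) ?_
  filter_upwards [coe_sub_sectorHeat m t u.1, sumMulToFun_coeFn (omega d m) u] with k h1 h2
  rw [h1, h2, norm_mul, norm_mul, ← mul_assoc, Complex.norm_real, Complex.norm_real,
    Real.norm_of_nonneg (one_sub_heatFactor_nonneg m t k),
    Real.norm_of_nonneg (Finset.sum_nonneg fun j _ => omega_nonneg d m _)]
  exact mul_le_mul_of_nonneg_right (one_sub_heatFactor_le m t k) (norm_nonneg _)

/-- The derivative at zero of `s ↦ -exp(-s Ω)`. -/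
theorem tendsto_one_sub_heatFactor_div {d n : ℕ} (m : ℝ) (k : Fin n → Rd d) :
    Filter.Tendsto (fun j => (1 - heatFactor d m (time j) k) / (time j : ℝ)) Filter.atTop
      (nhds (∑ i, omega d m (k i))) := by
  set Ω := ∑ i, omega d m (k i) with hΩ
  have h : HasDerivAt (fun s : ℝ => -Real.exp (-(s * Ω))) Ω 0 := by
    have h1 : HasDerivAt (fun s : ℝ => -(s * Ω)) (-(1 * Ω)) 0 :=
      ((hasDerivAt_id (0 : ℝ)).mul_const Ω).fun_neg
    have h2 := h1.exp.fun_neg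
    rwa [zero_mul, neg_zero, Real.exp_zero, one_mul, one_mul, neg_neg] at h2
  have h2 := (hasDerivAt_iff_tendsto_slope_zero.1 h).comp (tendsto_nhdsWithin_iff.2
    ⟨tendsto_time, Filter.Eventually.of_forall fun j =>
      NNReal.coe_ne_zero.2 (time_pos j).ne'⟩)
  refine h2.congr fun j => ?_
  simp only [Function.comp, zero_add, zero_mul, neg_zero, Real.exp_zero, heatFactor, smul_eq_mul]
  ring

/-- Dominated convergence within one sector: the difference quotient never exceeds the sum of the
energies, and `u` lies in the domain of multiplication by that sum. -/
theorem tendsto_re_inner_sub_sectorHeat_div {d n : ℕ} (m : ℝ) (u : sumMulDomain d (omega d m) n)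
    (v : symL2 d n) :
    Filter.Tendsto (fun j => (inner ℂ (u.1 - sectorHeat d m (time j) n u.1) v : ℂ).re / (time j : ℝ))
      Filter.atTop (nhds (inner ℂ (sumMulToFun (omega d m) u) v : ℂ).re) := by
  set w : L2n d n := ((sumMulToFun (omega d m) u : symL2 d n) : L2n d n)
  have key : Filter.Tendsto (fun j => ∫ k, (((1 - heatFactor d m (time j) k) / (time j : ℝ) : ℝ) : ℂ) *
      inner ℂ ((u.1 : L2n d n) k) ((v : L2n d n) k)) Filter.atTop (nhds (inner ℂ w (v : L2n d n))) := by
    rw [L2.inner_def]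
    refine tendsto_integral_of_dominated_convergence (fun k => ‖w k‖ * ‖(v : L2n d n) k‖)
      (fun j => ?_) ?_ (fun j => ?_) ?_
    · have := measurable_heatFactor d m (time j) n
      exact (by fun_prop : Measurable fun k : Fin n → Rd d =>
        (((1 - heatFactor d m (time j) k) / (time j : ℝ) : ℝ) : ℂ)).aestronglyMeasurable.mul
        ((Lp.aestronglyMeasurable _).inner (Lp.aestronglyMeasurable _))
    · exact (Lp.memLp w).norm.integrable_mul (Lp.memLp (v : L2n d n)).norm
    · filter_upwards [sumMulToFun_coeFn (omega d m) u] with k hk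
      have hj : (0 : ℝ) < time j := time_pos j
      have hw : w k = ((∑ i, omega d m (k i) : ℝ) : ℂ) * (u.1 : L2n d n) k := hk
      rw [norm_mul, hw, norm_mul, mul_assoc, Complex.norm_real, Complex.norm_real,
        Real.norm_of_nonneg (div_nonneg (one_sub_heatFactor_nonneg m _ k) hj.le),
        Real.norm_of_nonneg (Finset.sum_nonneg fun j _ => omega_nonneg d m _)]
      refine mul_le_mul ?_ (norm_inner_le_norm _ _) (norm_nonneg _)
        (Finset.sum_nonneg fun j _ => omega_nonneg d m _)
      rw [div_le_iff₀ hj, mul_comm]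
      exact one_sub_heatFactor_le m _ k
    · filter_upwards [sumMulToFun_coeFn (omega d m) u] with k hk
      have hw : w k = ((∑ i, omega d m (k i) : ℝ) : ℂ) * (u.1 : L2n d n) k := hk
      rw [hw, ← smul_eq_mul (a := ((∑ i, omega d m (k i) : ℝ) : ℂ)), inner_smul_left,
        Complex.conj_ofReal]
      exact ((Complex.continuous_ofReal.tendsto _).comp
        (tendsto_one_sub_heatFactor_div m k)).mul_const _
  refine ((Complex.continuous_re.tendsto _).comp key).congr fun j => ?_
  have e : inner ℂ (u.1 - sectorHeat d m (time j) n u.1) v = ((time j : ℝ) : ℂ) *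
      ∫ k, (((1 - heatFactor d m (time j) k) / (time j : ℝ) : ℝ) : ℂ) *
      inner ℂ ((u.1 : L2n d n) k) ((v : L2n d n) k) := by
    rw [Submodule.coe_inner, L2.inner_def, ← integral_const_mul]
    refine integral_congr_ae ?_
    filter_upwards [coe_sub_sectorHeat m (time j) u.1] with k hk
    rw [hk, ← smul_eq_mul (a := ((1 - heatFactor d m (time j) k : ℝ) : ℂ)), inner_smul_left,
      Complex.conj_ofReal, ← mul_assoc, ← Complex.ofReal_mul, mul_div_cancel₀]
    exact NNReal.coe_ne_zero.2 (time_pos j).ne'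
  rw [e, Complex.re_ofReal_mul, mul_div_cancel_left₀ _ (NNReal.coe_ne_zero.2 (time_pos j).ne')]
  rfl

theorem sectorEnergy_sq {d n : ℕ} (m : ℝ) (u : sumMulDomain d (omega d m) n) :
    sectorEnergy (fun y => sqrtOmega d m y ^ 2) (fun x => x * x) (u.1 : L2n d n) =
      ‖sumMulToFun (omega d m) u‖ₑ ^ 2 := by
  refine Eq.trans ?_
    (enorm_sq_eq_lintegral ((sumMulToFun (omega d m) u : symL2 d n) : L2n d n)).symm
  rw [sectorEnergy]
  refine lintegral_congr_ae ?_
  filter_upwards [sumMulToFun_coeFn (omega d m) u] with k hk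
  rw [hk, enorm_mul, mul_pow, sum_sqrtOmega_sq, ← sq,
    ← ofReal_norm (((∑ j, omega d m (k j) : ℝ) : ℂ)), Complex.norm_real,
    Real.norm_of_nonneg (Finset.sum_nonneg fun j _ => omega_nonneg d m _)]

theorem sectorEnergy_id {d n : ℕ} (m : ℝ) (u : sumMulDomain d (omega d m) n) :
    0 ≤ (inner ℂ u.1 (sumMulToFun (omega d m) u) : ℂ).re ∧
    sectorEnergy (fun y => sqrtOmega d m y ^ 2) (fun x => x) (u.1 : L2n d n) =
      ENNReal.ofReal (inner ℂ u.1 (sumMulToFun (omega d m) u) : ℂ).re := by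
  set g : (Fin n → Rd d) → ℝ := fun k => (∑ i, omega d m (k i)) * ‖(u.1 : L2n d n) k‖ ^ 2
  have hg : ∀ k, 0 ≤ g k := fun k =>
    mul_nonneg (Finset.sum_nonneg fun j _ => omega_nonneg d m _) (sq_nonneg _)
  have h0 : (fun k => inner ℂ ((u.1 : L2n d n) k)
      (((sumMulToFun (omega d m) u : symL2 d n) : L2n d n) k)) =ᵐ[volume] fun k => (g k : ℂ) := by
    filter_upwards [sumMulToFun_coeFn (omega d m) u] with k hk
    rw [hk, ← smul_eq_mul (a := ((∑ i, omega d m (k i) : ℝ) : ℂ)), inner_smul_right,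
      inner_self_eq_norm_sq_to_K]
    rw [Complex.ofReal_mul, Complex.ofReal_pow]
    rfl
  have hi : Integrable (fun k => (g k : ℂ)) :=
    (L2.integrable_inner (𝕜 := ℂ) (u.1 : L2n d n)
      ((sumMulToFun (omega d m) u : symL2 d n) : L2n d n)).congr h0
  have h1 : (inner ℂ u.1 (sumMulToFun (omega d m) u) : ℂ).re = ∫ k, g k := by
    rw [Submodule.coe_inner, L2.inner_def, integral_congr_ae h0, integral_complex_ofReal]
    exact Complex.ofReal_re _
  rw [h1]
  refine ⟨integral_nonneg hg, ?_⟩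
  rw [ofReal_integral_eq_lintegral_ofReal (by simpa using hi.re) (Filter.Eventually.of_forall hg),
    sectorEnergy]
  refine lintegral_congr fun k => ?_
  rw [sum_sqrtOmega_sq, ENNReal.ofReal_mul (Finset.sum_nonneg fun j _ => omega_nonneg d m _),
    ENNReal.ofReal_pow (norm_nonneg _), ofReal_norm]

theorem exists_freeHamiltonian_apply {d : ℕ} {m : ℝ} (Ψ : (freeHamiltonian d m).domain) :
    ∃ h : ∀ n, (Ψ : Fock d) n ∈ sumMulDomain d (omega d m) n,
      ∀ n, freeHamiltonian d m Ψ n = sumMulToFun (omega d m) ⟨(Ψ : Fock d) n, h n⟩ :=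
  ⟨fun n => Ψ.2.choose n, fun _ => rfl⟩

theorem energy_sq_eq {d : ℕ} {m : ℝ} (Ψ : (freeHamiltonian d m).domain) :
    energy (fun y => sqrtOmega d m y ^ 2) (fun x => x * x) (Ψ : Fock d) =
      ENNReal.ofReal ‖freeHamiltonian d m Ψ‖ ^ 2 := by
  obtain ⟨h, hh⟩ := exists_freeHamiltonian_apply Ψ
  rw [ofReal_norm, enorm_sq_eq_tsum, energy]
  refine tsum_congr fun n => ?_
  rw [hh]
  exact sectorEnergy_sq m ⟨(Ψ : Fock d) n, h n⟩

theorem energy_id_eq {d : ℕ} {m : ℝ} (Ψ : (freeHamiltonian d m).domain) :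
    0 ≤ (inner ℂ (Ψ : Fock d) (freeHamiltonian d m Ψ) : ℂ).re ∧
    energy (fun y => sqrtOmega d m y ^ 2) (fun x => x) (Ψ : Fock d) =
      ENNReal.ofReal (Real.sqrt (inner ℂ (Ψ : Fock d) (freeHamiltonian d m Ψ) : ℂ).re) ^ 2 := by
  obtain ⟨h, hh⟩ := exists_freeHamiltonian_apply Ψ
  have hs := Complex.hasSum_re (lp.hasSum_inner (𝕜 := ℂ) (Ψ : Fock d) (freeHamiltonian d m Ψ))
  have h0 : ∀ n, 0 ≤ (inner ℂ ((Ψ : Fock d) n) (freeHamiltonian d m Ψ n) : ℂ).re := fun n => by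
    rw [hh]
    exact (sectorEnergy_id m ⟨(Ψ : Fock d) n, h n⟩).1
  have h1 := hs.nonneg h0
  refine ⟨h1, ?_⟩
  rw [← ENNReal.ofReal_pow (Real.sqrt_nonneg _), Real.sq_sqrt h1, ← hs.tsum_eq,
    ENNReal.ofReal_tsum_of_nonneg h0 hs.summable, energy]
  refine tsum_congr fun n => ?_
  rw [hh]
  exact (sectorEnergy_id m ⟨(Ψ : Fock d) n, h n⟩).2

theorem energy_add {d : ℕ} {θ : Rd d → ℝ≥0∞} (hθ : Measurable θ) {w w' : ℝ≥0∞ → ℝ≥0∞}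
    (hw : Measurable w) (Ψ : Fock d) :
    energy θ (fun x => w x + w' x) Ψ = energy θ w Ψ + energy θ w' Ψ := by
  simp only [energy]
  rw [← ENNReal.tsum_add]
  refine tsum_congr fun n => ?_
  simp only [sectorEnergy, add_mul]
  exact lintegral_add_left ((hw.comp (measurable_sum_comp hθ)).mul (measurable_enorm_sq _)) _

/-- The square root of the energy of the components with at least `N` particles. -/
def tailEnergy {d : ℕ} (m : ℝ) (Ψ : Fock d) (N : ℕ) : ℝ :=
  Real.sqrt (∑' k, sectorEnergy (fun y => sqrtOmega d m y ^ 2) (fun x => 1 + x + x * x)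
    (Ψ (k + N) : L2n d (k + N))).toReal

/-- The three weights give `‖Ψ‖²`, `⟨Ψ, H₀Ψ⟩` and `‖H₀Ψ‖²`, all finite on the domain of `H₀`. -/
theorem energy_ne_top {d : ℕ} {m : ℝ} (Ψ : (freeHamiltonian d m).domain) :
    ∑' k, sectorEnergy (fun y => sqrtOmega d m y ^ 2) (fun x => 1 + x + x * x)
      ((Ψ : Fock d) k : L2n d k) ≠ ∞ := by
  have hθ := (measurable_sqrtOmega d m).pow_const 2
  have h := energy_add hθ (w := fun x => 1 + x) (w' := fun x => x * x) (by fun_prop) (Ψ : Fock d)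
  rw [energy_add hθ (w := fun _ => 1) (w' := fun x => x) (by fun_prop), energy_one, energy_sq_eq,
    (energy_id_eq Ψ).2] at h
  refine ne_of_eq_of_ne h ?_
  finiteness

theorem tendsto_tailEnergy {d : ℕ} {m : ℝ} (Ψ : (freeHamiltonian d m).domain) :
    Filter.Tendsto (tailEnergy m (Ψ : Fock d)) Filter.atTop (nhds 0) := by
  have h := (ENNReal.tendsto_toReal ENNReal.zero_ne_top).comp
    (ENNReal.tendsto_sum_nat_add _ (energy_ne_top Ψ))
  have h2 := (Real.continuous_sqrt.tendsto _).comp h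
  rw [ENNReal.toReal_zero, Real.sqrt_zero] at h2
  exact h2

theorem tailEnergy_sq {d : ℕ} {m : ℝ} (Ψ : (freeHamiltonian d m).domain) (N : ℕ) :
    ∑' k, sectorEnergy (fun y => sqrtOmega d m y ^ 2) (fun x => 1 + x + x * x)
      ((Ψ : Fock d) (k + N) : L2n d (k + N)) ≤ ENNReal.ofReal (tailEnergy m (Ψ : Fock d) N) ^ 2 := by
  have hle : ∑' k, sectorEnergy (fun y => sqrtOmega d m y ^ 2) (fun x => 1 + x + x * x)
      ((Ψ : Fock d) (k + N) : L2n d (k + N)) ≠ ∞ :=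
    ne_top_of_le_ne_top (energy_ne_top Ψ)
      (ENNReal.tsum_comp_le_tsum_of_injective (add_left_injective N) _)
  rw [tailEnergy, ← ENNReal.ofReal_pow (Real.sqrt_nonneg _), Real.sq_sqrt ENNReal.toReal_nonneg,
    ENNReal.ofReal_toReal hle]

/-! ### The lower bound for the cross term -/

theorem tendsto_norm_heatDiff_rho {d : ℕ} {m : ℝ} {χb : Rd d → ℂ}
    (hb : ∀ l : ℕ, l ≤ 2 → MemLp (fun k => χb k / (Real.sqrt (omega d m k) : ℂ) ^ l) 2 volume) :
    Filter.Tendsto (fun j => ‖heatDiff m (time j) (toL2 (rho m χb 0))‖) Filter.atTop (nhds 0) := by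
  have h := (tendsto_norm_heatDiff_rho_sq_div hb).mul tendsto_time
  rw [zero_mul] at h
  have h2 := (Real.continuous_sqrt.tendsto _).comp h
  rw [Real.sqrt_zero] at h2
  refine h2.congr fun j => ?_
  have hj : (time j : ℝ) ≠ 0 := NNReal.coe_ne_zero.2 (time_pos j).ne'
  rw [Function.comp, div_mul_cancel₀ _ hj, Real.sqrt_sq (norm_nonneg _)]

/-- The expression equals `γ √t`. -/
theorem tendsto_time_mul_sqrt (γ : ℝ) :
    Filter.Tendsto (fun j => (time j : ℝ) * γ * Real.sqrt (1 / (time j : ℝ))) Filter.atTop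
      (nhds 0) := by
  have h := ((Real.continuous_sqrt.tendsto _).comp tendsto_time).const_mul γ
  rw [Real.sqrt_zero, mul_zero] at h
  refine h.congr fun j => ?_
  have hj : (0 : ℝ) < time j := time_pos j
  have e : (time j : ℝ) = Real.sqrt (time j) * Real.sqrt (time j) := (Real.mul_self_sqrt hj.le).symm
  have e2 : Real.sqrt (time j : ℝ) ≠ 0 := (Real.sqrt_pos.2 hj).ne'
  rw [Function.comp, one_div, Real.sqrt_inv, ← div_eq_mul_inv, eq_div_iff e2]
  nth_rewrite 3 [e]
  ring

theorem tendsto_fieldConst {α β : ℝ} {r : ℕ → ℝ}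
    (hr : Filter.Tendsto r Filter.atTop (nhds 0)) :
    Filter.Tendsto (fun N => fieldConst α β (r N) (r N) (r N)) Filter.atTop (nhds 0) := by
  have hc : Continuous fun r : ℝ => fieldConst α β r r r := by
    unfold fieldConst
    fun_prop
  have h := (hc.tendsto 0).comp hr
  have h0 : fieldConst α β 0 0 0 = 0 := by
    unfold fieldConst
    ring
  rwa [h0] at h

/-- If the quartic form of the field at each point is bounded below, so is the matrix element of the
closure of the interaction. -/
theorem re_inner_closure_interaction_ge {d : ℕ} {m : ℝ} {χb : Rd d → ℂ} {χI : Rd d → ℝ}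
    (hI : Integrable χI volume) (hI0 : ∀ᵐ x ∂volume, 0 ≤ χI x) {β : ℝ}
    (hβ : ∀ x, ‖toL2 (rho m χb x)‖ ≤ β) (Φ : FiniteFock d)
    (Ψ : (interaction m χb χI).closure.domain) {B : ℝ}
    (hB : ∀ x, B ≤ (inner ℂ ((fieldSum (toL2 (rho m χb x)))^[4] Φ).val (Ψ : Fock d) : ℂ).re) :
    (∫ x, |χI x|) / 4 * B ≤ (inner ℂ Φ.val ((interaction m χb χI).closure Ψ) : ℂ).re := by
  obtain ⟨h1, h2⟩ := inner_closure_interaction m χb hI hβ Φ Ψ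
  have e1 : ∫ x, |χI x| = ∫ x, χI x :=
    integral_congr_ae (hI0.mono fun x hx => abs_of_nonneg hx)
  have e2 : (∫ x, χI x) / 4 * B = ∫ x, χI x * (1 / 4 * B) := by
    rw [integral_mul_const]
    ring
  have e3 := integral_re h1
  simp only [RCLike.re_to_complex] at e3
  rw [e1, h2, ← e3, e2]
  -- The nonnegativity of `χ_I` is what allows the pointwise lower bound to be integrated.
  refine integral_mono_ae (hI.mul_const _) h1.re ?_
  filter_upwards [hI0] with x hx
  have e4 : inner ℂ (((1 / 4 : ℝ) : ℂ) • (fieldSum (toL2 (rho m χb x)))^[4] Φ).val (Ψ : Fock d) =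
      ((1 / 4 : ℝ) : ℂ) * inner ℂ ((fieldSum (toL2 (rho m χb x)))^[4] Φ).val (Ψ : Fock d) := by
    refine (inner_smul_left _ _ _).trans ?_
    rw [Complex.conj_ofReal]
    rfl
  rw [e4, Complex.re_ofReal_mul, Complex.re_ofReal_mul]
  have := hB x
  gcongr

/-- The pointwise bound on the quartic form, integrated over `x`, is fed into the limiting argument
with `Θ = H₀Ψ` and `Y = H_I Ψ`. The factor `1/4` is `(1/√2)⁴` from the normalization of the field.
-/
theorem re_inner_freeHamiltonian_interaction_ge {d : ℕ} {m : ℝ} {χb : Rd d → ℂ} {χI : Rd d → ℝ}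
    (hb : ∀ l : ℕ, l ≤ 2 → MemLp (fun k => χb k / (Real.sqrt (omega d m k) : ℂ) ^ l) 2 volume)
    (hI : Integrable χI volume) (hI0 : ∀ᵐ x ∂volume, 0 ≤ χI x) {Ψ : Fock d}
    (h0 : Ψ ∈ (freeHamiltonian d m).domain) (hΨ : Ψ ∈ (interaction m χb χI).closure.domain) :
    -((∫ x, |χI x|) / 4 * (4 * cutoffNorm m χb 0 ^ 2 * (4 * (cutoffNorm m χb 2 ^ 2 *
        (inner ℂ Ψ (freeHamiltonian d m ⟨Ψ, h0⟩) : ℂ).re) +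
          2 * (cutoffNorm m χb 1 ^ 2 * ‖Ψ‖ ^ 2)))) ≤
      (inner ℂ (freeHamiltonian d m ⟨Ψ, h0⟩) ((interaction m χb χI).closure ⟨Ψ, hΨ⟩) : ℂ).re := by
  obtain ⟨hq, hid⟩ := energy_id_eq ⟨Ψ, h0⟩
  have hsq := energy_sq_eq ⟨Ψ, h0⟩
  obtain ⟨hs, hh⟩ := exists_freeHamiltonian_apply ⟨Ψ, h0⟩
  set h := Real.sqrt (inner ℂ Ψ (freeHamiltonian d m ⟨Ψ, h0⟩) : ℂ).re with hh'
  have hh2 : h ^ 2 = (inner ℂ Ψ (freeHamiltonian d m ⟨Ψ, h0⟩) : ℂ).re := Real.sq_sqrt hq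
  rw [← hh2, ← mul_pow]
  set α := cutoffNorm m χb 2
  set β := cutoffNorm m χb 1
  set γ := cutoffNorm m χb 0
  set H := ‖freeHamiltonian d m ⟨Ψ, h0⟩‖
  set p := ‖Ψ‖
  set L := ∫ x, |χI x|
  have hα : 0 ≤ α := ENNReal.toReal_nonneg
  have hγ : 0 ≤ γ := ENNReal.toReal_nonneg
  have hL : 0 ≤ L := integral_nonneg fun x => abs_nonneg _
  have hβ : ∀ x, ‖toL2 (rho m χb x)‖ = β := norm_toL2_rho (hb 1 one_le_two)
  have hη : ∀ j x, ‖heatDiff m (time j) (toL2 (rho m χb x))‖ =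
      ‖heatDiff m (time j) (toL2 (rho m χb 0))‖ := fun j x =>
    norm_heatDiff_rho_eq (hb 1 one_le_two) (time j) x
  have he := (tendsto_commutatorError α β γ h H p tendsto_time (tendsto_time_mul_sqrt γ)
    (tendsto_norm_heatDiff_rho hb) (tendsto_norm_heatDiff_rho_sq_div hb)).const_mul (L / 4)
  have hr := (tendsto_fieldConst (α := α) (β := β) (tendsto_tailEnergy ⟨Ψ, h0⟩)).const_mul
    (L / 4 * (2 * fieldConst α β h H p))
  rw [mul_zero] at he hr
  refine re_inner_ge_of_trunc (D := fun j n => sectorHeat d m (time j) n)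
    (t := fun j => (time j : ℝ)) (Ψ := Ψ) (fun j => time_pos j) (fun j n => ?_) (fun n => ?_) he hr
    (fun N j => ?_)
  · rw [hh]
    exact norm_sub_sectorHeat_le m (time j) ⟨Ψ n, hs n⟩
  · rw [hh]
    exact tendsto_re_inner_sub_sectorHeat_div m ⟨Ψ n, hs n⟩ _
  -- All norms entering `B` are independent of `x`, so one constant serves the whole integral.
  · set B := -((time j : ℝ) * (4 * γ ^ 2 * (4 * (α * h) ^ 2 + 2 * (β ^ 2 * p ^ 2)))) -
      time j * commutatorError α β γ h H p (time j) (time j * γ * Real.sqrt (1 / time j))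
        ‖heatDiff m (time j) (toL2 (rho m χb 0))‖
        (‖heatDiff m (time j) (toL2 (rho m χb 0))‖ ^ 2 / time j) -
      2 * fieldConst α β h H p *
        fieldConst α β (tailEnergy m Ψ N) (tailEnergy m Ψ N) (tailEnergy m Ψ N) with hBdef
    have hB : ∀ x, B ≤ (inner ℂ ((fieldSum (toL2 (rho m χb x)))^[4]
        (trunc N Ψ - heat d m (time j) (trunc N Ψ))).val Ψ : ℂ).re := fun x => by
      have := re_inner_fieldSum_pow_four_ge hα hγ (Real.sqrt_nonneg _) (norm_nonneg _)
        (Real.sqrt_nonneg _) (time_pos j) (weightBound_rho hb x)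
        (weightBound_heatDiff_rho hb (time j) x) (re_inner_heatDiff_rho_le hb (time j) x)
        hid.le hsq.le le_rfl N (tailEnergy_sq ⟨Ψ, h0⟩ N)
      rw [hβ, hη] at this
      exact this
    refine le_trans (le_of_eq ?_) (re_inner_closure_interaction_ge hI hI0 (fun x => (hβ x).le)
      (trunc N Ψ - heat d m (time j) (trunc N Ψ)) ⟨Ψ, hΨ⟩ hB)
    rw [hBdef]
    ring

/-! ### Young's inequality and the expansion of the square -/

theorem cb_nonneg {d : ℕ} (m : ℝ) (χb : Rd d → ℂ) (χI : Rd d → ℝ) : 0 ≤ cb m χb χI := by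
  have hL : 0 ≤ ∫ x, |χI x| := integral_nonneg fun x => abs_nonneg _
  unfold cb
  positivity

/-- The cross term is bounded below by the free energy and the norm. -/
theorem two_mul_re_inner_ge {d : ℕ} {m : ℝ} {χb : Rd d → ℂ} {χI : Rd d → ℝ}
    (hb : ∀ l : ℕ, l ≤ 2 → MemLp (fun k => χb k / (Real.sqrt (omega d m k) : ℂ) ^ l) 2 volume)
    (hI : Integrable χI volume) (hI0 : ∀ᵐ x ∂volume, 0 ≤ χI x) {Ψ : Fock d}
    (h0 : Ψ ∈ (freeHamiltonian d m).domain) (hΨ : Ψ ∈ (interaction m χb χI).closure.domain)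
    {ε : ℝ} (hε : 0 < ε) :
    -(cb m χb χI * (ε * ‖freeHamiltonian d m ⟨Ψ, h0⟩‖ ^ 2) +
        (4 * db m χb χI + cb m χb χI / (4 * ε)) * ‖Ψ‖ ^ 2) ≤
      2 * (inner ℂ (freeHamiltonian d m ⟨Ψ, h0⟩) ((interaction m χb χI).closure ⟨Ψ, hΨ⟩) : ℂ).re := by
  have key := re_inner_freeHamiltonian_interaction_ge hb hI hI0 h0 hΨ
  have hq := (energy_id_eq ⟨Ψ, h0⟩).1
  have hle : (inner ℂ Ψ (freeHamiltonian d m ⟨Ψ, h0⟩) : ℂ).re ≤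
      ‖Ψ‖ * ‖freeHamiltonian d m ⟨Ψ, h0⟩‖ :=
    (Complex.re_le_norm _).trans (norm_inner_le_norm _ _)
  change 0 ≤ (inner ℂ Ψ (freeHamiltonian d m ⟨Ψ, h0⟩) : ℂ).re at hq
  generalize (inner ℂ Ψ (freeHamiltonian d m ⟨Ψ, h0⟩) : ℂ).re = q at *
  generalize ‖freeHamiltonian d m ⟨Ψ, h0⟩‖ = H at *
  generalize (inner ℂ (freeHamiltonian d m ⟨Ψ, h0⟩)
    ((interaction m χb χI).closure ⟨Ψ, hΨ⟩) : ℂ).re = R at *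
  have hcb := cb_nonneg m χb χI
  -- Young's inequality, with the remainder completed to a square.
  have hyoung : q ≤ ε * H ^ 2 + 1 / (4 * ε) * ‖Ψ‖ ^ 2 := by
    refine hle.trans ?_
    have h1 : ε * H ^ 2 + 1 / (4 * ε) * ‖Ψ‖ ^ 2 - ‖Ψ‖ * H = (2 * ε * H - ‖Ψ‖) ^ 2 / (4 * ε) := by
      field_simp
      ring
    have h2 : 0 ≤ (2 * ε * H - ‖Ψ‖) ^ 2 / (4 * ε) := by positivity
    linarith
  have h3 : (∫ x, |χI x|) / 4 * (4 * cutoffNorm m χb 0 ^ 2 * (4 * (cutoffNorm m χb 2 ^ 2 * q) +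
      2 * (cutoffNorm m χb 1 ^ 2 * ‖Ψ‖ ^ 2))) =
      cb m χb χI / 4 * q + 2 * db m χb χI * ‖Ψ‖ ^ 2 := by
    unfold cb db
    ring
  rw [h3] at key
  have h4 := mul_le_mul_of_nonneg_left hyoung hcb
  have h5 := mul_nonneg hcb hq
  have h6 : cb m χb χI * (ε * H ^ 2 + 1 / (4 * ε) * ‖Ψ‖ ^ 2) =
      cb m χb χI * (ε * H ^ 2) + cb m χb χI / (4 * ε) * ‖Ψ‖ ^ 2 := by ring
  -- Doubling `key` yields only `c_b / 2` in front of `q`; as `q ≥ 0`, this is enlarged to `c_b`.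
  nlinarith

/-- In the expansion of the square, the cross term is linear in `κ`, so the bound for it is scaled
by `κ > 0`. -/
theorem norm_hamiltonian_ge {d : ℕ} {m : ℝ} {χb : Rd d → ℂ} {χI : Rd d → ℝ}
    (hb : ∀ l : ℕ, l ≤ 2 → MemLp (fun k => χb k / (Real.sqrt (omega d m k) : ℂ) ^ l) 2 volume)
    (hI : Integrable χI volume) (hI0 : ∀ᵐ x ∂volume, 0 ≤ χI x) {κ : ℝ} (hκ : 0 < κ) {ε : ℝ}
    (hε : 0 < ε) (Ψ : Fock d) (hΨ : Ψ ∈ (hamiltonian m χb χI κ).domain) :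
    (1 - cb m χb χI * ε * κ) * ‖freeHamiltonian d m ⟨Ψ, hΨ.1⟩‖ ^ 2 +
        ‖scaledInteraction m χb χI κ ⟨Ψ, hΨ.2⟩‖ ^ 2 ≤
      ‖hamiltonian m χb χI κ ⟨Ψ, hΨ⟩‖ ^ 2 +
        (4 * db m χb χI + cb m χb χI / (4 * ε)) * κ * ‖Ψ‖ ^ 2 := by
  have key := two_mul_re_inner_ge hb hI hI0 hΨ.1 hΨ.2 hε
  have e : hamiltonian m χb χI κ ⟨Ψ, hΨ⟩ =
      freeHamiltonian d m ⟨Ψ, hΨ.1⟩ + scaledInteraction m χb χI κ ⟨Ψ, hΨ.2⟩ := rfl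
  have e2 : scaledInteraction m χb χI κ ⟨Ψ, hΨ.2⟩ =
      (κ : ℂ) • (interaction m χb χI).closure ⟨Ψ, hΨ.2⟩ := rfl
  have e3 := norm_add_sq (𝕜 := ℂ) (freeHamiltonian d m ⟨Ψ, hΨ.1⟩)
    (scaledInteraction m χb χI κ ⟨Ψ, hΨ.2⟩)
  have e4 : (inner ℂ (freeHamiltonian d m ⟨Ψ, hΨ.1⟩)
      (scaledInteraction m χb χI κ ⟨Ψ, hΨ.2⟩) : ℂ).re = κ *
      (inner ℂ (freeHamiltonian d m ⟨Ψ, hΨ.1⟩)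
        ((interaction m χb χI).closure ⟨Ψ, hΨ.2⟩) : ℂ).re := by
    rw [e2, inner_smul_right, Complex.re_ofReal_mul]
  rw [RCLike.re_to_complex, e4] at e3
  rw [e, e3]
  have h := mul_le_mul_of_nonneg_left key hκ.le
  linarith

end PhiFour

end

theorem mainTheorem2 (d : ℕ) (hd : 0 < d) (m : ℝ) (hm : 0 ≤ m)
    (χb : PhiFour.Rd d → ℂ) (χI : PhiFour.Rd d → ℝ)
    (hb : ∀ l : ℕ, l ≤ 2 →
      MemLp (fun k => χb k / (Real.sqrt (PhiFour.omega d m k) : ℂ) ^ l) 2 volume)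
    (hI : Integrable χI volume) (hI_nonneg : ∀ᵐ x ∂volume, 0 ≤ χI x)
    (κ : ℝ) (hκ : 0 < κ) :
    (∀ ε : ℝ, 0 < ε →
      ∀ Ψ : PhiFour.Fock d, ∀ hΨ : Ψ ∈ (PhiFour.hamiltonian m χb χI κ).domain,
        (1 - PhiFour.cb m χb χI * ε * κ) * ‖PhiFour.freeHamiltonian d m ⟨Ψ, hΨ.1⟩‖ ^ 2
            + ‖PhiFour.scaledInteraction m χb χI κ ⟨Ψ, hΨ.2⟩‖ ^ 2
          ≤ ‖PhiFour.hamiltonian m χb χI κ ⟨Ψ, hΨ⟩‖ ^ 2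
            + (4 * PhiFour.db m χb χI + PhiFour.cb m χb χI / (4 * ε)) * κ * ‖Ψ‖ ^ 2) ∧
    (∀ ε : ℝ, 0 < ε → PhiFour.cb m χb χI * ε * κ < 1 →
      ∀ Ψ : PhiFour.Fock d, ∀ hΨ : Ψ ∈ (PhiFour.hamiltonian m χb χI κ).domain,
        ‖PhiFour.freeHamiltonian d m ⟨Ψ, hΨ.1⟩‖ ^ 2
            + ‖PhiFour.scaledInteraction m χb χI κ ⟨Ψ, hΨ.2⟩‖ ^ 2
          ≤ PhiFour.lambdaConst m χb χI ε κ * ‖PhiFour.hamiltonian m χb χI κ ⟨Ψ, hΨ⟩‖ ^ 2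
            + PhiFour.muConst m χb χI ε κ * ‖Ψ‖ ^ 2) := by
  have h := fun (ε : ℝ) (hε : 0 < ε) => PhiFour.norm_hamiltonian_ge hb hI hI_nonneg hκ hε
  refine ⟨h, fun ε hε hlt Ψ hΨ => ?_⟩
  have h1 : 0 < 1 - PhiFour.cb m χb χI * ε * κ := sub_pos.2 hlt
  have h2 : 0 ≤ PhiFour.cb m χb χI * ε * κ :=
    mul_nonneg (mul_nonneg (PhiFour.cb_nonneg m χb χI) hε.le) hκ.le
  -- This lets the coefficient 1 of the interaction term be lowered to `1 - c_b ε κ`, after which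
  -- the whole inequality is divided by this positive number.
  have h3 := mul_nonneg h2 (sq_nonneg ‖PhiFour.scaledInteraction m χb χI κ ⟨Ψ, hΨ.2⟩‖)
  have h4 := h ε hε Ψ hΨ
  rw [PhiFour.lambdaConst, PhiFour.muConst, div_mul_eq_mul_div, div_mul_eq_mul_div,
    div_mul_eq_mul_div, one_mul, ← add_div, le_div_iff₀ h1]
  linarith
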